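/- **Notation.** Let $Q=\{(x,t)\in\mathbb R^2: x>0,\ t>0\}$, $\overline Q=\{x\ge 0,\ t\ge 0\}$. All functions are complex-valued. * $\mathcal S([0,\infty))$ is the space of $u\in C^\infty([0,\infty))$ with $\rho_N(u)=\sup\{(1+x)^N|u^{(k)}(x)|: k\le N,\ x\ge0\}<\infty$ for all $N\ge 0$, with the topology of the norms $\rho_N$. * $C^\infty([0,\infty))$ has the topology of the seminorms $\sup\{|g^{(l)}(t)|:0\le t\le n\}$, $l\ge0$, $n\ge1$. * For $D=\overline Q$ or $D=\overline Q\setminus\{(0,0)\}$, $C^\infty(D)$ is the set of functions $h$ on $D$ that are $C^\infty$ in $Q$, all of whose partial derivatives $\partial_x^k\partial_t^l h$ (including $h$ itself) have limits from within $Q$ at all points of $D$, these limits being the values of $h$ and of its derivatives on $D$, the boundary values being $C^\infty$ along each of the two edges. * $\mathcal S_1(\overline Q\setminus\{(0,0)\})$ is the space of $h\in C^\infty(\overline Q\setminus\{(0,0)\})$ with $\lambda_n(h)=\sup\{(1+x)^n|\partial_x^k\partial_t^l h(x,t)|:(x,t)\in\Lambda_n,\ k+l\le n\}<\infty$ for all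 $n\ge1$, where $\Lambda_n=\{(x,t)\in\overline Q:\frac1n\le t\le n\}\cup\{(x,t)\in\overline Q: x\ge\frac1n,\ t\le\frac1n\}$; $\mathcal S_1(\overline Q)$ is defined in the same way from $C^\infty(\overline Q)$ and the sets $\Lambda_n^*=\{(x,t)\in\overline Q:t\le n\}$. Both carry the topology of these seminorms. * $\hat u(\lambda)=\int_0^\infty e^{-i\lambda y}u(y)\,dy$, $\ \tilde g(\omega,t)=\int_0^t e^{\omega\tau}g(\tau)\,d\tau$, $\ \tilde f(\lambda,\omega,t)=\int_0^t e^{\omega\tau}\int_0^\infty e^{-i\lambda y}f(y,\tau)\,dy\,d\tau$. * $\gamma$ is the contour that runs along straight rays from $e^{3i\pi/4}\infty$ to $0$ and from $0$ to $e^{i\pi/4}\infty$, and $\gamma^*=(\gamma\cap\{|\lambda|\ge\sqrt2\})+[-1+i,-1]+[1,1+i]$. For $(x,t)\in\overline Q\setminus\{(0,0)\}$ put $$(\mathbb I_0^+u)(x,t)=\int_{-\infty}^\infty e^{i\lambda x-\lambda^2t}\hat u(\lambda)\,d\lambda\quad(t>0),$$ $$(\mathbb I_0^+u)(x,0)=\int_{-1}^1e^{i\lambda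 x}\hat u(\lambda)\,d\lambda+u(0)\int_{\gamma^*}e^{i\lambda x}\frac{d\lambda}{i\lambda}+\Big(\int_{-\infty}^{-1}+\int_1^\infty\Big)e^{i\lambda x}\frac{\widehat{u'}(\lambda)}{i\lambda}\,d\lambda\quad(x>0),$$ $$(\mathbb I_0^-u)(x,t)=\int_\gamma e^{i\lambda x-\lambda^2t}\hat u(-\lambda)\,d\lambda\ \ (x>0),\qquad (\mathbb I_0^-u)(x,t)=\int_{-\infty}^\infty e^{i\lambda x-\lambda^2t}\hat u(-\lambda)\,d\lambda\ \ (t>0),$$ $$(\mathbb I_1g)(x,t)=\int_\gamma e^{i\lambda x-\lambda^2t}\,\tilde g(\lambda^2,t)\,\lambda\,d\lambda\quad(x>0),$$ with $(\mathbb I_1g)(0,t)$, $t>0$, the limit of $\mathbb I_1g$ from within $Q$, and $$(\mathbb I_2^+f)(x,t)=\int_{-\infty}^\infty e^{i\lambda x-\lambda^2t}\tilde f(\lambda,\lambda^2,t)\,d\lambda,\qquad(\mathbb I_2^-f)(x,t)=\int_\gamma e^{i\lambda x-\lambda^2t}\tilde f(-\lambda,\lambda^2,t)\,d\lambda .$$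 **Theorem.** Let $\mathcal D=\mathcal S([0,\infty))\times C^\infty([0,\infty))\times\mathcal S_1(\overline Q)$, with the product topology; no compatibility of the data $(u,g,f)\in\mathcal D$ at the corner is required. Then the integrals above converge absolutely, the two formulas for $\mathbb I_0^-u$ agree for $x,t>0$, the functions $\mathbb I_0^\pm u$, $\mathbb I_1g$, $\mathbb I_2^\pm f$ belong to $\mathcal S_1(\overline Q\setminus\{(0,0)\})$, and the unified transform method solution operator $\Phi:\mathcal D\to\mathcal S_1(\overline Q\setminus\{(0,0)\})$ of the heat equation on the quarter-plane, so well defined by $$2\pi\,\Phi(u,g,f)=\mathbb I_0^+u-\mathbb I_0^-u-2i\,\mathbb I_1g+\mathbb I_2^+f-\mathbb I_2^-f,$$ is continuous. -/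

import Mathlib

open Set Filter Topology MeasureTheory
open scoped ContDiff

namespace UTM

noncomputable section

/-! ### The quarter-plane and partial derivatives up to its boundary

A point of the plane is `p = (x, t)`.  A function on a closed half-line, on the closed quarter-plane
or on the punctured closed quarter-plane is represented by its extension by zero, so that equality
of representatives is equality on the domain. -/

/-- The open quarter-plane. -/
def Q : Set (ℝ × ℝ) := {p | 0 < p.1 ∧ 0 < p.2}

/-- The closed quarter-plane. -/
def Qbar : Set (ℝ × ℝ) := {p | 0 ≤ p.1 ∧ 0 ≤ p.2}

/-- The closed quarter-plane without its corner. -/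
def Qpunct : Set (ℝ × ℝ) := Qbar \ {(0, 0)}

/-- The classical partial derivative with respect to `x`. -/
def Dx (h : ℝ × ℝ → ℂ) (p : ℝ × ℝ) : ℂ := deriv (fun x : ℝ => h (x, p.2)) p.1

/-- The classical partial derivative with respect to `t`. -/
def Dt (h : ℝ × ℝ → ℂ) (p : ℝ × ℝ) : ℂ := deriv (fun t : ℝ => h (p.1, t)) p.2

/-- The classical partial derivative `∂^{k+l} h / ∂x^k ∂t^l` (meaningful in `Q`). -/
def pd (k l : ℕ) (h : ℝ × ℝ → ℂ) : ℝ × ℝ → ℂ := Dx^[k] (Dt^[l] h)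

/-- The partial derivative `∂^{k+l} h / ∂x^k ∂t^l` up to the boundary: its value at a point of the
closed quarter-plane is the limit of the classical partial derivative from within `Q`.  At points of
`Q` this is the classical partial derivative, see `pdBar_eq_pd`. -/
def pdBar (k l : ℕ) (h : ℝ × ℝ → ℂ) : ℝ × ℝ → ℂ := extendFrom Q (pd k l h)

/-- `h` is a `C^∞` function on `D`, where `D` is `Qbar` or `Qpunct`: it is `C^∞` in `Q`, all its
partial derivatives have limits at the points of `D`, its own values on `D` are such limits, and the
boundary values of the partial derivatives are `C^∞` along both edges. -/
structure IsSmoothUpTo (D : Set (ℝ × ℝ)) (h : ℝ × ℝ → ℂ) : Prop where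
  zero_off : ∀ p, p ∉ D → h p = 0
  contDiffOn : ContDiffOn ℝ ∞ h Q
  limit : ∀ k l : ℕ, ∀ p ∈ D, ∃ c : ℂ, Tendsto (pd k l h) (𝓝[Q] p) (𝓝 c)
  value : ∀ p ∈ D, Tendsto h (𝓝[Q] p) (𝓝 (h p))
  left : ∀ k l : ℕ, ContDiffOn ℝ ∞ (fun τ : ℝ => pdBar k l h (0, τ)) {τ | ((0 : ℝ), τ) ∈ D}
  bottom : ∀ k l : ℕ, ContDiffOn ℝ ∞ (fun χ : ℝ => pdBar k l h (χ, 0)) {χ | (χ, (0 : ℝ)) ∈ D}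

theorem isOpen_Q : IsOpen Q :=
  (isOpen_lt continuous_const continuous_fst).inter (isOpen_lt continuous_const continuous_snd)

theorem Dx_eq_fderiv {h : ℝ × ℝ → ℂ} {p : ℝ × ℝ} (hd : DifferentiableAt ℝ h p) :
    Dx h p = fderiv ℝ h p (1, 0) := by
  have h1 : HasDerivAt (fun x : ℝ => ((x, p.2) : ℝ × ℝ)) (1, 0) p.1 :=
    (hasDerivAt_id p.1).prodMk (hasDerivAt_const _ _)
  exact (HasFDerivAt.comp_hasDerivAt (f := fun x : ℝ => ((x, p.2) : ℝ × ℝ)) p.1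
    (hd.hasFDerivAt : HasFDerivAt h _ (p.1, p.2)) h1).deriv

theorem Dt_eq_fderiv {h : ℝ × ℝ → ℂ} {p : ℝ × ℝ} (hd : DifferentiableAt ℝ h p) :
    Dt h p = fderiv ℝ h p (0, 1) := by
  have h1 : HasDerivAt (fun t : ℝ => ((p.1, t) : ℝ × ℝ)) (0, 1) p.2 :=
    (hasDerivAt_const _ _).prodMk (hasDerivAt_id p.2)
  exact (HasFDerivAt.comp_hasDerivAt (f := fun t : ℝ => ((p.1, t) : ℝ × ℝ)) p.2
    (hd.hasFDerivAt : HasFDerivAt h _ (p.1, p.2)) h1).deriv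

theorem differentiableAt_of_contDiffOn {h : ℝ × ℝ → ℂ} (hh : ContDiffOn ℝ ∞ h Q) {p : ℝ × ℝ}
    (hp : p ∈ Q) : DifferentiableAt ℝ h p :=
  (hh.contDiffAt (isOpen_Q.mem_nhds hp)).differentiableAt (by simp)

theorem contDiffOn_fderiv_apply {h : ℝ × ℝ → ℂ} (hh : ContDiffOn ℝ ∞ h Q) (v : ℝ × ℝ) :
    ContDiffOn ℝ ∞ (fun p => fderiv ℝ h p v) Q :=
  (hh.fderiv_of_isOpen isOpen_Q (by simp)).clm_apply contDiffOn_const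

theorem contDiffOn_Dx {h : ℝ × ℝ → ℂ} (hh : ContDiffOn ℝ ∞ h Q) : ContDiffOn ℝ ∞ (Dx h) Q :=
  (contDiffOn_fderiv_apply hh (1, 0)).congr fun _ hp =>
    Dx_eq_fderiv (differentiableAt_of_contDiffOn hh hp)

theorem contDiffOn_Dt {h : ℝ × ℝ → ℂ} (hh : ContDiffOn ℝ ∞ h Q) : ContDiffOn ℝ ∞ (Dt h) Q :=
  (contDiffOn_fderiv_apply hh (0, 1)).congr fun _ hp =>
    Dt_eq_fderiv (differentiableAt_of_contDiffOn hh hp)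

theorem contDiffOn_pd {h : ℝ × ℝ → ℂ} (hh : ContDiffOn ℝ ∞ h Q) (k l : ℕ) :
    ContDiffOn ℝ ∞ (pd k l h) Q := by
  have h1 : ContDiffOn ℝ ∞ (Dt^[l] h) Q := by
    induction l with
    | zero => simpa using hh
    | succ l ih => rw [Function.iterate_succ_apply']; exact contDiffOn_Dt ih
  unfold pd
  induction k with
  | zero => simpa using h1
  | succ k ih => rw [Function.iterate_succ_apply']; exact contDiffOn_Dx ih

theorem pdBar_eq_pd {h : ℝ × ℝ → ℂ} (hh : ContDiffOn ℝ ∞ h Q) (k l : ℕ) {p : ℝ × ℝ} (hp : p ∈ Q) :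
    pdBar k l h p = pd k l h p :=
  extendFrom_eq (subset_closure hp) ((contDiffOn_pd hh k l).continuousOn p hp)

theorem Dx_congr {h₁ h₂ : ℝ × ℝ → ℂ} (h : EqOn h₁ h₂ Q) : EqOn (Dx h₁) (Dx h₂) Q := by
  intro p hp
  refine Filter.EventuallyEq.deriv_eq ?_
  filter_upwards [isOpen_Ioi.mem_nhds (show p.1 ∈ Ioi (0 : ℝ) from hp.1)] with x hx
  exact h ⟨hx, hp.2⟩

theorem Dt_congr {h₁ h₂ : ℝ × ℝ → ℂ} (h : EqOn h₁ h₂ Q) : EqOn (Dt h₁) (Dt h₂) Q := by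
  intro p hp
  refine Filter.EventuallyEq.deriv_eq ?_
  filter_upwards [isOpen_Ioi.mem_nhds (show p.2 ∈ Ioi (0 : ℝ) from hp.2)] with x hx
  exact h ⟨hp.1, hx⟩

theorem Dx_lin {h₁ h₂ : ℝ × ℝ → ℂ} (hh₁ : ContDiffOn ℝ ∞ h₁ Q) (hh₂ : ContDiffOn ℝ ∞ h₂ Q)
    (c : ℂ) : EqOn (Dx (c • h₁ + h₂)) (c • Dx h₁ + Dx h₂) Q := by
  intro p hp
  have d1 := differentiableAt_of_contDiffOn hh₁ hp
  have d2 := differentiableAt_of_contDiffOn hh₂ hp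
  rw [Dx_eq_fderiv ((d1.const_smul c).add d2), fderiv_add (d1.const_smul c) d2,
    fderiv_const_smul d1 c]
  simp [Dx_eq_fderiv d1, Dx_eq_fderiv d2]

theorem Dt_lin {h₁ h₂ : ℝ × ℝ → ℂ} (hh₁ : ContDiffOn ℝ ∞ h₁ Q) (hh₂ : ContDiffOn ℝ ∞ h₂ Q)
    (c : ℂ) : EqOn (Dt (c • h₁ + h₂)) (c • Dt h₁ + Dt h₂) Q := by
  intro p hp
  have d1 := differentiableAt_of_contDiffOn hh₁ hp
  have d2 := differentiableAt_of_contDiffOn hh₂ hp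
  rw [Dt_eq_fderiv ((d1.const_smul c).add d2), fderiv_add (d1.const_smul c) d2,
    fderiv_const_smul d1 c]
  simp [Dt_eq_fderiv d1, Dt_eq_fderiv d2]

theorem pd_lin {h₁ h₂ : ℝ × ℝ → ℂ} (hh₁ : ContDiffOn ℝ ∞ h₁ Q) (hh₂ : ContDiffOn ℝ ∞ h₂ Q)
    (c : ℂ) (k l : ℕ) : EqOn (pd k l (c • h₁ + h₂)) (c • pd k l h₁ + pd k l h₂) Q := by
  induction k with
  | zero =>
    induction l with
    | zero => intro p _; rfl
    | succ l ih =>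
      have e : ∀ h, pd 0 (l + 1) h = Dt (pd 0 l h) := fun h => by
        simp only [pd, Function.iterate_succ_apply', Function.iterate_zero, id]
      simp only [e]
      exact (Dt_congr ih).trans (Dt_lin (contDiffOn_pd hh₁ 0 l) (contDiffOn_pd hh₂ 0 l) c)
  | succ k ih =>
    have e : ∀ h, pd (k + 1) l h = Dx (pd k l h) := fun h => by
      simp only [pd, Function.iterate_succ_apply']
    simp only [e]
    exact (Dx_congr ih).trans (Dx_lin (contDiffOn_pd hh₁ k l) (contDiffOn_pd hh₂ k l) c)

theorem Qbar_subset_closure : Qbar ⊆ closure Q := by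
  have : Q = Ioi (0 : ℝ) ×ˢ Ioi (0 : ℝ) := rfl
  rw [this, closure_prod_eq, closure_Ioi]
  exact fun p hp => hp

theorem tendsto_pd_lin {D : Set (ℝ × ℝ)} {h₁ h₂ : ℝ × ℝ → ℂ} (hh₁ : IsSmoothUpTo D h₁)
    (hh₂ : IsSmoothUpTo D h₂) (c : ℂ) (k l : ℕ) {p : ℝ × ℝ} (hp : p ∈ D) :
    Tendsto (pd k l (c • h₁ + h₂)) (𝓝[Q] p) (𝓝 (c • pdBar k l h₁ p + pdBar k l h₂ p)) := by
  have t := ((tendsto_extendFrom (hh₁.limit k l p hp)).const_smul c).add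
    (tendsto_extendFrom (hh₂.limit k l p hp))
  exact t.congr' ((pd_lin hh₁.contDiffOn hh₂.contDiffOn c k l).symm.eventuallyEq_of_mem
    self_mem_nhdsWithin)

theorem pdBar_lin {D : Set (ℝ × ℝ)} (hD : D ⊆ Qbar) {h₁ h₂ : ℝ × ℝ → ℂ} (hh₁ : IsSmoothUpTo D h₁)
    (hh₂ : IsSmoothUpTo D h₂) (c : ℂ) (k l : ℕ) {p : ℝ × ℝ} (hp : p ∈ D) :
    pdBar k l (c • h₁ + h₂) p = c • pdBar k l h₁ p + pdBar k l h₂ p :=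
  extendFrom_eq (Qbar_subset_closure (hD hp)) (tendsto_pd_lin hh₁ hh₂ c k l hp)

theorem pd_zero (k l : ℕ) : pd k l 0 = 0 := by
  have a : Dx 0 = 0 := by funext p; simp [Dx]
  have b : Dt 0 = 0 := by funext p; simp [Dt]
  simp only [pd, Function.iterate_fixed b, Function.iterate_fixed a]

theorem pdBar_zero {k l : ℕ} {p : ℝ × ℝ} (hp : p ∈ Qbar) : pdBar k l 0 p = 0 := by
  refine extendFrom_eq (Qbar_subset_closure hp) ?_
  rw [pd_zero]
  exact tendsto_const_nhds

theorem IsSmoothUpTo.zero {D : Set (ℝ × ℝ)} (hD : D ⊆ Qbar) : IsSmoothUpTo D 0 where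
  zero_off _ _ := rfl
  contDiffOn := contDiffOn_const
  limit k l p _ := ⟨0, by rw [pd_zero]; exact tendsto_const_nhds⟩
  value _ _ := tendsto_const_nhds
  left _ _ := (contDiffOn_const (c := (0 : ℂ))).congr fun _ hτ => pdBar_zero (hD hτ)
  bottom _ _ := (contDiffOn_const (c := (0 : ℂ))).congr fun _ hτ => pdBar_zero (hD hτ)

theorem IsSmoothUpTo.lin {D : Set (ℝ × ℝ)} (hD : D ⊆ Qbar) {h₁ h₂ : ℝ × ℝ → ℂ}
    (hh₁ : IsSmoothUpTo D h₁) (hh₂ : IsSmoothUpTo D h₂) (c : ℂ) :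
    IsSmoothUpTo D (c • h₁ + h₂) where
  zero_off p hp := by simp [hh₁.zero_off p hp, hh₂.zero_off p hp]
  contDiffOn := (hh₁.contDiffOn.const_smul c).add hh₂.contDiffOn
  limit k l p hp := ⟨_, tendsto_pd_lin hh₁ hh₂ c k l hp⟩
  value p hp := ((hh₁.value p hp).const_smul c).add (hh₂.value p hp)
  left k l := (((hh₁.left k l).const_smul c).add (hh₂.left k l)).congr fun _ hτ =>
    pdBar_lin hD hh₁ hh₂ c k l hτ
  bottom k l := (((hh₁.bottom k l).const_smul c).add (hh₂.bottom k l)).congr fun _ hτ =>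
    pdBar_lin hD hh₁ hh₂ c k l hτ

/-! ### The spaces `S_1` on the closed and on the punctured closed quarter-plane -/

/-- The numbers whose supremum is the `n`-th seminorm, for a strip `K`. -/
def stripValues (K : Set (ℝ × ℝ)) (n : ℕ) (h : ℝ × ℝ → ℂ) : Set ℝ :=
  {r | ∃ k l : ℕ, ∃ p ∈ K, k + l ≤ n ∧ r = (1 + p.1) ^ n * ‖pdBar k l h p‖}

theorem one_add_pow_nonneg {p : ℝ × ℝ} (hp : p ∈ Qbar) (n : ℕ) : 0 ≤ (1 + p.1) ^ n :=
  pow_nonneg (add_nonneg zero_le_one hp.1) n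

theorem stripValues_nonneg {K : Set (ℝ × ℝ)} (hK : K ⊆ Qbar) {n : ℕ} {h : ℝ × ℝ → ℂ} :
    0 ≤ sSup (stripValues K n h) := by
  refine Real.sSup_nonneg ?_
  rintro r ⟨k, l, p, hp, -, rfl⟩
  exact mul_nonneg (one_add_pow_nonneg (hK hp) n) (norm_nonneg _)

theorem stripValues_lin {D K : Set (ℝ × ℝ)} (hD : D ⊆ Qbar) (hK : K ⊆ D) {n : ℕ}
    {h₁ h₂ : ℝ × ℝ → ℂ} (hh₁ : IsSmoothUpTo D h₁) (hh₂ : IsSmoothUpTo D h₂)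
    (b₁ : BddAbove (stripValues K n h₁)) (b₂ : BddAbove (stripValues K n h₂)) (c : ℂ) :
    ∀ r ∈ stripValues K n (c • h₁ + h₂),
      r ≤ ‖c‖ * sSup (stripValues K n h₁) + sSup (stripValues K n h₂) := by
  rintro r ⟨k, l, p, hp, hkl, rfl⟩
  rw [pdBar_lin hD hh₁ hh₂ c k l (hK hp)]
  have w := one_add_pow_nonneg (hD (hK hp)) n
  have e₁ := le_csSup b₁ ⟨k, l, p, hp, hkl, rfl⟩
  have e₂ := le_csSup b₂ ⟨k, l, p, hp, hkl, rfl⟩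
  calc (1 + p.1) ^ n * ‖c • pdBar k l h₁ p + pdBar k l h₂ p‖
      ≤ (1 + p.1) ^ n * (‖c‖ * ‖pdBar k l h₁ p‖ + ‖pdBar k l h₂ p‖) := by
        refine mul_le_mul_of_nonneg_left ((norm_add_le _ _).trans ?_) w
        rw [norm_smul]
    _ = ‖c‖ * ((1 + p.1) ^ n * ‖pdBar k l h₁ p‖) + (1 + p.1) ^ n * ‖pdBar k l h₂ p‖ := by ring
    _ ≤ _ := add_le_add (mul_le_mul_of_nonneg_left e₁ (norm_nonneg c)) e₂

theorem stripValues_zero_le {K : Set (ℝ × ℝ)} (hK : K ⊆ Qbar) (n : ℕ) :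
    ∀ r ∈ stripValues K n 0, r ≤ 0 := by
  rintro r ⟨k, l, p, hp, -, rfl⟩
  simp [pdBar_zero (hK hp)]

/-- A domain `D` inside `Qbar` with strips `K 1, K 2, …` in it; the two that are used are
`punctured` and `closedQuarter` below. -/
structure Strips where
  D : Set (ℝ × ℝ)
  K : ℕ+ → Set (ℝ × ℝ)
  D_subset : D ⊆ Qbar
  K_subset : ∀ n, K n ⊆ D

/-- The vector space `S_1(D)` of the `C^∞` functions on `D` all of whose seminorms are finite. -/
def s1Submodule (S : Strips) : Submodule ℂ (ℝ × ℝ → ℂ) where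
  carrier := {h | IsSmoothUpTo S.D h ∧ ∀ n : ℕ+, BddAbove (stripValues (S.K n) n h)}
  zero_mem' := ⟨IsSmoothUpTo.zero S.D_subset, fun n =>
    ⟨0, stripValues_zero_le ((S.K_subset n).trans S.D_subset) n⟩⟩
  add_mem' {a b} ha hb := by
    have e : a + b = (1 : ℂ) • a + b := by rw [one_smul]
    rw [e]
    exact ⟨ha.1.lin S.D_subset hb.1 1, fun n =>
      ⟨_, stripValues_lin S.D_subset (S.K_subset n) ha.1 hb.1 (ha.2 n) (hb.2 n) 1⟩⟩
  smul_mem' c a ha := by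
    have z := IsSmoothUpTo.zero S.D_subset
    have e : c • a = c • a + 0 := by rw [add_zero]
    rw [e]
    exact ⟨ha.1.lin S.D_subset z c, fun n =>
      ⟨_, stripValues_lin S.D_subset (S.K_subset n) ha.1 z (ha.2 n)
        ⟨0, stripValues_zero_le ((S.K_subset n).trans S.D_subset) n⟩ c⟩⟩

/-- The space `S_1(D)`. -/
def S1 (S : Strips) : Type := ↥(s1Submodule S)

instance (S : Strips) : AddCommGroup (S1 S) := inferInstanceAs (AddCommGroup ↥(s1Submodule S))

instance (S : Strips) : Module ℂ (S1 S) := inferInstanceAs (Module ℂ ↥(s1Submodule S))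

/-- The function on the plane (zero off `D`) that represents an element of `S_1(D)`. -/
def S1.fn {S : Strips} (h : S1 S) : ℝ × ℝ → ℂ := Subtype.val h

/-- The seminorm `sup {(1+x)^n |∂^{k+l}h/∂x^k∂t^l| : (x,t) ∈ K n, k + l ≤ n}`. -/
def s1Seminorm (S : Strips) (n : ℕ+) : Seminorm ℂ (S1 S) :=
  Seminorm.ofSMulLE (fun h => sSup (stripValues (S.K n) n h.fn))
    (le_antisymm
      (Real.sSup_le (stripValues_zero_le ((S.K_subset n).trans S.D_subset) n) le_rfl)
      (stripValues_nonneg ((S.K_subset n).trans S.D_subset)))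
    (fun a b => by
      have e : (a + b).fn = (1 : ℂ) • a.fn + b.fn := by rw [one_smul]; rfl
      have hK := (S.K_subset n).trans S.D_subset
      rw [e]
      refine Real.sSup_le (fun r hr => ?_)
        (add_nonneg (stripValues_nonneg hK) (stripValues_nonneg hK))
      have q := stripValues_lin S.D_subset (S.K_subset n) a.2.1 b.2.1 (a.2.2 n) (b.2.2 n) 1 r hr
      rw [norm_one, one_mul] at q
      exact q)
    (fun c a => by
      have e : (c • a).fn = c • a.fn + (0 : S1 S).fn := by
        show (c • a).fn = c • a.fn + 0
        rw [add_zero]; rfl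
      have hK := (S.K_subset n).trans S.D_subset
      have z : sSup (stripValues (S.K n) n (0 : S1 S).fn) ≤ 0 :=
        Real.sSup_le (stripValues_zero_le hK n) le_rfl
      rw [e]
      refine Real.sSup_le (fun r hr => ?_) (mul_nonneg (norm_nonneg c) (stripValues_nonneg hK))
      have q := stripValues_lin S.D_subset (S.K_subset n) a.2.1 (0 : S1 S).2.1 (a.2.2 n)
        ((0 : S1 S).2.2 n) c r hr
      exact q.trans ((add_le_add le_rfl z).trans_eq (add_zero _)))

/-- The topology of `S_1(D)`, defined by the seminorms. -/
instance (S : Strips) : TopologicalSpace (S1 S) :=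
  SeminormFamily.moduleFilterBasis (s1Seminorm S) |>.topology

theorem withSeminorms_s1 (S : Strips) : WithSeminorms (s1Seminorm S) := ⟨rfl⟩

/-- The punctured closed quarter-plane with the strips
`{1/n ≤ t ≤ n} ∪ {x ≥ 1/n, t ≤ 1/n}`. -/
def punctured : Strips where
  D := Qpunct
  K n := {p | p ∈ Qbar ∧ 1 / (n : ℝ) ≤ p.2 ∧ p.2 ≤ n} ∪
    {p | p ∈ Qbar ∧ 1 / (n : ℝ) ≤ p.1 ∧ p.2 ≤ 1 / n}
  D_subset := sdiff_subset
  K_subset n := by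
    have hn : (0 : ℝ) < 1 / (n : ℝ) := one_div_pos.2 (by exact_mod_cast n.pos)
    rintro p (⟨hp, h, -⟩ | ⟨hp, h, -⟩) <;> refine ⟨hp, ?_⟩ <;> rintro rfl <;> exact hn.not_ge h

/-- The closed quarter-plane with the strips `{t ≤ n}`. -/
def closedQuarter : Strips where
  D := Qbar
  K n := {p | p ∈ Qbar ∧ p.2 ≤ (n : ℝ)}
  D_subset := subset_rfl
  K_subset _ _ hp := hp.1

/-! ### The spaces of functions on the half-line -/

/-- The numbers whose supremum is the `N`-th norm of a Schwartz function on the half-line. -/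
def schwartzValues (N : ℕ) (u : ℝ → ℂ) : Set ℝ :=
  {r | ∃ k ≤ N, ∃ x : ℝ, 0 ≤ x ∧ r = (1 + x) ^ N * ‖iteratedDerivWithin k u (Ici 0) x‖}

/-- The numbers whose supremum is the seminorm `sup {|g^(l)(t)| : 0 ≤ t ≤ n}`. -/
def smoothValues (l n : ℕ) (g : ℝ → ℂ) : Set ℝ :=
  {r | ∃ t : ℝ, 0 ≤ t ∧ t ≤ n ∧ r = ‖iteratedDerivWithin l g (Ici 0) t‖}

theorem iteratedDerivWithin_lin {u v : ℝ → ℂ} (hu : ContDiffOn ℝ ∞ u (Ici 0))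
    (hv : ContDiffOn ℝ ∞ v (Ici 0)) (c : ℂ) (k : ℕ) {x : ℝ} (hx : 0 ≤ x) :
    iteratedDerivWithin k (c • u + v) (Ici 0) x =
      c • iteratedDerivWithin k u (Ici 0) x + iteratedDerivWithin k v (Ici 0) x := by
  have hx' : x ∈ Ici (0 : ℝ) := hx
  have ks : (k : WithTop ℕ∞) ≤ ∞ := by exact_mod_cast le_top
  have hu' := (hu.of_le ks) x hx'
  have hv' := (hv.of_le ks) x hx'
  have hcu : ContDiffWithinAt ℝ k (c • u) (Ici 0) x := hu'.const_smul c
  rw [iteratedDerivWithin_add hx' (uniqueDiffOn_Ici 0) hcu hv',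
    iteratedDerivWithin_const_smul hx' (uniqueDiffOn_Ici 0) c hu']

theorem schwartzValues_nonneg {N : ℕ} {u : ℝ → ℂ} : 0 ≤ sSup (schwartzValues N u) := by
  refine Real.sSup_nonneg ?_
  rintro r ⟨k, -, x, hx, rfl⟩
  positivity

theorem schwartzValues_zero_le (N : ℕ) : ∀ r ∈ schwartzValues N 0, r ≤ 0 := by
  rintro r ⟨k, -, x, hx, rfl⟩
  simp

theorem schwartzValues_lin {N : ℕ} {u v : ℝ → ℂ} (hu : ContDiffOn ℝ ∞ u (Ici 0))
    (hv : ContDiffOn ℝ ∞ v (Ici 0)) (bu : BddAbove (schwartzValues N u))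
    (bv : BddAbove (schwartzValues N v)) (c : ℂ) :
    ∀ r ∈ schwartzValues N (c • u + v),
      r ≤ ‖c‖ * sSup (schwartzValues N u) + sSup (schwartzValues N v) := by
  rintro r ⟨k, hk, x, hx, rfl⟩
  rw [iteratedDerivWithin_lin hu hv c k hx]
  have w : 0 ≤ (1 + x) ^ N := by positivity
  have e₁ := le_csSup bu ⟨k, hk, x, hx, rfl⟩
  have e₂ := le_csSup bv ⟨k, hk, x, hx, rfl⟩
  set a := iteratedDerivWithin k u (Ici 0) x
  set b := iteratedDerivWithin k v (Ici 0) x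
  calc (1 + x) ^ N * ‖c • a + b‖ ≤ (1 + x) ^ N * (‖c‖ * ‖a‖ + ‖b‖) := by
        refine mul_le_mul_of_nonneg_left ((norm_add_le _ _).trans ?_) w
        rw [norm_smul]
    _ = ‖c‖ * ((1 + x) ^ N * ‖a‖) + (1 + x) ^ N * ‖b‖ := by ring
    _ ≤ _ := add_le_add (mul_le_mul_of_nonneg_left e₁ (norm_nonneg c)) e₂

/-- The vector space `S([0,∞))`. -/
def schwartzSubmodule : Submodule ℂ (ℝ → ℂ) where
  carrier := {u | (∀ x, x < 0 → u x = 0) ∧ ContDiffOn ℝ ∞ u (Ici 0) ∧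
    ∀ N : ℕ, BddAbove (schwartzValues N u)}
  zero_mem' := ⟨fun _ _ => rfl, contDiffOn_const, fun N => ⟨0, schwartzValues_zero_le N⟩⟩
  add_mem' {a b} ha hb := by
    have e : a + b = (1 : ℂ) • a + b := by rw [one_smul]
    refine ⟨fun x hx => by simp [ha.1 x hx, hb.1 x hx], ha.2.1.add hb.2.1, fun N => ?_⟩
    rw [e]
    exact ⟨_, schwartzValues_lin ha.2.1 hb.2.1 (ha.2.2 N) (hb.2.2 N) 1⟩
  smul_mem' c a ha := by
    have e : c • a = c • a + 0 := by rw [add_zero]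
    refine ⟨fun x hx => by simp [ha.1 x hx], ha.2.1.const_smul c, fun N => ?_⟩
    rw [e]
    exact ⟨_, schwartzValues_lin ha.2.1 contDiffOn_const (ha.2.2 N)
      ⟨0, schwartzValues_zero_le N⟩ c⟩

/-- The space `S([0,∞))` of Schwartz functions on the half-line. -/
def SchwartzHalfLine : Type := ↥schwartzSubmodule

instance : AddCommGroup SchwartzHalfLine := inferInstanceAs (AddCommGroup ↥schwartzSubmodule)

instance : Module ℂ SchwartzHalfLine := inferInstanceAs (Module ℂ ↥schwartzSubmodule)

/-- The function on the line (zero on the negative half-line) that represents `u`. -/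
def SchwartzHalfLine.fn (u : SchwartzHalfLine) : ℝ → ℂ := Subtype.val u

/-- The norm `sup {(1+x)^N |u^(k)(x)| : k ≤ N, x ≥ 0}`. -/
def schwartzSeminorm (N : ℕ) : Seminorm ℂ SchwartzHalfLine :=
  Seminorm.ofSMulLE (fun u => sSup (schwartzValues N u.fn))
    (le_antisymm (Real.sSup_le (schwartzValues_zero_le N) le_rfl) schwartzValues_nonneg)
    (fun a b => by
      have e : (a + b).fn = (1 : ℂ) • a.fn + b.fn := by rw [one_smul]; rfl
      rw [e]
      refine Real.sSup_le (fun r hr => ?_) (add_nonneg schwartzValues_nonneg schwartzValues_nonneg)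
      have q := schwartzValues_lin a.2.2.1 b.2.2.1 (a.2.2.2 N) (b.2.2.2 N) 1 r hr
      rw [norm_one, one_mul] at q
      exact q)
    (fun c a => by
      have e : (c • a).fn = c • a.fn + (0 : SchwartzHalfLine).fn := by
        show (c • a).fn = c • a.fn + 0
        rw [add_zero]; rfl
      have z : sSup (schwartzValues N (0 : SchwartzHalfLine).fn) ≤ 0 :=
        Real.sSup_le (schwartzValues_zero_le N) le_rfl
      rw [e]
      refine Real.sSup_le (fun r hr => ?_) (mul_nonneg (norm_nonneg c) schwartzValues_nonneg)
      have q := schwartzValues_lin a.2.2.1 (0 : SchwartzHalfLine).2.2.1 (a.2.2.2 N)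
        ((0 : SchwartzHalfLine).2.2.2 N) c r hr
      exact q.trans ((add_le_add le_rfl z).trans_eq (add_zero _)))

/-- The topology of `S([0,∞))`, defined by the norms. -/
instance : TopologicalSpace SchwartzHalfLine :=
  SeminormFamily.moduleFilterBasis schwartzSeminorm |>.topology

theorem withSeminorms_schwartz : WithSeminorms schwartzSeminorm := ⟨rfl⟩

theorem smoothValues_nonneg {l n : ℕ} {g : ℝ → ℂ} : 0 ≤ sSup (smoothValues l n g) := by
  refine Real.sSup_nonneg ?_
  rintro r ⟨t, -, -, rfl⟩
  exact norm_nonneg _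

theorem smoothValues_bdd {l n : ℕ} {g : ℝ → ℂ} (hg : ContDiffOn ℝ ∞ g (Ici 0)) :
    BddAbove (smoothValues l n g) := by
  have ls : (l : WithTop ℕ∞) ≤ ∞ := by exact_mod_cast le_top
  have h1 : ContinuousOn (fun t => ‖iteratedDerivWithin l g (Ici 0) t‖) (Icc 0 (n : ℝ)) :=
    ((hg.continuousOn_iteratedDerivWithin ls (uniqueDiffOn_Ici 0)).mono Icc_subset_Ici_self).norm
  refine (isCompact_Icc.bddAbove_image h1).mono ?_
  rintro r ⟨t, h0, hn, rfl⟩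
  exact ⟨t, ⟨h0, hn⟩, rfl⟩

theorem smoothValues_lin {l n : ℕ} {g k : ℝ → ℂ} (hg : ContDiffOn ℝ ∞ g (Ici 0))
    (hk : ContDiffOn ℝ ∞ k (Ici 0)) (c : ℂ) :
    ∀ r ∈ smoothValues l n (c • g + k),
      r ≤ ‖c‖ * sSup (smoothValues l n g) + sSup (smoothValues l n k) := by
  rintro r ⟨t, h0, hn, rfl⟩
  rw [iteratedDerivWithin_lin hg hk c l h0]
  have e₁ := le_csSup (smoothValues_bdd (l := l) (n := n) hg) ⟨t, h0, hn, rfl⟩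
  have e₂ := le_csSup (smoothValues_bdd (l := l) (n := n) hk) ⟨t, h0, hn, rfl⟩
  refine (norm_add_le _ _).trans ?_
  rw [norm_smul]
  exact add_le_add (mul_le_mul_of_nonneg_left e₁ (norm_nonneg c)) e₂

theorem smoothValues_zero_le (l n : ℕ) : ∀ r ∈ smoothValues l n 0, r ≤ 0 := by
  rintro r ⟨t, -, -, rfl⟩
  simp

/-- The vector space `C^∞([0,∞))`. -/
def smoothSubmodule : Submodule ℂ (ℝ → ℂ) where
  carrier := {g | (∀ t, t < 0 → g t = 0) ∧ ContDiffOn ℝ ∞ g (Ici 0)}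
  zero_mem' := ⟨fun _ _ => rfl, contDiffOn_const⟩
  add_mem' {a b} ha hb := ⟨fun x hx => by simp [ha.1 x hx, hb.1 x hx], ha.2.add hb.2⟩
  smul_mem' c a ha := ⟨fun x hx => by simp [ha.1 x hx], ha.2.const_smul c⟩

/-- The space `C^∞([0,∞))`. -/
def SmoothHalfLine : Type := ↥smoothSubmodule

instance : AddCommGroup SmoothHalfLine := inferInstanceAs (AddCommGroup ↥smoothSubmodule)

instance : Module ℂ SmoothHalfLine := inferInstanceAs (Module ℂ ↥smoothSubmodule)

/-- The function on the line (zero on the negative half-line) that represents `g`. -/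
def SmoothHalfLine.fn (g : SmoothHalfLine) : ℝ → ℂ := Subtype.val g

/-- The seminorm `sup {|g^(l)(t)| : 0 ≤ t ≤ n}`, indexed by the pair `(l, n)` with `n ≥ 1`. -/
def smoothSeminorm (i : ℕ × ℕ+) : Seminorm ℂ SmoothHalfLine :=
  Seminorm.ofSMulLE (fun g => sSup (smoothValues i.1 i.2 g.fn))
    (le_antisymm (Real.sSup_le (smoothValues_zero_le _ _) le_rfl) smoothValues_nonneg)
    (fun a b => by
      have e : (a + b).fn = (1 : ℂ) • a.fn + b.fn := by rw [one_smul]; rfl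
      rw [e]
      refine Real.sSup_le (fun r hr => ?_) (add_nonneg smoothValues_nonneg smoothValues_nonneg)
      have q := smoothValues_lin a.2.2 b.2.2 1 r hr
      rw [norm_one, one_mul] at q
      exact q)
    (fun c a => by
      have e : (c • a).fn = c • a.fn + (0 : SmoothHalfLine).fn := by
        show (c • a).fn = c • a.fn + 0
        rw [add_zero]; rfl
      have z : sSup (smoothValues i.1 i.2 (0 : SmoothHalfLine).fn) ≤ 0 :=
        Real.sSup_le (smoothValues_zero_le _ _) le_rfl
      rw [e]
      refine Real.sSup_le (fun r hr => ?_) (mul_nonneg (norm_nonneg c) smoothValues_nonneg)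
      have q := smoothValues_lin a.2.2 (0 : SmoothHalfLine).2.2 c r hr
      exact q.trans ((add_le_add le_rfl z).trans_eq (add_zero _)))

/-- The topology of `C^∞([0,∞))`, defined by the seminorms. -/
instance : TopologicalSpace SmoothHalfLine :=
  SeminormFamily.moduleFilterBasis smoothSeminorm |>.topology

theorem withSeminorms_smooth : WithSeminorms smoothSeminorm := ⟨rfl⟩

/-! ### Transforms and contours -/

/-- The half-line Fourier transform `∫_0^∞ e^{-iλy} u(y) dy` (for `Im λ ≤ 0`). -/
def hat (u : ℝ → ℂ) (z : ℂ) : ℂ := ∫ y in Ioi (0 : ℝ), Complex.exp (-(Complex.I * z * y)) * u y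

/-- `∫_0^t e^{ωτ} g(τ) dτ`. -/
def tildeT (g : ℝ → ℂ) (w : ℂ) (t : ℝ) : ℂ := ∫ τ in (0 : ℝ)..t, Complex.exp (w * τ) * g τ

/-- `∫_0^t e^{ωτ} ∫_0^∞ e^{-iλy} f(y,τ) dy dτ`. -/
def tildeXT (f : ℝ × ℝ → ℂ) (z w : ℂ) (t : ℝ) : ℂ :=
  ∫ τ in (0 : ℝ)..t, Complex.exp (w * τ) * hat (fun y => f (y, τ)) z

/-- The exponential `e^{iλx - λ²t}`. -/
def phase (x t : ℝ) (z : ℂ) : ℂ := Complex.exp (Complex.I * z * x - z ^ 2 * t)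

/-- The direction `e^{iπ/4}` of the outgoing ray of the contour `γ`. -/
def dirOut : ℂ := Complex.exp (Complex.I * (Real.pi / 4))

/-- The direction `e^{3iπ/4}` of the incoming ray of the contour `γ`. -/
def dirIn : ℂ := Complex.exp (Complex.I * (3 * Real.pi / 4))

/-- The integral of `F` over the part `|λ| ≥ R` of the contour `γ`, which runs from `e^{3iπ/4}∞` to
`0` and then from `0` to `e^{iπ/4}∞` along straight rays; `R = 0` gives the whole of `γ`. -/
def gammaInt (R : ℝ) (F : ℂ → ℂ) : ℂ :=
  (∫ r in Ioi R, F (r * dirOut) * dirOut) - ∫ r in Ioi R, F (r * dirIn) * dirIn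

/-- Absolute convergence of `gammaInt R F`. -/
def GammaIntegrable (R : ℝ) (F : ℂ → ℂ) : Prop :=
  IntegrableOn (fun r : ℝ => F (r * dirOut)) (Ioi R) ∧
    IntegrableOn (fun r : ℝ => F (r * dirIn)) (Ioi R)

/-- The integral of `F` over the oriented segment `[a, b]`. -/
def segInt (a b : ℂ) (F : ℂ → ℂ) : ℂ := ∫ s in (0 : ℝ)..1, F (a + s * (b - a)) * (b - a)

/-- The integral over `γ^* = (γ ∩ {|λ| ≥ √2}) + [-1+i, -1] + [1, 1+i]`. -/
def gammaStarInt (F : ℂ → ℂ) : ℂ :=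
  gammaInt (Real.sqrt 2) F + segInt (-1 + Complex.I) (-1) F + segInt 1 (1 + Complex.I) F

/-! ### The component operators, as functions on the plane that vanish off `Qpunct` -/

/-- `I_0^+ u`: the integral over the real line for `t > 0`, the regularized integral for `t = 0`. -/
def i0plus (u : ℝ → ℂ) : ℝ × ℝ → ℂ := Qpunct.indicator fun p =>
  if 0 < p.2 then ∫ z : ℝ, phase p.1 p.2 z * hat u z
  else (∫ z in (-1 : ℝ)..1, Complex.exp (Complex.I * z * p.1) * hat u z)
    + u 0 * gammaStarInt (fun z => Complex.exp (Complex.I * z * p.1) / (Complex.I * z))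
    + ((∫ z in Iio (-1 : ℝ),
          Complex.exp (Complex.I * z * p.1) * (hat (derivWithin u (Ici 0)) z / (Complex.I * z)))
      + ∫ z in Ioi (1 : ℝ),
          Complex.exp (Complex.I * z * p.1) * (hat (derivWithin u (Ici 0)) z / (Complex.I * z)))

/-- `I_0^- u`: the integral over `γ` for `x > 0`, the integral over the real line for `x = 0`. -/
def i0minus (u : ℝ → ℂ) : ℝ × ℝ → ℂ := Qpunct.indicator fun p =>
  if 0 < p.1 then gammaInt 0 (fun z => phase p.1 p.2 z * hat u (-z))
  else ∫ z : ℝ, phase p.1 p.2 z * hat u (-z)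

/-- `I_1 g` for `x > 0`. -/
def i1Interior (g : ℝ → ℂ) (p : ℝ × ℝ) : ℂ :=
  gammaInt 0 (fun z => phase p.1 p.2 z * tildeT g (z ^ 2) p.2 * z)

/-- `I_1 g`: the integral over `γ` for `x > 0`.  On the edge `x = 0`, where the integral does not
converge absolutely, the value is the limit from within `Q`, as for every function in
`C^∞(Qpunct)`. -/
def i1 (g : ℝ → ℂ) : ℝ × ℝ → ℂ := Qpunct.indicator fun p =>
  if 0 < p.1 then i1Interior g p else extendFrom Q (i1Interior g) p

/-- `I_2^+ f`. -/
def i2plus (f : ℝ × ℝ → ℂ) : ℝ × ℝ → ℂ := Qpunct.indicator fun p =>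
  ∫ z : ℝ, phase p.1 p.2 z * tildeXT f z ((z : ℂ) ^ 2) p.2

/-- `I_2^- f`. -/
def i2minus (f : ℝ × ℝ → ℂ) : ℝ × ℝ → ℂ := Qpunct.indicator fun p =>
  gammaInt 0 (fun z => phase p.1 p.2 z * tildeXT f (-z) (z ^ 2) p.2)

/-! ### Absolute convergence of the defining integrals -/

/-- The integrals that define `I_0^+ u` converge absolutely. -/
def I0plusConverges (u : ℝ → ℂ) : Prop :=
  (∀ x t : ℝ, 0 ≤ x → 0 < t → Integrable fun z : ℝ => phase x t z * hat u z) ∧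
  ∀ x : ℝ, 0 < x →
    IntervalIntegrable (fun z : ℝ => Complex.exp (Complex.I * z * x) * hat u z) volume (-1) 1 ∧
    GammaIntegrable (Real.sqrt 2) (fun z => Complex.exp (Complex.I * z * x) / (Complex.I * z)) ∧
    IntegrableOn (fun z : ℝ => Complex.exp (Complex.I * z * x) *
      (hat (derivWithin u (Ici 0)) z / (Complex.I * z))) (Iio (-1) ∪ Ioi 1)

/-- The integrals that define `I_0^- u` converge absolutely, and the integral over `γ` agrees with
the one over the real line where both are prescribed. -/
def I0minusConverges (u : ℝ → ℂ) : Prop :=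
  (∀ x t : ℝ, 0 < x → 0 ≤ t → GammaIntegrable 0 (fun z => phase x t z * hat u (-z))) ∧
  (∀ x t : ℝ, 0 ≤ x → 0 < t → Integrable fun z : ℝ => phase x t z * hat u (-z)) ∧
  ∀ x t : ℝ, 0 < x → 0 < t →
    gammaInt 0 (fun z => phase x t z * hat u (-z)) = ∫ z : ℝ, phase x t z * hat u (-z)

/-- The integral that defines `I_1 g` for `x > 0` converges absolutely. -/
def I1Converges (g : ℝ → ℂ) : Prop :=
  ∀ x t : ℝ, 0 < x → 0 ≤ t →
    GammaIntegrable 0 (fun z => phase x t z * tildeT g (z ^ 2) t * z)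

/-- The integrals that define `I_2^+ f` and `I_2^- f` converge absolutely. -/
def I2Converges (f : ℝ × ℝ → ℂ) : Prop :=
  ∀ p ∈ Qpunct, (Integrable fun z : ℝ => phase p.1 p.2 z * tildeXT f z ((z : ℂ) ^ 2) p.2) ∧
    GammaIntegrable 0 (fun z => phase p.1 p.2 z * tildeXT f (-z) (z ^ 2) p.2)

end

end UTM

/-!
The idea is to recognize the contour integrals as classical heat potentials and to prove all
regularity and continuity statements for the potentials.

Let `K_k = ∂_x^k K_0`, where `K_0(x, t) = √(π/t) exp(-x²/(4t))` is the heat kernel times `2π`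
(`heatK`).  Interchanging integrals, and deforming the contour `γ` to the real line
(`integral_halfLine_eq_integral_ray`), one finds in `Q`

* `I_0^± u (x, t) = ∫_0^∞ K_0(x ∓ y, t) u(y) dy` (`halfConv`),
* `I_1 g (x, t) = -i ∫_0^t K_1(x, t - τ) g(τ) dτ` (`timeConv`),
* `I_2^± f (x, t) = ∫_0^t ∫_0^∞ K_0(x ∓ y, t - τ) f(y, τ) dy dτ` (`duhamel`).

On the strips of the punctured quarter-plane `K_k` is rapidly decreasing in `x`, since there the
point `(x, t)` stays away from the singularity `(0, 0)`.  Integration by parts moves a derivative of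
a potential from the kernel to the datum; the boundary terms are of the form `K_k(x, t)` times the
corner value `u(0)` or `g(0)` of the datum, so that they are harmless even though they blow up at the
corner.  Hence all derivatives of the potentials are bounded on the strips by continuous seminorms of
the data.  The predicates `Controlled` and `ControlledUpTo` express such bounds; they are closed
under the operations above (`SchwartzFamily.controlledUpTo`, `SmoothFamily.controlledUpTo`,
`SourceFamily.controlledUpTo`).

Bounds for all derivatives of a function in `Q` make these derivatives Lipschitz near every point of
`Qpunct`, so that they have limits on the two edges, and differentiation commutes with the passage
to the edge (`hasDerivAt_left`, `hasDerivAt_bottom`).  This yields membership in `S_1(Qpunct)` and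
the continuity (`exists_continuous_linearMap`).

It remains to compare the values prescribed on the edges with the limits.  As the limits exist, it
suffices to approach a boundary point along the normal to the edge, where the dominated convergence
theorem applies to the contour integrals.  For `I_0^+` at `t = 0` this uses
`iλ û(λ) = u(0) + û'(λ)` and the deformation of the term with the pole to `γ^*`
(`integral_phase_div`), for `I_2^-` at `x = 0` an integration by parts in time
(`SourceFamily.norm_phase_mul_tildeXT_le`).
-/

namespace UTM

noncomputable section

/-! ### Functions with controlled derivatives on the punctured quarter-plane -/

/-- A function with partial derivatives bounded by `M` on a box is Lipschitz there. -/
theorem norm_sub_le_of_partials {h hx ht : ℝ × ℝ → ℂ} {I J : Set ℝ} (hI : Convex ℝ I)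
    (hJ : Convex ℝ J) {M : ℝ}
    (dx : ∀ x ∈ I, ∀ t ∈ J, HasDerivAt (fun x => h (x, t)) (hx (x, t)) x)
    (dt : ∀ x ∈ I, ∀ t ∈ J, HasDerivAt (fun t => h (x, t)) (ht (x, t)) t)
    (bx : ∀ x ∈ I, ∀ t ∈ J, ‖hx (x, t)‖ ≤ M) (bt : ∀ x ∈ I, ∀ t ∈ J, ‖ht (x, t)‖ ≤ M)
    {x x' t t' : ℝ} (hx1 : x ∈ I) (hx2 : x' ∈ I) (ht1 : t ∈ J) (ht2 : t' ∈ J) :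
    ‖h (x, t) - h (x', t')‖ ≤ M * (|x - x'| + |t - t'|) := by
  have e1 : ‖h (x, t) - h (x', t)‖ ≤ M * ‖x - x'‖ :=
    hI.norm_image_sub_le_of_norm_hasDerivWithin_le (f := fun x => h (x, t))
      (f' := fun x => hx (x, t)) (fun y hy => (dx y hy t ht1).hasDerivWithinAt)
      (fun y hy => bx y hy t ht1) hx2 hx1
  have e2 : ‖h (x', t) - h (x', t')‖ ≤ M * ‖t - t'‖ :=
    hJ.norm_image_sub_le_of_norm_hasDerivWithin_le (f := fun t => h (x', t))
      (f' := fun t => ht (x', t)) (fun y hy => (dt x' hx2 y hy).hasDerivWithinAt)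
      (fun y hy => bt x' hx2 y hy) ht2 ht1
  calc ‖h (x, t) - h (x', t')‖ ≤ ‖h (x, t) - h (x', t)‖ + ‖h (x', t) - h (x', t')‖ :=
        norm_sub_le_norm_sub_add_norm_sub _ _ _
    _ ≤ M * ‖x - x'‖ + M * ‖t - t'‖ := add_le_add e1 e2
    _ = _ := by rw [Real.norm_eq_abs, Real.norm_eq_abs]; ring

/-- Near every point of the punctured quarter-plane, the edges included, `Q` is contained in one
strip; hence bounds on the strips are local bounds up to the edges. -/
theorem exists_box_subset_strip {p : ℝ × ℝ} (hp : p ∈ Qpunct) :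
    ∃ n : ℕ+, ∀ q ∈ Q, |q.1 - p.1| < 1 / (n : ℝ) → |q.2 - p.2| < 1 / (n : ℝ) →
      q ∈ punctured.K n := by
  obtain ⟨⟨h1, h2⟩, h0⟩ := hp
  rcases h2.lt_or_eq with h | h
  · obtain ⟨n, hn⟩ := exists_nat_gt (max (2 / p.2) (p.2 + 1))
    have h3 := (le_max_left _ _).trans_lt hn
    have h4 := (le_max_right _ _).trans_lt hn
    have hn0 : (0 : ℝ) < n := lt_trans (by positivity) h3
    refine ⟨⟨n, by exact_mod_cast hn0⟩, fun q hq _ hb => Or.inl ⟨⟨hq.1.le, hq.2.le⟩, ?_⟩⟩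
    have h5 : 1 / (n : ℝ) < p.2 / 2 := by
      rw [div_lt_iff₀ h] at h3
      rw [div_lt_iff₀ hn0]; linarith
    have h6 : 1 / (n : ℝ) ≤ 1 := by
      rw [div_le_one hn0]; exact_mod_cast Nat.one_le_iff_ne_zero.2 (by rintro rfl; simp at hn0)
    simp only [PNat.mk_coe] at hb ⊢
    rw [abs_lt] at hb
    constructor <;> linarith
  · have hx : 0 < p.1 := lt_of_le_of_ne h1 fun e => h0 (by ext <;> simp [← e, ← h])
    obtain ⟨n, hn⟩ := exists_nat_gt (2 / p.1)
    have hn0 : (0 : ℝ) < n := lt_trans (by positivity) hn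
    refine ⟨⟨n, by exact_mod_cast hn0⟩, fun q hq ha hb => Or.inr ⟨⟨hq.1.le, hq.2.le⟩, ?_⟩⟩
    have h5 : 1 / (n : ℝ) < p.1 / 2 := by
      rw [div_lt_iff₀ hx] at hn
      rw [div_lt_iff₀ hn0]; linarith
    simp only [PNat.mk_coe] at ha hb ⊢
    rw [abs_lt] at ha hb
    constructor <;> linarith

/-- Every point of a strip is the limit of points of the strip that lie in the open
quarter-plane. -/
theorem neBot_strip {n : ℕ+} {p : ℝ × ℝ} (hp : p ∈ punctured.K n) :
    (𝓝[punctured.K n ∩ Q] p).NeBot := by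
  have hn : (0 : ℝ) < 1 / (n : ℝ) := one_div_pos.2 (by exact_mod_cast n.pos)
  have h0 : 0 ≤ p.1 ∧ 0 ≤ p.2 := by rcases hp with ⟨h, -⟩ | ⟨h, -⟩ <;> exact h
  have ht : Tendsto (fun ε : ℝ => (p.1 + ε, max p.2 ε)) (𝓝[>] 0) (𝓝[punctured.K n ∩ Q] p) := by
    refine tendsto_nhdsWithin_iff.2 ⟨?_, ?_⟩
    · have : Continuous fun ε : ℝ => (p.1 + ε, max p.2 ε) := by fun_prop
      have := (this.tendsto 0).mono_left (nhdsWithin_le_nhds (s := Ioi 0))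
      simpa [h0.2] using this
    · filter_upwards [Ioo_mem_nhdsGT hn] with ε hε
      refine ⟨?_, add_pos_of_nonneg_of_pos h0.1 hε.1, lt_max_of_lt_right hε.1⟩
      have hq : ((p.1 + ε, max p.2 ε) : ℝ × ℝ) ∈ Qbar :=
        ⟨add_nonneg h0.1 hε.1.le, le_max_of_le_left h0.2⟩
      rcases hp with ⟨-, h1, h2⟩ | ⟨-, h1, h2⟩
      · refine Or.inl ⟨hq, le_max_of_le_left h1, ?_⟩
        simp only [max_eq_left (hε.2.le.trans h1)]
        exact h2
      · exact Or.inr ⟨hq, by simp only; linarith [hε.1], max_le h2 hε.2.le⟩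
  exact ht.neBot

section controlled
variable {E : Type*} [AddCommGroup E] [Module ℂ E] [TopologicalSpace E]

/-- The weighted sup-norms of `T e` over the strips are bounded by continuous seminorms of `e`. -/
def Controlled (T : E → ℝ × ℝ → ℂ) : Prop :=
  ∀ (n : ℕ+) (N : ℕ), ∃ q : Seminorm ℂ E, Continuous q ∧
    ∀ e, ∀ p ∈ punctured.K n ∩ Q, (1 + p.1) ^ N * ‖T e p‖ ≤ q e

/-- `T e` has classical partial derivatives in `Q` up to the order `m`, all of them controlled by
continuous seminorms of `e`.  No linearity of `T` is asked for. -/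
def ControlledUpTo : ℕ → (E → ℝ × ℝ → ℂ) → Prop
  | 0, T => Controlled T
  | m + 1, T => Controlled T ∧ ∃ Tx Tt : E → ℝ × ℝ → ℂ,
      ControlledUpTo m Tx ∧ ControlledUpTo m Tt ∧
      (∀ e, ∀ p ∈ Q, HasDerivAt (fun x => T e (x, p.2)) (Tx e p) p.1) ∧
      (∀ e, ∀ p ∈ Q, HasDerivAt (fun t => T e (p.1, t)) (Tt e p) p.2)

theorem ControlledUpTo.controlled {m : ℕ} {T : E → ℝ × ℝ → ℂ} (h : ControlledUpTo m T) :
    Controlled T := by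
  cases m with
  | zero => exact h
  | succ m => exact h.1

theorem Controlled.congr {T S : E → ℝ × ℝ → ℂ} (h : Controlled T) (e : ∀ e, EqOn (S e) (T e) Q) :
    Controlled S := by
  intro n N
  obtain ⟨q, hq, b⟩ := h n N
  exact ⟨q, hq, fun a p hp => by rw [e a hp.2]; exact b a p hp⟩

/-- A family `T k` with `∂ₓ T k = T (k+1)` and `∂ₜ T k = T (k+2)`, as it comes from a solution of
the heat equation, is controlled to all orders as soon as each member is controlled. -/
theorem controlledUpTo_of_heat {T : ℕ → E → ℝ × ℝ → ℂ} (h : ∀ k, Controlled (T k))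
    (dx : ∀ k e, ∀ p ∈ Q, HasDerivAt (fun x => T k e (x, p.2)) (T (k + 1) e p) p.1)
    (dt : ∀ k e, ∀ p ∈ Q, HasDerivAt (fun t => T k e (p.1, t)) (T (k + 2) e p) p.2) (m k : ℕ) :
    ControlledUpTo m (T k) := by
  induction m generalizing k with
  | zero => exact h k
  | succ m ih => exact ⟨h k, _, _, ih (k + 1), ih (k + 2), dx k, dt k⟩

theorem Controlled.add {T S : E → ℝ × ℝ → ℂ} (hT : Controlled T) (hS : Controlled S) :
    Controlled fun e p => T e p + S e p := by
  intro n N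
  obtain ⟨q, hq, b⟩ := hT n N
  obtain ⟨q', hq', b'⟩ := hS n N
  refine ⟨q + q', hq.add hq', fun e p hp => ?_⟩
  have w : 0 ≤ (1 + p.1) ^ N := pow_nonneg (by linarith [hp.2.1]) N
  calc (1 + p.1) ^ N * ‖T e p + S e p‖ ≤ (1 + p.1) ^ N * (‖T e p‖ + ‖S e p‖) := by
        gcongr; exact norm_add_le _ _
    _ ≤ q e + q' e := by rw [mul_add]; exact add_le_add (b e p hp) (b' e p hp)

theorem Controlled.const_mul {T : E → ℝ × ℝ → ℂ} (hT : Controlled T) (c : ℂ) :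
    Controlled fun e p => c * T e p := by
  intro n N
  obtain ⟨q, hq, b⟩ := hT n N
  refine ⟨‖c‖₊ • q, hq.const_smul _, fun e p hp => ?_⟩
  rw [norm_mul, mul_left_comm]
  exact mul_le_mul_of_nonneg_left (b e p hp) (norm_nonneg c)

theorem ControlledUpTo.add {m : ℕ} {T S : E → ℝ × ℝ → ℂ} (hT : ControlledUpTo m T)
    (hS : ControlledUpTo m S) : ControlledUpTo m fun e p => T e p + S e p := by
  induction m generalizing T S with
  | zero => exact Controlled.add hT hS
  | succ m ih =>
    obtain ⟨h0, Tx, Tt, hx, ht, dx, dt⟩ := hT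
    obtain ⟨h0', Sx, St, hx', ht', dx', dt'⟩ := hS
    exact ⟨h0.add h0', _, _, ih hx hx', ih ht ht', fun e p hp => (dx e p hp).add (dx' e p hp),
      fun e p hp => (dt e p hp).add (dt' e p hp)⟩

theorem ControlledUpTo.const_mul {m : ℕ} {T : E → ℝ × ℝ → ℂ} (hT : ControlledUpTo m T) (c : ℂ) :
    ControlledUpTo m fun e p => c * T e p := by
  induction m generalizing T with
  | zero => exact Controlled.const_mul hT c
  | succ m ih =>
    obtain ⟨h0, Tx, Tt, hx, ht, dx, dt⟩ := hT
    exact ⟨h0.const_mul c, _, _, ih hx, ih ht, fun e p hp => (dx e p hp).const_mul c,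
      fun e p hp => (dt e p hp).const_mul c⟩

/-- Near a point of the punctured quarter-plane `T e` is Lipschitz. -/
theorem ControlledUpTo.lipschitz_near {T : E → ℝ × ℝ → ℂ} (h : ControlledUpTo 1 T) (e : E)
    {p : ℝ × ℝ} (hp : p ∈ Qpunct) : ∃ ε > 0, ∃ M, ∀ q ∈ Q, ∀ q' ∈ Q,
      |q.1 - p.1| < ε → |q.2 - p.2| < ε → |q'.1 - p.1| < ε → |q'.2 - p.2| < ε →
      ‖T e q - T e q'‖ ≤ M * (|q.1 - q'.1| + |q.2 - q'.2|) := by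
  obtain ⟨n, hn⟩ := exists_box_subset_strip hp
  obtain ⟨-, Tx, Tt, hx, ht, dx, dt⟩ := h
  obtain ⟨r, -, br⟩ := hx.controlled n 0
  obtain ⟨s, -, bs⟩ := ht.controlled n 0
  have hI : ∀ a : ℝ, Convex ℝ {x : ℝ | 0 < x ∧ |x - a| < 1 / (n : ℝ)} := fun a => by
    have : {x : ℝ | 0 < x ∧ |x - a| < 1 / (n : ℝ)} = Ioi 0 ∩ Metric.ball a (1 / (n : ℝ)) := by
      ext x; simp [Real.dist_eq]
    rw [this]; exact (convex_Ioi 0).inter (convex_ball _ _)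
  refine ⟨1 / (n : ℝ), one_div_pos.2 (by exact_mod_cast n.pos), max (r e) (s e),
    fun q hq q' hq' h1 h2 h3 h4 => ?_⟩
  refine norm_sub_le_of_partials (h := T e) (hx := Tx e) (ht := Tt e) (hI p.1) (hI p.2)
    (fun x hx t ht => dx e (x, t) ⟨hx.1, ht.1⟩) (fun x hx t ht => dt e (x, t) ⟨hx.1, ht.1⟩)
    (fun x hx t ht => ?_) (fun x hx t ht => ?_) ⟨hq.1, h1⟩ ⟨hq'.1, h3⟩ ⟨hq.2, h2⟩ ⟨hq'.2, h4⟩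
  · have hxt : ((x, t) : ℝ × ℝ) ∈ Q := ⟨hx.1, ht.1⟩
    have := br e (x, t) ⟨hn _ hxt hx.2 ht.2, hxt⟩
    rw [pow_zero, one_mul] at this
    exact this.trans (le_max_left _ _)
  · have hxt : ((x, t) : ℝ × ℝ) ∈ Q := ⟨hx.1, ht.1⟩
    have := bs e (x, t) ⟨hn _ hxt hx.2 ht.2, hxt⟩
    rw [pow_zero, one_mul] at this
    exact this.trans (le_max_right _ _)

theorem neBot_Q {p : ℝ × ℝ} (hp : p ∈ Qbar) : (𝓝[Q] p).NeBot :=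
  mem_closure_iff_nhdsWithin_neBot.1 (Qbar_subset_closure hp)

/-- A function with bounded first derivatives is Lipschitz, hence Cauchy, near a boundary point. -/
theorem ControlledUpTo.exists_limit {T : E → ℝ × ℝ → ℂ} (h : ControlledUpTo 1 T) (e : E)
    {p : ℝ × ℝ} (hp : p ∈ Qpunct) : ∃ c, Tendsto (T e) (𝓝[Q] p) (𝓝 c) := by
  obtain ⟨ε, hε, M, hM⟩ := h.lipschitz_near e hp
  have := neBot_Q hp.1
  refine cauchy_map_iff_exists_tendsto.1 (Metric.cauchy_iff.2 ⟨inferInstance, fun δ hδ => ?_⟩)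
  set η := min ε (δ / (4 * (|M| + 1))) with hη
  have hM1 : 0 < |M| + 1 := by positivity
  have hη0 : 0 < η := lt_min hε (by positivity)
  refine ⟨T e '' (Q ∩ Metric.ball p η), image_mem_map
    (inter_mem self_mem_nhdsWithin (mem_nhdsWithin_of_mem_nhds (Metric.ball_mem_nhds p hη0))), ?_⟩
  have key : ∀ q ∈ Metric.ball p η, |q.1 - p.1| < η ∧ |q.2 - p.2| < η := fun q hq => by
    rw [Metric.mem_ball, Prod.dist_eq, max_lt_iff] at hq
    exact hq
  rintro _ ⟨q, ⟨hq, hq1⟩, rfl⟩ _ ⟨q', ⟨hq', hq1'⟩, rfl⟩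
  obtain ⟨a, b⟩ := key q hq1
  obtain ⟨c, d⟩ := key q' hq1'
  have hle : η ≤ ε := min_le_left _ _
  rw [dist_eq_norm]
  refine (hM q hq q' hq' (a.trans_le hle) (b.trans_le hle) (c.trans_le hle)
    (d.trans_le hle)).trans_lt ?_
  have e1 : |q.1 - q'.1| < 2 * η := by rw [abs_lt] at *; constructor <;> linarith
  have e2 : |q.2 - q'.2| < 2 * η := by rw [abs_lt] at *; constructor <;> linarith
  have e3 : η ≤ δ / (4 * (|M| + 1)) := min_le_right _ _
  rw [le_div_iff₀ (by positivity)] at e3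
  have s0 : 0 ≤ |q.1 - q'.1| + |q.2 - q'.2| := by positivity
  calc M * (|q.1 - q'.1| + |q.2 - q'.2|)
      ≤ (|M| + 1) * (|q.1 - q'.1| + |q.2 - q'.2|) := by
        gcongr; linarith [le_abs_self M]
    _ < (|M| + 1) * (4 * η) := by gcongr; linarith
    _ ≤ δ := by linarith

theorem ControlledUpTo.continuousOn {T : E → ℝ × ℝ → ℂ} (h : ControlledUpTo 1 T) (e : E) :
    ContinuousOn (T e) Q := by
  intro p hp
  have hp' : p ∈ Qpunct := ⟨⟨hp.1.le, hp.2.le⟩, by rintro rfl; exact lt_irrefl _ hp.1⟩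
  obtain ⟨c, hc⟩ := h.exists_limit e hp'
  have : c = T e p := by
    have h2 : Tendsto (T e) (pure p) (𝓝 c) :=
      hc.mono_left (pure_le_nhdsWithin hp)
    exact tendsto_nhds_unique h2 (tendsto_pure_nhds _ _)
  rwa [← this.symm] at hc

theorem ControlledUpTo.of_succ {m : ℕ} {T : E → ℝ × ℝ → ℂ} (h : ControlledUpTo (m + 1) T) :
    ControlledUpTo m T := by
  induction m generalizing T with
  | zero => exact h.1
  | succ m ih =>
    obtain ⟨h0, Tx, Tt, hx, ht, dx, dt⟩ := h
    exact ⟨h0, Tx, Tt, ih hx, ih ht, dx, dt⟩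

theorem ControlledUpTo.mono {m k : ℕ} (hk : k ≤ m) {T : E → ℝ × ℝ → ℂ}
    (h : ControlledUpTo m T) : ControlledUpTo k T := by
  induction m, hk using Nat.le_induction with
  | base => exact h
  | succ m _ ih => exact ih h.of_succ

theorem ControlledUpTo.hasFDerivAt {T Tx Tt : E → ℝ × ℝ → ℂ} (hx : ControlledUpTo 1 Tx)
    (ht : ControlledUpTo 1 Tt)
    (dx : ∀ e, ∀ p ∈ Q, HasDerivAt (fun x => T e (x, p.2)) (Tx e p) p.1)
    (dt : ∀ e, ∀ p ∈ Q, HasDerivAt (fun t => T e (p.1, t)) (Tt e p) p.2) (e : E) {p : ℝ × ℝ}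
    (hp : p ∈ Q) : HasFDerivAt (T e)
      ((ContinuousLinearMap.toSpanSingleton ℝ (Tx e p)).coprod
        (ContinuousLinearMap.toSpanSingleton ℝ (Tt e p))) p := by
  have cont : ∀ {S : E → ℝ × ℝ → ℂ}, ControlledUpTo 1 S →
      ContinuousAt (fun q => ContinuousLinearMap.toSpanSingleton ℝ (S e q)) p := fun {S} hS =>
    (ContinuousLinearMap.toSpanSingletonCLE : ℂ ≃L[ℝ] ℝ →L[ℝ] ℂ).continuous.continuousAt.comp
      ((hS.continuousOn e).continuousAt (isOpen_Q.mem_nhds hp))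
  exact (hasStrictFDerivAt_uncurry_coprod (u := p) (f := fun x t => T e (x, t))
    (f₁ := fun x t => ContinuousLinearMap.toSpanSingleton ℝ (Tx e (x, t)))
    (f₂ := fun x t => ContinuousLinearMap.toSpanSingleton ℝ (Tt e (x, t)))
    (by filter_upwards [isOpen_Q.mem_nhds hp] with q hq using (dx e q hq).hasFDerivAt)
    (by filter_upwards [isOpen_Q.mem_nhds hp] with q hq using (dt e q hq).hasFDerivAt)
    (cont hx) (cont ht)).hasFDerivAt

theorem ControlledUpTo.contDiffOn {m : ℕ} {T : E → ℝ × ℝ → ℂ} (h : ControlledUpTo (m + 1) T)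
    (e : E) : ContDiffOn ℝ m (T e) Q := by
  induction m generalizing T with
  | zero => exact contDiffOn_zero.2 (h.continuousOn e)
  | succ m ih =>
    obtain ⟨h0, Tx, Tt, hx, ht, dx, dt⟩ := h
    push_cast
    refine (contDiffOn_succ_iff_hasFDerivWithinAt_of_uniqueDiffOn isOpen_Q.uniqueDiffOn).2
      ⟨by simp, fun p => (ContinuousLinearMap.toSpanSingleton ℝ (Tx e p)).coprod
        (ContinuousLinearMap.toSpanSingleton ℝ (Tt e p)), ?_, fun p hp =>
        (ControlledUpTo.hasFDerivAt (hx.mono (by omega)) (ht.mono (by omega)) dx dt e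
          hp).hasFDerivWithinAt⟩
    have cx := ih hx
    have ct := ih ht
    refine contDiffOn_clm_apply.2 fun y => ?_
    simp only [ContinuousLinearMap.coprod_apply, ContinuousLinearMap.toSpanSingleton_apply]
    exact (cx.const_smul y.1).add (ct.const_smul y.2)

/-- The iterated partial derivatives of `T e` are again controlled. -/
theorem ControlledUpTo.exists_pd {T : E → ℝ × ℝ → ℂ} (m k l : ℕ)
    (h : ControlledUpTo (m + k + l) T) :
    ∃ T', ControlledUpTo m T' ∧ ∀ e, EqOn (pd k l (T e)) (T' e) Q := by
  induction k generalizing m with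
  | zero =>
    induction l generalizing m with
    | zero => exact ⟨T, h, fun e p _ => rfl⟩
    | succ l ih =>
      obtain ⟨S, ⟨-, -, St, -, ht, -, dt⟩, hS⟩ := ih (m + 1) (h.mono (by omega))
      refine ⟨St, ht, fun e => ?_⟩
      have e1 : pd 0 (l + 1) (T e) = Dt (pd 0 l (T e)) := by
        simp only [pd, Function.iterate_succ_apply', Function.iterate_zero, id]
      rw [e1]
      exact (Dt_congr (hS e)).trans fun p hp => (dt e p hp).deriv
  | succ k ih =>
    obtain ⟨S, ⟨-, Sx, -, hx, -, dx, -⟩, hS⟩ := ih (m + 1) (h.mono (by omega))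
    refine ⟨Sx, hx, fun e => ?_⟩
    have e1 : pd (k + 1) l (T e) = Dx (pd k l (T e)) := by
      simp only [pd, Function.iterate_succ_apply']
    rw [e1]
    exact (Dx_congr (hS e)).trans fun p hp => (dx e p hp).deriv

/-! ### Derivatives along the edges -/

/-- The parameter of `g` is the distance to the edge; the limit of the functions `g ε` as `ε → 0`
may be differentiated because the derivatives converge locally uniformly. -/
theorem hasDerivAt_of_edge {g g1 : ℝ → ℝ → ℂ} {s : ℝ}
    (h1 : Tendsto (fun q : ℝ × ℝ => g1 q.1 q.2) (𝓝[>] 0 ×ˢ 𝓝 s) (𝓝 (g1 0 s)))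
    (h0 : ContinuousAt (g1 0) s)
    (hd : ∀ᶠ q : ℝ × ℝ in 𝓝[>] 0 ×ˢ 𝓝 s, HasDerivAt (g q.1) (g1 q.1 q.2) q.2)
    (hl : ∀ᶠ r in 𝓝 s, Tendsto (fun ε => g ε r) (𝓝[>] 0) (𝓝 (g 0 r))) :
    HasDerivAt (g 0) (g1 0 s) s := by
  refine hasDerivAt_of_tendstoUniformlyOnFilter (l := 𝓝[>] (0 : ℝ)) (f := g) (f' := g1) ?_ hd hl
  intro u hu
  have h2 : Tendsto (fun q : ℝ × ℝ => g1 0 q.2) (𝓝[>] 0 ×ˢ 𝓝 s) (𝓝 (g1 0 s)) :=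
    h0.tendsto.comp tendsto_snd
  have h3 := (h2.prodMk_nhds h1).eventually
    (show ∀ᶠ z in 𝓝 (g1 0 s, g1 0 s), z ∈ u from nhds_le_uniformity _ hu)
  exact h3

theorem mem_Qpunct_left {τ : ℝ} (h : 0 < τ) : ((0 : ℝ), τ) ∈ Qpunct :=
  ⟨⟨le_rfl, h.le⟩, fun e => h.ne' (Prod.ext_iff.1 e).2⟩

theorem mem_Qpunct_bottom {χ : ℝ} (h : 0 < χ) : (χ, (0 : ℝ)) ∈ Qpunct :=
  ⟨⟨h.le, le_rfl⟩, fun e => h.ne' (Prod.ext_iff.1 e).1⟩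

theorem Qpunct_subset_closure : Qpunct ⊆ closure Q :=
  sdiff_subset.trans Qbar_subset_closure

/-- If `F` has the derivative `F1` in the direction of `t`, and both extend continuously to the
punctured quarter-plane, then the boundary values of `F` on the edge `x = 0` have the boundary values
of `F1` as their derivative. -/
theorem hasDerivAt_left {F F1 : ℝ × ℝ → ℂ}
    (hF : ∀ p ∈ Qpunct, ∃ c, Tendsto F (𝓝[Q] p) (𝓝 c))
    (hF1 : ∀ p ∈ Qpunct, ∃ c, Tendsto F1 (𝓝[Q] p) (𝓝 c))
    (hc : ContinuousOn F Q) (hc1 : ContinuousOn F1 Q)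
    (hd : ∀ p ∈ Q, HasDerivAt (fun t => F (p.1, t)) (F1 p) p.2) {τ : ℝ} (hτ : 0 < τ) :
    HasDerivAt (fun τ => extendFrom Q F (0, τ)) (extendFrom Q F1 (0, τ)) τ := by
  have inQ : ∀ᶠ q : ℝ × ℝ in 𝓝[>] 0 ×ˢ 𝓝 τ, q ∈ Q :=
    prod_mem_prod self_mem_nhdsWithin (isOpen_Ioi.mem_nhds (show τ ∈ Ioi (0 : ℝ) from hτ))
  have toQ : 𝓝[>] 0 ×ˢ 𝓝 τ ≤ 𝓝[Q] ((0 : ℝ), τ) := by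
    refine le_inf ?_ (le_principal_iff.2 inQ)
    rw [nhds_prod_eq]
    exact prod_mono nhdsWithin_le_nhds le_rfl
  refine hasDerivAt_of_edge (g := fun ε s => extendFrom Q F (ε, s))
    (g1 := fun ε s => extendFrom Q F1 (ε, s)) ?_ ?_ ?_ ?_
  · refine ((tendsto_extendFrom (hF1 _ (mem_Qpunct_left hτ))).mono_left toQ).congr' ?_
    filter_upwards [inQ] with q hq using (extendFrom_extends hc1 q hq).symm
  · have h1 := continuousOn_extendFrom Qpunct_subset_closure hF1 _ (mem_Qpunct_left hτ)
    have h2 : ContinuousWithinAt (fun s : ℝ => ((0 : ℝ), s)) (Ioi 0) τ := by fun_prop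
    exact (h1.comp h2 fun s hs => mem_Qpunct_left hs).continuousAt (isOpen_Ioi.mem_nhds hτ)
  · filter_upwards [inQ] with q hq
    simp only [extendFrom_extends hc1 q hq]
    refine (hd q hq).congr_of_eventuallyEq ?_
    filter_upwards [isOpen_Ioi.mem_nhds (show q.2 ∈ Ioi (0 : ℝ) from hq.2)] with s hs
    exact extendFrom_extends hc _ ⟨hq.1, hs⟩
  · filter_upwards [isOpen_Ioi.mem_nhds (show τ ∈ Ioi (0 : ℝ) from hτ)] with s hs
    have h1 := tendsto_extendFrom (hF _ (mem_Qpunct_left hs))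
    have h2 : Tendsto (fun ε : ℝ => (ε, s)) (𝓝[>] 0) (𝓝[Q] (0, s)) := by
      refine tendsto_nhdsWithin_iff.2 ⟨?_, ?_⟩
      · exact ((by fun_prop : Continuous fun ε : ℝ => (ε, s)).tendsto 0).mono_left
          nhdsWithin_le_nhds
      · filter_upwards [self_mem_nhdsWithin] with ε hε using (⟨hε, hs⟩ : 0 < ε ∧ 0 < s)
    refine (h1.comp h2).congr' ?_
    filter_upwards [self_mem_nhdsWithin] with ε hε
    exact (extendFrom_extends hc (ε, s) ⟨hε, hs⟩).symm

/-- The counterpart of `hasDerivAt_left` for the direction of `x` and the edge `t = 0`. -/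
theorem hasDerivAt_bottom {F F1 : ℝ × ℝ → ℂ}
    (hF : ∀ p ∈ Qpunct, ∃ c, Tendsto F (𝓝[Q] p) (𝓝 c))
    (hF1 : ∀ p ∈ Qpunct, ∃ c, Tendsto F1 (𝓝[Q] p) (𝓝 c))
    (hc : ContinuousOn F Q) (hc1 : ContinuousOn F1 Q)
    (hd : ∀ p ∈ Q, HasDerivAt (fun x => F (x, p.2)) (F1 p) p.1) {χ : ℝ} (hχ : 0 < χ) :
    HasDerivAt (fun χ => extendFrom Q F (χ, 0)) (extendFrom Q F1 (χ, 0)) χ := by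
  have inQ : ∀ᶠ q : ℝ × ℝ in 𝓝[>] 0 ×ˢ 𝓝 χ, (q.2, q.1) ∈ Q := by
    filter_upwards [prod_mem_prod self_mem_nhdsWithin
      (isOpen_Ioi.mem_nhds (show χ ∈ Ioi (0 : ℝ) from hχ))] with q hq using ⟨hq.2, hq.1⟩
  have toQ : Tendsto (fun q : ℝ × ℝ => (q.2, q.1)) (𝓝[>] 0 ×ˢ 𝓝 χ) (𝓝[Q] (χ, (0 : ℝ))) := by
    refine tendsto_nhdsWithin_iff.2 ⟨?_, inQ⟩
    rw [nhds_prod_eq]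
    exact tendsto_snd.prodMk (tendsto_fst.mono_right nhdsWithin_le_nhds)
  refine hasDerivAt_of_edge (g := fun ε s => extendFrom Q F (s, ε))
    (g1 := fun ε s => extendFrom Q F1 (s, ε)) ?_ ?_ ?_ ?_
  · refine ((tendsto_extendFrom (hF1 _ (mem_Qpunct_bottom hχ))).comp toQ).congr' ?_
    filter_upwards [inQ] with q hq using (extendFrom_extends hc1 _ hq).symm
  · have h1 := continuousOn_extendFrom Qpunct_subset_closure hF1 _ (mem_Qpunct_bottom hχ)
    have h2 : ContinuousWithinAt (fun s : ℝ => (s, (0 : ℝ))) (Ioi 0) χ := by fun_prop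
    exact (ContinuousWithinAt.comp (f := fun s : ℝ => (s, (0 : ℝ))) h1 h2
      fun s hs => mem_Qpunct_bottom hs).continuousAt (isOpen_Ioi.mem_nhds hχ)
  · filter_upwards [inQ] with q hq
    simp only [extendFrom_extends hc1 _ hq]
    refine (hd _ hq).congr_of_eventuallyEq ?_
    filter_upwards [isOpen_Ioi.mem_nhds (show q.2 ∈ Ioi (0 : ℝ) from hq.1)] with s hs
    exact extendFrom_extends hc _ ⟨hs, hq.2⟩
  · filter_upwards [isOpen_Ioi.mem_nhds (show χ ∈ Ioi (0 : ℝ) from hχ)] with s hs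
    have h1 := tendsto_extendFrom (hF _ (mem_Qpunct_bottom hs))
    have h2 : Tendsto (fun ε : ℝ => (s, ε)) (𝓝[>] 0) (𝓝[Q] (s, 0)) := by
      refine tendsto_nhdsWithin_iff.2 ⟨?_, ?_⟩
      · exact ((by fun_prop : Continuous fun ε : ℝ => (s, ε)).tendsto 0).mono_left
          nhdsWithin_le_nhds
      · filter_upwards [self_mem_nhdsWithin] with ε hε using (⟨hs, hε⟩ : 0 < s ∧ 0 < ε)
    refine (h1.comp h2).congr' ?_
    filter_upwards [self_mem_nhdsWithin] with ε hε
    exact (extendFrom_extends hc (s, ε) ⟨hs, hε⟩).symm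

theorem contDiffOn_Ioi_succ {f f' : ℝ → ℂ} {m : ℕ} (h : ∀ x, 0 < x → HasDerivAt f (f' x) x)
    (h' : ContDiffOn ℝ m f' (Ioi 0)) : ContDiffOn ℝ (m + 1 : ℕ) f (Ioi 0) := by
  push_cast
  refine (contDiffOn_succ_iff_deriv_of_isOpen isOpen_Ioi).2
    ⟨fun x hx => (h x hx).differentiableAt.differentiableWithinAt, by simp, ?_⟩
  exact h'.congr fun x hx => (h x hx).deriv

theorem ControlledUpTo.contDiffOn_edges {m : ℕ} {T : E → ℝ × ℝ → ℂ}
    (h : ControlledUpTo (m + 1) T) (e : E) :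
    ContDiffOn ℝ m (fun τ => extendFrom Q (T e) (0, τ)) (Ioi 0) ∧
    ContDiffOn ℝ m (fun χ => extendFrom Q (T e) (χ, 0)) (Ioi 0) := by
  induction m generalizing T with
  | zero =>
    have h1 := continuousOn_extendFrom Qpunct_subset_closure fun p hp => h.exists_limit e hp
    exact ⟨contDiffOn_zero.2 (h1.comp (by fun_prop) fun s hs => mem_Qpunct_left hs),
      contDiffOn_zero.2 (h1.comp (by fun_prop) fun s hs => mem_Qpunct_bottom hs)⟩
  | succ m ih =>
    have h1 : ControlledUpTo 1 T := h.mono (by omega)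
    obtain ⟨h0, Tx, Tt, hx, ht, dx, dt⟩ := h
    have hx1 : ControlledUpTo 1 Tx := hx.mono (by omega)
    have ht1 : ControlledUpTo 1 Tt := ht.mono (by omega)
    exact ⟨contDiffOn_Ioi_succ (fun τ hτ => hasDerivAt_left (fun p hp => h1.exists_limit e hp)
        (fun p hp => ht1.exists_limit e hp) (h1.continuousOn e) (ht1.continuousOn e) (dt e) hτ)
        (ih ht).1,
      contDiffOn_Ioi_succ (fun τ hτ => hasDerivAt_bottom (fun p hp => h1.exists_limit e hp)
        (fun p hp => hx1.exists_limit e hp) (h1.continuousOn e) (hx1.continuousOn e) (dx e) hτ)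
        (ih hx).2⟩

theorem pd_congr {h₁ h₂ : ℝ × ℝ → ℂ} (h : EqOn h₁ h₂ Q) (k l : ℕ) :
    EqOn (pd k l h₁) (pd k l h₂) Q := by
  have h1 : EqOn (Dt^[l] h₁) (Dt^[l] h₂) Q := by
    induction l with
    | zero => exact h
    | succ l ih => simp only [Function.iterate_succ_apply']; exact Dt_congr ih
  unfold pd
  induction k with
  | zero => exact h1
  | succ k ih => simp only [Function.iterate_succ_apply']; exact Dx_congr ih

theorem extendFrom_congr {F G : ℝ × ℝ → ℂ} (h : EqOn F G Q) {p : ℝ × ℝ} (hp : p ∈ Qpunct)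
    (hG : ∃ c, Tendsto G (𝓝[Q] p) (𝓝 c)) : extendFrom Q F p = extendFrom Q G p :=
  extendFrom_eq (Qpunct_subset_closure hp) ((tendsto_extendFrom hG).congr'
    (h.symm.eventuallyEq_of_mem self_mem_nhdsWithin))

/-- A family of functions that is controlled to all orders, given its boundary values on the
punctured quarter-plane, consists of elements of `S_1`. -/
theorem isSmoothUpTo_of_controlled {T : E → ℝ × ℝ → ℂ} (hT : ∀ m, ControlledUpTo m T) {e : E}
    {h : ℝ × ℝ → ℂ} (hQ : EqOn h (T e) Q) (off : ∀ p, p ∉ Qpunct → h p = 0)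
    (val : ∀ p ∈ Qpunct, Tendsto h (𝓝[Q] p) (𝓝 (h p))) : IsSmoothUpTo Qpunct h := by
  have lim : ∀ k l : ℕ, ∀ p ∈ Qpunct, ∃ c : ℂ, Tendsto (pd k l h) (𝓝[Q] p) (𝓝 c) := by
    intro k l p hp
    obtain ⟨T', h1, h2⟩ := (hT (1 + k + l)).exists_pd 1 k l
    obtain ⟨c, hc⟩ := h1.exists_limit e hp
    exact ⟨c, hc.congr' (((pd_congr hQ k l).trans (h2 e)).symm.eventuallyEq_of_mem
      self_mem_nhdsWithin)⟩
  have edge : ∀ k l m : ℕ, ContDiffOn ℝ m (fun τ => pdBar k l h (0, τ)) (Ioi 0) ∧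
      ContDiffOn ℝ m (fun χ => pdBar k l h (χ, 0)) (Ioi 0) := by
    intro k l m
    obtain ⟨T', h1, h2⟩ := (hT (m + 1 + k + l)).exists_pd (m + 1) k l
    have h3 := h1.contDiffOn_edges e
    have h4 := (pd_congr hQ k l).trans (h2 e)
    have h5 : ControlledUpTo 1 T' := h1.mono (by omega)
    exact ⟨h3.1.congr fun τ hτ => extendFrom_congr h4 (mem_Qpunct_left hτ)
        (h5.exists_limit e (mem_Qpunct_left hτ)),
      h3.2.congr fun τ hτ => extendFrom_congr h4 (mem_Qpunct_bottom hτ)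
        (h5.exists_limit e (mem_Qpunct_bottom hτ))⟩
  have sl : {τ : ℝ | ((0 : ℝ), τ) ∈ Qpunct} ⊆ Ioi 0 := fun τ hτ =>
    lt_of_le_of_ne hτ.1.2 fun e => hτ.2 (by simpa using e.symm)
  have sb : {χ : ℝ | (χ, (0 : ℝ)) ∈ Qpunct} ⊆ Ioi 0 := fun τ hτ =>
    lt_of_le_of_ne hτ.1.1 fun e => hτ.2 (by simpa using e.symm)
  exact
    { zero_off := off
      contDiffOn := contDiffOn_infty.2 fun m => ((hT (m + 1)).contDiffOn e).congr hQ
      limit := lim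
      value := val
      left := fun k l => (contDiffOn_infty.2 fun m => (edge k l m).1).mono sl
      bottom := fun k l => (contDiffOn_infty.2 fun m => (edge k l m).2).mono sb }

/-- Bounds in the open part of a strip extend to its edges by passage to the limit. -/
theorem norm_pdBar_le_of_controlled {T T' : E → ℝ × ℝ → ℂ} {e : E} {h : ℝ × ℝ → ℂ}
    (hQ : EqOn h (T e) Q) {k l : ℕ} (hT' : ControlledUpTo 1 T')
    (hpd : EqOn (pd k l (T e)) (T' e) Q) {n : ℕ+} {N : ℕ} {C : ℝ}
    (hC : ∀ p ∈ punctured.K n ∩ Q, (1 + p.1) ^ N * ‖T' e p‖ ≤ C) {p : ℝ × ℝ}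
    (hp : p ∈ punctured.K n) : (1 + p.1) ^ N * ‖pdBar k l h p‖ ≤ C := by
  have hpQ : p ∈ Qpunct := punctured.K_subset n hp
  have h4 := (pd_congr hQ k l).trans hpd
  have e1 : pdBar k l h p = extendFrom Q (T' e) p :=
    extendFrom_congr h4 hpQ (hT'.exists_limit e hpQ)
  rw [e1]
  have h5 := (tendsto_extendFrom (hT'.exists_limit e hpQ)).mono_left
    (nhdsWithin_mono p (inter_subset_right (s := punctured.K n)))
  have h6 : Tendsto (fun q : ℝ × ℝ => (1 + q.1) ^ N) (𝓝[punctured.K n ∩ Q] p)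
      (𝓝 ((1 + p.1) ^ N)) :=
    ((by fun_prop : Continuous fun q : ℝ × ℝ => (1 + q.1) ^ N).tendsto p).mono_left
      nhdsWithin_le_nhds
  have := neBot_strip hp
  exact le_of_tendsto (h6.mul h5.norm) (eventually_of_mem self_mem_nhdsWithin hC)

/-- The seminorms of a controlled family are bounded by continuous seminorms of the parameter. -/
theorem exists_seminorm_of_controlled {T : E → ℝ × ℝ → ℂ}
    (hT : ∀ m, ControlledUpTo m T) {h : E → ℝ × ℝ → ℂ} (hQ : ∀ e, EqOn (h e) (T e) Q) (n : ℕ+) :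
    ∃ q : Seminorm ℂ E, Continuous q ∧ ∀ e, ∀ r ∈ stripValues (punctured.K n) n (h e), r ≤ q e := by
  have key : ∀ i : ℕ × ℕ, ∃ q : Seminorm ℂ E, Continuous q ∧ ∀ e, ∀ p ∈ punctured.K n,
      (1 + p.1) ^ (n : ℕ) * ‖pdBar i.1 i.2 (h e) p‖ ≤ q e := by
    rintro ⟨k, l⟩
    obtain ⟨T', h1, h2⟩ := (hT (1 + k + l)).exists_pd 1 k l
    obtain ⟨q, hq, b⟩ := h1.controlled n n
    exact ⟨q, hq, fun e p hp => norm_pdBar_le_of_controlled (hQ e) h1 (h2 e) (b e) hp⟩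
  choose q hq b using key
  refine ⟨∑ i ∈ Finset.range (n + 1) ×ˢ Finset.range (n + 1), q i, ?_, ?_⟩
  · have : ∀ s : Finset (ℕ × ℕ), Continuous (⇑(∑ i ∈ s, q i)) := fun s => by
      induction s using Finset.induction_on with
      | empty => simpa using! continuous_const
      | insert i s hi ih => rw [Finset.sum_insert hi]; exact (hq i).add ih
    exact this _
  · rintro e r ⟨k, l, p, hp, hkl, rfl⟩
    have hmem : (k, l) ∈ Finset.range ((n : ℕ) + 1) ×ˢ Finset.range ((n : ℕ) + 1) := by
      simp only [Finset.mem_product, Finset.mem_range]; omega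
    refine (b (k, l) e p hp).trans ?_
    rw [← Finset.add_sum_erase _ _ hmem, add_apply]
    exact le_add_of_nonneg_right (apply_nonneg _ _)

end controlled

/-! ### The heat kernel and its derivatives -/

/-- The derivatives of the Gaussian `√π exp(-w²/4)`, given by the recursion that expresses the heat
equation for the kernel `heatK` in the self-similar variable. -/
def heatProfile : ℕ → ℝ → ℝ
  | 0, w => √Real.pi * Real.exp (-w ^ 2 / 4)
  | 1, w => -(w / 2) * heatProfile 0 w
  | k + 2, w => -((k + 1) / 2) * heatProfile k w - w / 2 * heatProfile (k + 1) w

theorem heatProfile_zero (w : ℝ) : heatProfile 0 w = √Real.pi * Real.exp (-w ^ 2 / 4) := rfl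

theorem heatProfile_one (w : ℝ) : heatProfile 1 w = -(w / 2) * heatProfile 0 w := rfl

theorem heatProfile_add_two (k : ℕ) (w : ℝ) : heatProfile (k + 2) w =
    -((k + 1) / 2) * heatProfile k w - w / 2 * heatProfile (k + 1) w := rfl

theorem hasDerivAt_heatProfile_zero (w : ℝ) :
    HasDerivAt (heatProfile 0) (heatProfile 1 w) w := by
  have h1 : HasDerivAt (fun w : ℝ => -w ^ 2 / 4) (-(w / 2)) w := by
    convert! ((hasDerivAt_pow 2 w).neg.div_const 4) using 1
    simp; ring
  refine (h1.exp.const_mul √Real.pi).congr_deriv ?_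
  rw [heatProfile_one, heatProfile_zero]; ring

theorem hasDerivAt_heatProfile (k : ℕ) (w : ℝ) :
    HasDerivAt (heatProfile k) (heatProfile (k + 1) w) w := by
  induction k using Nat.twoStepInduction generalizing w with
  | zero => exact hasDerivAt_heatProfile_zero w
  | one =>
    have h1 : HasDerivAt (fun w : ℝ => -(w / 2)) (-(1 / 2)) w :=
      ((hasDerivAt_id w).div_const 2).neg
    refine (h1.mul (hasDerivAt_heatProfile_zero w)).congr_deriv ?_
    rw [heatProfile_add_two]; simp; ring
  | more k ih1 ih2 =>
    have h1 : HasDerivAt (fun w : ℝ => w / 2) (1 / 2) w := (hasDerivAt_id w).div_const 2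
    refine (((ih1 w).const_mul (-(((k : ℝ) + 1) / 2))).sub (h1.mul (ih2 w))).congr_deriv ?_
    rw [heatProfile_add_two (k + 1)]; push_cast; ring

theorem continuous_heatProfile (k : ℕ) : Continuous (heatProfile k) :=
  continuous_iff_continuousAt.2 fun w => (hasDerivAt_heatProfile k w).continuousAt

theorem heatProfile_zero_decay (j : ℕ) :
    ∃ C, 0 ≤ C ∧ ∀ w, (1 + |w|) ^ j * |heatProfile 0 w| ≤ C := by
  refine ⟨2 ^ j * (1 + 4 ^ j * j.factorial) * √Real.pi, by positivity, fun w => ?_⟩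
  have h1 : (1 + |w|) ^ j ≤ 2 ^ j * (1 + (w ^ 2) ^ j) := by
    rcases le_total |w| 1 with h | h
    · calc (1 + |w|) ^ j ≤ 2 ^ j := by gcongr; linarith
        _ ≤ 2 ^ j * (1 + (w ^ 2) ^ j) :=
          le_mul_of_one_le_right (by positivity) (le_add_of_nonneg_right (by positivity))
    · calc (1 + |w|) ^ j ≤ (2 * w ^ 2) ^ j := by
            gcongr; rw [← sq_abs w]; nlinarith
        _ = 2 ^ j * (w ^ 2) ^ j := mul_pow _ _ _
        _ ≤ 2 ^ j * (1 + (w ^ 2) ^ j) := by gcongr; linarith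
  have h2 := Real.pow_div_factorial_le_exp (w ^ 2 / 4) (by positivity) j
  have h3 : (w ^ 2) ^ j * Real.exp (-w ^ 2 / 4) ≤ 4 ^ j * j.factorial := by
    rw [div_pow, div_div, div_le_iff₀ (by positivity)] at h2
    calc (w ^ 2) ^ j * Real.exp (-w ^ 2 / 4)
        ≤ Real.exp (w ^ 2 / 4) * (4 ^ j * j.factorial) * Real.exp (-w ^ 2 / 4) := by gcongr
      _ = 4 ^ j * j.factorial * (Real.exp (w ^ 2 / 4) * Real.exp (-w ^ 2 / 4)) := by ring
      _ = _ := by rw [← Real.exp_add, show w ^ 2 / 4 + -w ^ 2 / 4 = 0 by ring]; simp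
  have h4 : Real.exp (-w ^ 2 / 4) ≤ 1 := Real.exp_le_one_iff.2 (by nlinarith [sq_nonneg w])
  have h5 : 0 ≤ √Real.pi * Real.exp (-w ^ 2 / 4) :=
    mul_nonneg (Real.sqrt_nonneg _) (Real.exp_nonneg _)
  rw [heatProfile_zero, abs_of_nonneg h5]
  calc (1 + |w|) ^ j * (√Real.pi * Real.exp (-w ^ 2 / 4))
      ≤ 2 ^ j * (1 + (w ^ 2) ^ j) * (√Real.pi * Real.exp (-w ^ 2 / 4)) := by gcongr
    _ = 2 ^ j * (Real.exp (-w ^ 2 / 4) + (w ^ 2) ^ j * Real.exp (-w ^ 2 / 4)) * √Real.pi := by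
      ring
    _ ≤ _ := by gcongr

theorem heatProfile_decay (k j : ℕ) :
    ∃ C, 0 ≤ C ∧ ∀ w, (1 + |w|) ^ j * |heatProfile k w| ≤ C := by
  induction k using Nat.twoStepInduction generalizing j with
  | zero => exact heatProfile_zero_decay j
  | one =>
    obtain ⟨C, hC, b⟩ := heatProfile_zero_decay (j + 1)
    refine ⟨C, hC, fun w => le_trans ?_ (b w)⟩
    rw [heatProfile_one, abs_mul, abs_neg, abs_div, abs_of_pos (by norm_num : (0 : ℝ) < 2), pow_succ,
      mul_assoc]
    gcongr
    linarith [abs_nonneg w]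
  | more k ih1 ih2 =>
    obtain ⟨C, hC, b⟩ := ih1 j
    obtain ⟨D, hD, d⟩ := ih2 (j + 1)
    refine ⟨(k + 1) / 2 * C + D, by positivity, fun w => ?_⟩
    rw [heatProfile_add_two]
    have h1 : |-(((k : ℝ) + 1) / 2) * heatProfile k w - w / 2 * heatProfile (k + 1) w| ≤
        (k + 1) / 2 * |heatProfile k w| + (1 + |w|) * |heatProfile (k + 1) w| := by
      refine (abs_sub _ _).trans ?_
      rw [abs_mul, abs_mul, abs_neg, abs_of_nonneg (by positivity : (0 : ℝ) ≤ (k + 1) / 2), abs_div,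
        abs_of_pos (by norm_num : (0 : ℝ) < 2)]
      gcongr
      linarith [abs_nonneg w]
    calc (1 + |w|) ^ j * |_|
        ≤ (1 + |w|) ^ j * ((k + 1) / 2 * |heatProfile k w| + (1 + |w|) * |heatProfile (k + 1) w|) :=
          by gcongr
      _ = (k + 1) / 2 * ((1 + |w|) ^ j * |heatProfile k w|) +
          (1 + |w|) ^ (j + 1) * |heatProfile (k + 1) w| := by ring
      _ ≤ _ := by gcongr; exacts [b w, d w]

/-- The `k`-th `x`-derivative of the heat kernel `√(π/t) exp(-x²/(4t))`, as a function of `x` and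
`t`.  For `t ≤ 0` its value is zero, because `√t = 0` there and `0⁻¹ = 0`. -/
def heatK (k : ℕ) (x t : ℝ) : ℝ := (√t)⁻¹ ^ (k + 1) * heatProfile k (x * (√t)⁻¹)

theorem heatK_of_nonpos {k : ℕ} {x t : ℝ} (ht : t ≤ 0) : heatK k x t = 0 := by
  simp [heatK, Real.sqrt_eq_zero_of_nonpos ht]

theorem hasDerivAt_heatK_x (k : ℕ) (x t : ℝ) :
    HasDerivAt (fun x => heatK k x t) (heatK (k + 1) x t) x := by
  have h1 : HasDerivAt (fun x : ℝ => x * (√t)⁻¹) (√t)⁻¹ x := by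
    simpa using (hasDerivAt_id x).mul_const (√t)⁻¹
  have h2 := ((hasDerivAt_heatProfile k (x * (√t)⁻¹)).comp x h1).const_mul ((√t)⁻¹ ^ (k + 1))
  convert! h2 using 1
  simp only [heatK]; ring

theorem measurable_heatK (k : ℕ) : Measurable fun p : ℝ × ℝ => heatK k p.1 p.2 := by
  have h1 : Measurable fun p : ℝ × ℝ => (√p.2)⁻¹ :=
    (Real.continuous_sqrt.measurable.comp measurable_snd).inv
  exact (h1.pow_const _).mul ((continuous_heatProfile k).measurable.comp (measurable_fst.mul h1))

theorem continuous_heatK_x (k : ℕ) (t : ℝ) : Continuous fun x => heatK k x t :=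
  continuous_iff_continuousAt.2 fun x => (hasDerivAt_heatK_x k x t).continuousAt

/-- A weight in `x` is dominated, for bounded `t`, by the weight in the similarity variable
`x / √t` of the heat kernel. -/
theorem weight_le {x t T : ℝ} (ht : 0 < t) (hT : t ≤ T) (N : ℕ) :
    (1 + |x|) ^ N ≤ (1 + √T) ^ N * (1 + |x * (√t)⁻¹|) ^ N := by
  rw [← mul_pow]
  have hs : 0 < √t := Real.sqrt_pos.2 ht
  have h1 : |x| = √t * |x * (√t)⁻¹| := by
    rw [abs_mul, abs_of_pos (inv_pos.2 hs)]; field_simp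
  have h2 : √t ≤ √T := Real.sqrt_le_sqrt hT
  set w := |x * (√t)⁻¹|
  have hw : 0 ≤ w := abs_nonneg _
  gcongr
  rw [h1]
  nlinarith [mul_le_mul_of_nonneg_right h2 hw, Real.sqrt_nonneg T]

theorem weight_heatK_le {x t T : ℝ} (ht : 0 < t) (hT : t ≤ T) (N k : ℕ) :
    (1 + |x|) ^ N * |heatK k x t| ≤ (1 + √T) ^ N * ((√t)⁻¹ ^ (k + 1) *
      ((1 + |x * (√t)⁻¹|) ^ N * |heatProfile k (x * (√t)⁻¹)|)) := by
  have hs : 0 ≤ (√t)⁻¹ ^ (k + 1) := by positivity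
  rw [heatK, abs_mul, abs_of_nonneg hs]
  calc _ ≤ (1 + √T) ^ N * (1 + |x * (√t)⁻¹|) ^ N *
        ((√t)⁻¹ ^ (k + 1) * |heatProfile k (x * (√t)⁻¹)|) := by
        gcongr; exact weight_le ht hT N
    _ = _ := by ring

/-- Where `|x|` is bounded below, powers of `t⁻¹` may be traded for powers of the similarity variable,
against which `heatProfile` decays. -/
theorem inv_sqrt_le {δ x t : ℝ} (hδ : 0 < δ) (hx : δ ≤ |x|) :
    (√t)⁻¹ ≤ δ⁻¹ * (1 + |x * (√t)⁻¹|) := by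
  have hs : 0 ≤ (√t)⁻¹ := by positivity
  rw [abs_mul, abs_of_nonneg hs, inv_mul_eq_div, le_div_iff₀ hδ]
  nlinarith [mul_le_mul_of_nonneg_left hx hs]

/-- Away from the origin the heat kernel and its derivatives are bounded and decay rapidly in `x`,
locally uniformly in `t`. -/
theorem heatK_bound (k N : ℕ) {δ T : ℝ} (hδ : 0 < δ) :
    ∃ C, 0 ≤ C ∧ ∀ x t, t ≤ T → (δ ≤ |x| ∨ δ ≤ t) → (1 + |x|) ^ N * |heatK k x t| ≤ C := by
  obtain ⟨C, hC, b⟩ := heatProfile_decay k N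
  obtain ⟨D, hD, d⟩ := heatProfile_decay k (k + 1 + N)
  refine ⟨(1 + √T) ^ N * ((√δ)⁻¹ ^ (k + 1) * C) + (1 + √T) ^ N * (δ⁻¹ ^ (k + 1) * D),
    by positivity, fun x t hT h => ?_⟩
  rcases le_or_gt t 0 with ht | ht
  · rw [heatK_of_nonpos ht, abs_zero, mul_zero]; positivity
  refine (weight_heatK_le ht hT N k).trans ?_
  have hs : 0 ≤ (√t)⁻¹ := by positivity
  rcases h with h | h
  · refine le_add_of_nonneg_of_le (by positivity) ?_
    refine mul_le_mul_of_nonneg_left ?_ (by positivity)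
    calc (√t)⁻¹ ^ (k + 1) * ((1 + |x * (√t)⁻¹|) ^ N * |heatProfile k (x * (√t)⁻¹)|)
        ≤ (δ⁻¹ * (1 + |x * (√t)⁻¹|)) ^ (k + 1) *
          ((1 + |x * (√t)⁻¹|) ^ N * |heatProfile k (x * (√t)⁻¹)|) := by
          gcongr; exact inv_sqrt_le hδ h
      _ = δ⁻¹ ^ (k + 1) * ((1 + |x * (√t)⁻¹|) ^ (k + 1 + N) *
          |heatProfile k (x * (√t)⁻¹)|) := by rw [mul_pow, pow_add]; ring
      _ ≤ _ := by gcongr; exact d _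
  · refine le_add_of_le_of_nonneg ?_ (by positivity)
    gcongr
    exact b _

theorem heatK_bound' (k : ℕ) {δ T : ℝ} (hδ : 0 < δ) :
    ∃ C, 0 ≤ C ∧ ∀ x t, t ≤ T → (δ ≤ |x| ∨ δ ≤ t) → |heatK k x t| ≤ C := by
  obtain ⟨C, hC, h⟩ := heatK_bound k 0 (T := T) hδ
  exact ⟨C, hC, fun x t hT hx => by simpa using h x t hT hx⟩

/-- The kernel vanishes to second order as `t → 0` with `x ≠ 0`, so that its continuation by zero is
differentiable at `t = 0`. -/
theorem abs_heatK_le_sq (k : ℕ) {δ : ℝ} (hδ : 0 < δ) :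
    ∃ C, 0 ≤ C ∧ ∀ x t, δ ≤ |x| → |heatK k x t| ≤ C * t ^ 2 := by
  obtain ⟨D, hD, d⟩ := heatProfile_decay k (k + 5)
  refine ⟨δ⁻¹ ^ (k + 5) * D, by positivity, fun x t h => ?_⟩
  rcases le_or_gt t 0 with ht | ht
  · rw [heatK_of_nonpos ht, abs_zero]; positivity
  have hs : 0 ≤ (√t)⁻¹ := by positivity
  have h4 : (√t)⁻¹ ^ (k + 1) = (√t)⁻¹ ^ (k + 5) * t ^ 2 := by
    have h5 : √t ≠ 0 := (Real.sqrt_pos.2 ht).ne'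
    have h6 : t ^ 2 = √t ^ 4 := by rw [show √t ^ 4 = (√t ^ 2) ^ 2 by ring, Real.sq_sqrt ht.le]
    rw [h6, show k + 5 = k + 1 + 4 by ring, pow_add _ (k + 1) 4, mul_assoc, ← mul_pow,
      inv_mul_cancel₀ h5, one_pow, mul_one]
  rw [heatK, abs_mul, abs_of_nonneg (by positivity), h4]
  calc (√t)⁻¹ ^ (k + 5) * t ^ 2 * |heatProfile k (x * (√t)⁻¹)|
      ≤ (δ⁻¹ * (1 + |x * (√t)⁻¹|)) ^ (k + 5) * t ^ 2 * |heatProfile k (x * (√t)⁻¹)| := by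
        gcongr; exact inv_sqrt_le hδ h
    _ = δ⁻¹ ^ (k + 5) * ((1 + |x * (√t)⁻¹|) ^ (k + 5) * |heatProfile k (x * (√t)⁻¹)|) * t ^ 2 := by
        rw [mul_pow]; ring
    _ ≤ _ := by gcongr; exact d _

/-- Away from the origin the heat kernel, continued by zero to `t ≤ 0`, solves the heat equation. -/
theorem hasDerivAt_heatK_t (k : ℕ) {x t : ℝ} (h : 0 < t ∨ x ≠ 0) :
    HasDerivAt (fun t => heatK k x t) (heatK (k + 2) x t) t := by
  rcases lt_trichotomy t 0 with ht | rfl | ht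
  · rw [heatK_of_nonpos ht.le]
    refine (hasDerivAt_const t (0 : ℝ)).congr_of_eventuallyEq ?_
    filter_upwards [isOpen_Iio.mem_nhds ht] with s hs using heatK_of_nonpos (le_of_lt hs)
  · have hx : x ≠ 0 := h.resolve_left (lt_irrefl _)
    obtain ⟨C, hC, b⟩ := abs_heatK_le_sq k (abs_pos.2 hx)
    rw [heatK_of_nonpos le_rfl, hasDerivAt_iff_isLittleO_nhds_zero]
    simp only [zero_add, heatK_of_nonpos le_rfl, sub_zero, smul_zero]
    refine Asymptotics.IsBigO.trans_isLittleO (g := fun t : ℝ => t ^ 2) ?_ ?_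
    · refine Asymptotics.IsBigO.of_bound C (Eventually.of_forall fun t => ?_)
      rw [Real.norm_eq_abs, Real.norm_of_nonneg (sq_nonneg t)]
      exact b x t le_rfl
    · simpa using Asymptotics.isLittleO_pow_pow (𝕜 := ℝ) (m := 1) (n := 2) (by norm_num)
  · have hs : 0 < √t := Real.sqrt_pos.2 ht
    have h1 : HasDerivAt (fun t => (√t)⁻¹) (-(1 / 2) * (√t)⁻¹ ^ 3) t := by
      convert! (Real.hasDerivAt_sqrt ht.ne').inv hs.ne' using 1
      field_simp
    have h2 : HasDerivAt (fun t => x * (√t)⁻¹) (x * (-(1 / 2) * (√t)⁻¹ ^ 3)) t := h1.const_mul x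
    have h3 := (h1.pow (k + 1)).mul
      (HasDerivAt.comp (h₂ := heatProfile k) t (hasDerivAt_heatProfile k (x * (√t)⁻¹)) h2)
    convert! h3 using 1
    rw [heatK, heatProfile_add_two]
    simp only [Pi.pow_apply, Function.comp_apply]
    rw [show k + 2 + 1 = k + 3 by ring, show k + 1 - 1 = k by omega]
    push_cast
    ring

theorem integrable_heatProfile_weight (k N : ℕ) :
    Integrable fun w => (1 + |w|) ^ N * |heatProfile k w| := by
  obtain ⟨C, hC, b⟩ := heatProfile_decay k (N + 2)
  have h1 := (integrable_inv_one_add_sq).const_mul C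
  refine h1.mono' (((by fun_prop : Continuous fun w : ℝ => (1 + |w|) ^ N).mul
    (continuous_heatProfile k).abs).aestronglyMeasurable) (Eventually.of_forall fun w => ?_)
  rw [Real.norm_of_nonneg (by positivity), ← div_eq_mul_inv, le_div_iff₀ (by positivity)]
  refine le_trans ?_ (b w)
  calc (1 + |w|) ^ N * |heatProfile k w| * (1 + w ^ 2)
      ≤ (1 + |w|) ^ N * |heatProfile k w| * (1 + |w|) ^ 2 := by
        gcongr; rw [← sq_abs w]; nlinarith [abs_nonneg w]
    _ = _ := by ring

/-- The weighted `L¹` norm of the heat kernel is bounded for bounded times. -/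
theorem heatK_weight_integral (N : ℕ) (T : ℝ) : ∃ C, 0 ≤ C ∧ ∀ t, 0 < t → t ≤ T →
    Integrable (fun z => (1 + |z|) ^ N * |heatK 0 z t|) ∧
      ∫ z, (1 + |z|) ^ N * |heatK 0 z t| ≤ C := by
  set G : ℝ → ℝ := fun w => (1 + |w|) ^ N * |heatProfile 0 w| with hG
  have hGi : Integrable G := integrable_heatProfile_weight 0 N
  refine ⟨(1 + √T) ^ N * ∫ w, G w, mul_nonneg (by positivity)
    (integral_nonneg fun w => by positivity), fun t ht hT => ?_⟩
  have hs : 0 < (√t)⁻¹ := inv_pos.2 (Real.sqrt_pos.2 ht)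
  have h1 : ∀ z, (1 + |z|) ^ N * |heatK 0 z t| ≤ (1 + √T) ^ N * ((√t)⁻¹ * G (z * (√t)⁻¹)) :=
    fun z => by simpa [hG] using weight_heatK_le (x := z) ht hT N 0
  have h2 : Integrable fun z => (1 + √T) ^ N * ((√t)⁻¹ * G (z * (√t)⁻¹)) :=
    ((hGi.comp_mul_right' hs.ne').const_mul _).const_mul _
  have h3 : Integrable (fun z => (1 + |z|) ^ N * |heatK 0 z t|) :=
    h2.mono' (((by fun_prop : Continuous fun w : ℝ => (1 + |w|) ^ N).mul
      (continuous_heatK_x 0 t).abs).aestronglyMeasurable) (Eventually.of_forall fun w => by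
        rw [Real.norm_of_nonneg (by positivity)]; exact h1 w)
  refine ⟨h3, (integral_mono h3 h2 h1).trans_eq ?_⟩
  rw [integral_const_mul, integral_const_mul, Measure.integral_comp_mul_right, inv_inv,
    smul_eq_mul, abs_of_pos (inv_pos.1 hs), ← mul_assoc (√t)⁻¹, inv_mul_cancel₀ (inv_pos.1 hs).ne',
    one_mul]

/-! ### Convolution of the heat kernel with initial data -/

/-- The convolution `∫_0^∞ K_k(x - σy, t) u(y) dy` of the `k`-th derivative of the heat kernel with
half-line data; `σ = 1` gives the initial-value potential, `σ = -1` its mirror image. -/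
def halfConv (σ : ℝ) (k : ℕ) (u : ℝ → ℂ) (p : ℝ × ℝ) : ℂ :=
  ∫ y in Ioi (0 : ℝ), (heatK k (p.1 - σ * y) p.2 : ℂ) * u y

theorem integrableOn_of_decay {u : ℝ → ℂ} {M : ℝ}
    (hm : AEStronglyMeasurable u (volume.restrict (Ioi 0)))
    (hb : ∀ y, 0 < y → (1 + y) ^ 2 * ‖u y‖ ≤ M) :
    IntegrableOn u (Ioi 0) ∧ ∫ y in Ioi (0 : ℝ), ‖u y‖ ≤ M * Real.pi := by
  have hM : 0 ≤ M := le_trans (by positivity) (hb 1 one_pos)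
  have h1 : Integrable fun y : ℝ => M * (1 + y ^ 2)⁻¹ := integrable_inv_one_add_sq.const_mul M
  have h2 : ∀ y ∈ Ioi (0 : ℝ), ‖u y‖ ≤ M * (1 + y ^ 2)⁻¹ := fun y hy => by
    have hy : 0 < y := hy
    rw [← div_eq_mul_inv, le_div_iff₀ (by positivity), mul_comm]
    refine le_trans ?_ (hb y hy)
    gcongr
    nlinarith
  have h3 : IntegrableOn u (Ioi 0) :=
    h1.integrableOn.mono' hm ((ae_restrict_mem measurableSet_Ioi).mono h2)
  refine ⟨h3, ?_⟩
  calc ∫ y in Ioi (0 : ℝ), ‖u y‖ ≤ ∫ y in Ioi (0 : ℝ), M * (1 + y ^ 2)⁻¹ :=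
        setIntegral_mono_on h3.norm h1.integrableOn measurableSet_Ioi h2
    _ ≤ ∫ y : ℝ, M * (1 + y ^ 2)⁻¹ :=
        setIntegral_le_integral h1 (Eventually.of_forall fun y => by positivity)
    _ = M * Real.pi := by rw [integral_const_mul, integral_univ_inv_one_add_sq]

theorem continuous_heatK_line (σ : ℝ) (k : ℕ) (x t : ℝ) :
    Continuous fun y => (heatK k (x - σ * y) t : ℂ) :=
  Complex.continuous_ofReal.comp ((continuous_heatK_x k t).comp (by fun_prop))

theorem integrableOn_heatK_mul (σ : ℝ) (k : ℕ) (x t : ℝ) {u : ℝ → ℂ}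
    (hu : IntegrableOn u (Ioi 0)) :
    IntegrableOn (fun y => (heatK k (x - σ * y) t : ℂ) * u y) (Ioi 0) := by
  rcases le_or_gt t 0 with ht | ht
  · simp [heatK_of_nonpos ht]
  obtain ⟨C, -, b⟩ := heatK_bound' k (T := t) ht
  refine Integrable.bdd_mul (c := C) hu
    (continuous_heatK_line σ k x t).aestronglyMeasurable (Eventually.of_forall fun y => ?_)
  rw [Complex.norm_real]
  exact b _ _ le_rfl (Or.inr le_rfl)

theorem hasDerivAt_halfConv_x (σ : ℝ) (k : ℕ) {u : ℝ → ℂ} (hu : IntegrableOn u (Ioi 0)) (x : ℝ)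
    {t : ℝ} (ht : 0 < t) :
    HasDerivAt (fun x => halfConv σ k u (x, t)) (halfConv σ (k + 1) u (x, t)) x := by
  obtain ⟨C, -, b⟩ := heatK_bound' (k + 1) (T := t) ht
  refine (hasDerivAt_integral_of_dominated_loc_of_deriv_le
    (F := fun x y => (heatK k (x - σ * y) t : ℂ) * u y)
    (F' := fun x y => (heatK (k + 1) (x - σ * y) t : ℂ) * u y)
    (bound := fun y => C * ‖u y‖) univ_mem
    (Eventually.of_forall fun x => (integrableOn_heatK_mul σ k x t hu).aestronglyMeasurable)
    (integrableOn_heatK_mul σ k x t hu) (integrableOn_heatK_mul σ _ x t hu).aestronglyMeasurable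
    (Eventually.of_forall fun y x _ => ?_) (hu.norm.const_mul C)
    (Eventually.of_forall fun y x _ => ?_)).2
  · rw [norm_mul, Complex.norm_real]
    gcongr
    exact b _ _ le_rfl (Or.inr le_rfl)
  · exact ((hasDerivAt_heatK_x k (x - σ * y) t).comp_sub_const x (σ * y)).ofReal_comp.mul_const _

theorem hasDerivAt_halfConv_t (σ : ℝ) (k : ℕ) {u : ℝ → ℂ} (hu : IntegrableOn u (Ioi 0)) (x : ℝ)
    {t : ℝ} (ht : 0 < t) :
    HasDerivAt (fun t => halfConv σ k u (x, t)) (halfConv σ (k + 2) u (x, t)) t := by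
  obtain ⟨C, -, b⟩ := heatK_bound' (k + 2) (T := 2 * t) (half_pos ht)
  refine (hasDerivAt_integral_of_dominated_loc_of_deriv_le
    (F := fun t y => (heatK k (x - σ * y) t : ℂ) * u y)
    (F' := fun t y => (heatK (k + 2) (x - σ * y) t : ℂ) * u y)
    (bound := fun y => C * ‖u y‖) (Ioo_mem_nhds (a := t / 2) (b := 2 * t) (by linarith)
      (by linarith))
    (Eventually.of_forall fun s => (integrableOn_heatK_mul σ k x s hu).aestronglyMeasurable)
    (integrableOn_heatK_mul σ k x t hu) (integrableOn_heatK_mul σ _ x t hu).aestronglyMeasurable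
    (Eventually.of_forall fun y s hs => ?_) (hu.norm.const_mul C)
    (Eventually.of_forall fun y s hs => ?_)).2
  · rw [norm_mul, Complex.norm_real]
    gcongr
    exact b _ _ hs.2.le (Or.inr hs.1.le)
  · exact (hasDerivAt_heatK_t k (Or.inl ((half_pos ht).trans hs.1))).ofReal_comp.mul_const _

/-- Integration by parts: an `x`-derivative of the kernel is moved to the data, at the price of a
boundary term at the corner. -/
theorem halfConv_succ {σ : ℝ} (hσ : σ = 1 ∨ σ = -1) (k : ℕ) {u u' : ℝ → ℂ}
    (hc : ContinuousOn u (Ici 0)) (hd : ∀ y, 0 < y → HasDerivAt u (u' y) y)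
    (hu : IntegrableOn u (Ioi 0)) (hu' : IntegrableOn u' (Ioi 0))
    (hlim : Tendsto u atTop (𝓝 0)) (x : ℝ) {t : ℝ} (ht : 0 < t) :
    halfConv σ (k + 1) u (x, t) =
      σ * ((heatK k x t : ℂ) * u 0 + halfConv σ k u' (x, t)) := by
  have hσ2 : (σ : ℂ) * σ = 1 := by rcases hσ with rfl | rfl <;> norm_num
  have i1 := integrableOn_heatK_mul σ (k + 1) x t hu
  have i2 := integrableOn_heatK_mul σ k x t hu'
  have key := integral_Ioi_of_hasDerivAt_of_tendsto (a := 0) (m := 0)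
    (f := fun y => (heatK k (x - σ * y) t : ℂ) * u y)
    (f' := fun y => (-σ : ℂ) * ((heatK (k + 1) (x - σ * y) t : ℂ) * u y) +
      (heatK k (x - σ * y) t : ℂ) * u' y)
    ((continuous_heatK_line σ k x t).continuousWithinAt.mul (hc 0 self_mem_Ici))
    (fun y hy => ?_) ((i1.const_mul _).add i2) ?_
  · rw [integral_add (i1.const_mul _) i2, integral_const_mul] at key
    simp only [mul_zero, sub_zero, zero_sub] at key
    simp only [halfConv]
    linear_combination (-(σ : ℂ)) * key -
      (∫ y in Ioi (0 : ℝ), (heatK (k + 1) (x - σ * y) t : ℂ) * u y) * hσ2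
  · have h1 : HasDerivAt (fun y : ℝ => x - σ * y) (-σ) y := by
      simpa using ((hasDerivAt_id y).const_mul σ).const_sub x
    have h2 := (HasDerivAt.comp y (hasDerivAt_heatK_x k (x - σ * y) t) h1).ofReal_comp
    refine (h2.mul (hd y hy)).congr_deriv ?_
    simp only [Function.comp_apply]
    push_cast; ring
  · obtain ⟨C, -, b⟩ := heatK_bound' k (T := t) ht
    have h3 : Tendsto (fun y => C * ‖u y‖) atTop (𝓝 0) := by simpa using hlim.norm.const_mul C
    refine squeeze_zero_norm (fun y => ?_) h3
    rw [norm_mul, Complex.norm_real]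
    gcongr
    exact b _ _ le_rfl (Or.inr le_rfl)

theorem integrable_comp_line {σ : ℝ} (hσ : σ = 1 ∨ σ = -1) {G : ℝ → ℝ} (hG : Integrable G) (x : ℝ) :
    Integrable (fun y => G (x - σ * y)) ∧ ∫ y, G (x - σ * y) = ∫ z, G z := by
  rcases hσ with rfl | rfl
  · simp only [one_mul]
    exact ⟨hG.comp_sub_left x, integral_sub_left_eq_self G volume x⟩
  · simp only [neg_mul, one_mul, sub_neg_eq_add]
    exact ⟨hG.comp_add_left x, integral_add_left_eq_self G x⟩

theorem one_add_le_mul {σ : ℝ} (hσ : σ = 1 ∨ σ = -1) {x y : ℝ} (hy : 0 ≤ y) :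
    1 + x ≤ (1 + |x - σ * y|) * (1 + y) := by
  have h : x - y ≤ |x - σ * y| := by
    rcases hσ with rfl | rfl
    · simpa using le_abs_self (x - y)
    · refine le_trans ?_ (le_abs_self _); linarith
  nlinarith [abs_nonneg (x - σ * y), mul_nonneg (abs_nonneg (x - σ * y)) hy]

/-- The convolution with the heat kernel preserves rapid decay, locally uniformly in time. -/
theorem halfConv_zero_bound {σ : ℝ} (hσ : σ = 1 ∨ σ = -1) (N : ℕ) (T : ℝ) :
    ∃ C, 0 ≤ C ∧ ∀ (u : ℝ → ℂ) (M : ℝ), (∀ y, 0 < y → (1 + y) ^ N * ‖u y‖ ≤ M) →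
      ∀ x t, 0 ≤ x → t ≤ T → (1 + x) ^ N * ‖halfConv σ 0 u (x, t)‖ ≤ C * M := by
  obtain ⟨C, hC, h⟩ := heatK_weight_integral N T
  refine ⟨C, hC, fun u M hu x t hx hT => ?_⟩
  have hM : 0 ≤ M := le_trans (by positivity) (hu 1 one_pos)
  rcases le_or_gt t 0 with ht | ht
  · simp only [halfConv, heatK_of_nonpos ht]; simp; positivity
  obtain ⟨i1, b1⟩ := h t ht hT
  obtain ⟨i2, e2⟩ := integrable_comp_line hσ i1 x
  have w : 0 ≤ (1 + x) ^ N := by positivity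
  have e3 : (1 + x) ^ N * ‖halfConv σ 0 u (x, t)‖ =
      ‖∫ y in Ioi (0 : ℝ), (((1 + x) ^ N : ℝ) : ℂ) * ((heatK 0 (x - σ * y) t : ℂ) * u y)‖ := by
    rw [integral_const_mul, norm_mul, Complex.norm_real, Real.norm_of_nonneg w, halfConv]
  rw [e3]
  calc _ ≤ ∫ y in Ioi (0 : ℝ), (1 + |x - σ * y|) ^ N * |heatK 0 (x - σ * y) t| * M := by
        refine norm_integral_le_of_norm_le (i2.integrableOn.mul_const M) ?_
        filter_upwards [ae_restrict_mem measurableSet_Ioi] with y hy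
        have hy : 0 < y := hy
        rw [norm_mul, norm_mul, Complex.norm_real, Complex.norm_real, Real.norm_of_nonneg w,
          Real.norm_eq_abs]
        calc (1 + x) ^ N * (|heatK 0 (x - σ * y) t| * ‖u y‖)
            ≤ ((1 + |x - σ * y|) * (1 + y)) ^ N * (|heatK 0 (x - σ * y) t| * ‖u y‖) := by
              gcongr; exact one_add_le_mul hσ hy.le
          _ = (1 + |x - σ * y|) ^ N * |heatK 0 (x - σ * y) t| * ((1 + y) ^ N * ‖u y‖) := by
              rw [mul_pow]; ring
          _ ≤ _ := by gcongr; exact hu y hy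
    _ = (∫ y in Ioi (0 : ℝ), (1 + |x - σ * y|) ^ N * |heatK 0 (x - σ * y) t|) * M :=
        integral_mul_const _ _
    _ ≤ C * M := by
        gcongr
        refine le_trans (setIntegral_le_integral i2 (Eventually.of_forall fun y => by positivity)) ?_
        exact e2.trans_le b1

/-! ### Convolution in time -/

/-- The convolution `∫_0^t K_k(x, t - τ) g(τ) dτ` in time. -/
def timeConv (k : ℕ) (g : ℝ → ℂ) (p : ℝ × ℝ) : ℂ :=
  ∫ τ in (0 : ℝ)..p.2, (heatK k p.1 (p.2 - τ) : ℂ) * g τ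

/-- Since the kernel vanishes for negative times, the upper limit may be raised. -/
theorem timeConv_eq {k : ℕ} {g : ℝ → ℂ} {x t T : ℝ} (ht : 0 ≤ t) (hT : t ≤ T) :
    timeConv k g (x, t) = ∫ τ in (0 : ℝ)..T, (heatK k x (t - τ) : ℂ) * g τ := by
  rw [timeConv, intervalIntegral.integral_of_le ht, intervalIntegral.integral_of_le (ht.trans hT)]
  refine (setIntegral_eq_of_subset_of_forall_sdiff_eq_zero measurableSet_Ioc
    (Ioc_subset_Ioc_right hT) fun τ hτ => ?_).symm
  have : t ≤ τ := by
    by_contra! h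
    exact hτ.2 ⟨hτ.1.1, h.le⟩
  simp [heatK_of_nonpos (sub_nonpos.2 this)]

theorem continuous_heatK_t {k : ℕ} {x : ℝ} (hx : x ≠ 0) : Continuous fun t => heatK k x t :=
  continuous_iff_continuousAt.2 fun _ => (hasDerivAt_heatK_t k (Or.inr hx)).continuousAt

theorem intervalIntegrable_heatK_mul {k : ℕ} {x : ℝ} (hx : x ≠ 0) {g : ℝ → ℂ}
    (hg : ContinuousOn g (Ici 0)) (t : ℝ) {T : ℝ} (hT : 0 ≤ T) :
    IntervalIntegrable (fun τ => (heatK k x (t - τ) : ℂ) * g τ) volume 0 T := by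
  refine ContinuousOn.intervalIntegrable (ContinuousOn.mul ?_ (hg.mono ?_))
  · exact (Complex.continuous_ofReal.comp
      ((continuous_heatK_t hx).comp (by fun_prop : Continuous fun τ => t - τ))).continuousOn
  · rw [uIcc_of_le hT]; exact Icc_subset_Ici_self

theorem hasDerivAt_timeConv_x (k : ℕ) {g : ℝ → ℂ} (hg : ContinuousOn g (Ici 0)) {x t : ℝ}
    (hx : 0 < x) (ht : 0 < t) :
    HasDerivAt (fun x => timeConv k g (x, t)) (timeConv (k + 1) g (x, t)) x := by
  obtain ⟨C, -, b⟩ := heatK_bound' (k + 1) (T := t) (half_pos hx)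
  have hgi : IntervalIntegrable g volume 0 t :=
    (hg.mono (by rw [uIcc_of_le ht.le]; exact Icc_subset_Ici_self)).intervalIntegrable
  have hs : Ioi (x / 2) ∈ 𝓝 x := isOpen_Ioi.mem_nhds (half_lt_self hx)
  refine (intervalIntegral.hasDerivAt_integral_of_dominated_loc_of_deriv_le
    (F := fun x τ => (heatK k x (t - τ) : ℂ) * g τ)
    (F' := fun x τ => (heatK (k + 1) x (t - τ) : ℂ) * g τ)
    (bound := fun τ => C * ‖g τ‖) hs
    (eventually_of_mem hs fun y hy => ?_)
    (intervalIntegrable_heatK_mul hx.ne' hg t ht.le)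
    (intervalIntegrable_heatK_mul hx.ne' hg t ht.le).aestronglyMeasurable_restrict_uIoc
    (Eventually.of_forall fun τ hτ y hy => ?_) (hgi.norm.const_mul C)
    (Eventually.of_forall fun τ hτ y hy => ?_)).2
  · exact (intervalIntegrable_heatK_mul ((half_pos hx).trans hy).ne' hg t
      ht.le).aestronglyMeasurable_restrict_uIoc
  · rw [uIoc_of_le ht.le] at hτ
    rw [norm_mul, Complex.norm_real]
    gcongr
    exact b _ _ (by linarith [hτ.1]) (Or.inl ((le_of_lt hy).trans (le_abs_self y)))
  · exact (hasDerivAt_heatK_x k y (t - τ)).ofReal_comp.mul_const _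

theorem hasDerivAt_timeConv_t (k : ℕ) {g : ℝ → ℂ} (hg : ContinuousOn g (Ici 0)) {x t : ℝ}
    (hx : 0 < x) (ht : 0 < t) :
    HasDerivAt (fun t => timeConv k g (x, t)) (timeConv (k + 2) g (x, t)) t := by
  obtain ⟨C, -, b⟩ := heatK_bound' (k + 2) (T := 2 * t) hx
  have h2t : 0 < 2 * t := by linarith
  have hgi : IntervalIntegrable g volume 0 (2 * t) :=
    (hg.mono (by rw [uIcc_of_le h2t.le]; exact Icc_subset_Ici_self)).intervalIntegrable
  have hs : Ioo 0 (2 * t) ∈ 𝓝 t := Ioo_mem_nhds ht (by linarith)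
  have key := (intervalIntegral.hasDerivAt_integral_of_dominated_loc_of_deriv_le
    (F := fun t τ => (heatK k x (t - τ) : ℂ) * g τ)
    (F' := fun t τ => (heatK (k + 2) x (t - τ) : ℂ) * g τ)
    (bound := fun τ => C * ‖g τ‖) hs
    (Eventually.of_forall fun s =>
      (intervalIntegrable_heatK_mul hx.ne' hg s h2t.le).aestronglyMeasurable_restrict_uIoc)
    (intervalIntegrable_heatK_mul hx.ne' hg t h2t.le)
    (intervalIntegrable_heatK_mul hx.ne' hg t h2t.le).aestronglyMeasurable_restrict_uIoc
    (Eventually.of_forall fun τ hτ s hs => ?_) (hgi.norm.const_mul C)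
    (Eventually.of_forall fun τ hτ s hs => ?_)).2
  · rw [timeConv_eq ht.le (by linarith : t ≤ 2 * t)]
    exact key.congr_of_eventuallyEq (eventually_of_mem hs fun s hs => timeConv_eq hs.1.le hs.2.le)
  · rw [uIoc_of_le h2t.le] at hτ
    rw [norm_mul, Complex.norm_real]
    gcongr
    exact b _ _ (by linarith [hτ.1, hs.2]) (Or.inl (le_abs_self x))
  · exact ((hasDerivAt_heatK_t k (Or.inr hx.ne')).comp_sub_const s τ).ofReal_comp.mul_const _

/-- Integration by parts: a time derivative of the kernel is moved to the data; only the lower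
limit contributes a boundary term, since the kernel vanishes at time zero. -/
theorem timeConv_add_two (k : ℕ) {g g' : ℝ → ℂ} (hg : ContinuousOn g (Ici 0))
    (hg' : ContinuousOn g' (Ici 0)) (hd : ∀ τ, 0 < τ → HasDerivAt g (g' τ) τ) {x t : ℝ}
    (hx : 0 < x) (ht : 0 < t) :
    timeConv (k + 2) g (x, t) = (heatK k x t : ℂ) * g 0 + timeConv k g' (x, t) := by
  have i1 := intervalIntegrable_heatK_mul (k := k + 2) hx.ne' hg t ht.le
  have i2 := intervalIntegrable_heatK_mul (k := k) hx.ne' hg' t ht.le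
  have hK : ∀ τ, HasDerivAt (fun τ => (heatK k x (t - τ) : ℂ)) (-(heatK (k + 2) x (t - τ) : ℂ)) τ :=
    fun τ => by
      have h1 : HasDerivAt (fun τ : ℝ => t - τ) (-1) τ := (hasDerivAt_id τ).const_sub t
      have h2 := (HasDerivAt.comp τ (hasDerivAt_heatK_t k (x := x) (t := t - τ)
        (Or.inr hx.ne')) h1).ofReal_comp
      exact h2.congr_deriv (by push_cast; ring)
  have key := intervalIntegral.integral_eq_sub_of_hasDerivAt_of_le (a := 0) (b := t)
    (f := fun τ => (heatK k x (t - τ) : ℂ) * g τ)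
    (f' := fun τ => -((heatK (k + 2) x (t - τ) : ℂ) * g τ) + (heatK k x (t - τ) : ℂ) * g' τ)
    ht.le ?_ (fun τ hτ => ?_) (i1.neg.add i2)
  · have h1 := intervalIntegral.integral_add i1.neg i2
    simp only [Pi.neg_apply] at h1
    rw [h1, intervalIntegral.integral_neg, sub_self,
      heatK_of_nonpos le_rfl, sub_zero, Complex.ofReal_zero, zero_mul] at key
    simp only [timeConv]
    linear_combination -key
  · exact ContinuousOn.mul (fun τ _ => (hK τ).continuousAt.continuousWithinAt)
      (hg.mono Icc_subset_Ici_self)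
  · exact ((hK τ).mul (hd τ hτ.1)).congr_deriv (by ring)

theorem norm_timeConv_le {k : ℕ} {g : ℝ → ℂ} {x t M w B : ℝ} {G : ℝ → ℝ} (ht : 0 ≤ t) (hw : 0 ≤ w)
    (hg : ∀ τ, 0 ≤ τ → τ ≤ t → ‖g τ‖ ≤ M)
    (hG : ∀ s, 0 < s → s ≤ t → w * |heatK k x s| ≤ G s)
    (hi : IntervalIntegrable G volume 0 t) (hB : ∫ s in (0 : ℝ)..t, G s ≤ B) :
    w * ‖timeConv k g (x, t)‖ ≤ B * M := by
  have hM : 0 ≤ M := (norm_nonneg _).trans (hg 0 le_rfl ht)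
  have e3 : w * ‖timeConv k g (x, t)‖ =
      ‖∫ τ in (0 : ℝ)..t, (w : ℂ) * ((heatK k x (t - τ) : ℂ) * g τ)‖ := by
    rw [intervalIntegral.integral_const_mul, norm_mul, Complex.norm_real, Real.norm_of_nonneg hw,
      timeConv]
  have hi' : IntervalIntegrable (fun τ => G (t - τ)) volume 0 t := by
    simpa using (hi.comp_sub_left t).symm
  rw [e3]
  calc _ ≤ ∫ τ in (0 : ℝ)..t, G (t - τ) * M := by
        refine intervalIntegral.norm_integral_le_of_norm_le ht ?_ (hi'.mul_const M)
        have : ∀ᵐ τ : ℝ, τ ≠ t := Measure.ae_ne volume t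
        filter_upwards [this] with τ h1 h2
        have h3 : 0 < t - τ := sub_pos.2 (lt_of_le_of_ne h2.2 h1)
        rw [norm_mul, norm_mul, Complex.norm_real, Complex.norm_real, Real.norm_of_nonneg hw,
          Real.norm_eq_abs, ← mul_assoc]
        have h4 := hG (t - τ) h3 (by linarith [h2.1])
        have h5 : 0 ≤ G (t - τ) := le_trans (by positivity) h4
        exact mul_le_mul h4 (hg τ h2.1.le h2.2) (norm_nonneg _) h5
    _ = (∫ s in (0 : ℝ)..t, G s) * M := by
        rw [intervalIntegral.integral_mul_const, intervalIntegral.integral_comp_sub_left G t]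
        simp
    _ ≤ B * M := by gcongr

theorem integral_inv_sqrt {t : ℝ} (ht : 0 ≤ t) :
    IntervalIntegrable (fun s => (√s)⁻¹) volume 0 t ∧ ∫ s in (0 : ℝ)..t, (√s)⁻¹ = 2 * √t := by
  have hd : ∀ s ∈ Ioo (0 : ℝ) t, HasDerivAt (fun s => 2 * √s) (√s)⁻¹ s := fun s hs => by
    refine ((Real.hasDerivAt_sqrt hs.1.ne').const_mul 2).congr_deriv ?_
    field_simp
  have hc : ContinuousOn (fun s => 2 * √s) (Icc 0 t) := by fun_prop
  have hi : IntervalIntegrable (fun s => (√s)⁻¹) volume 0 t := by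
    rw [intervalIntegrable_iff_integrableOn_Ioc_of_le ht]
    exact intervalIntegral.integrableOn_deriv_of_nonneg hc hd fun s _ => by positivity
  exact ⟨hi, by
    rw [intervalIntegral.integral_eq_sub_of_hasDerivAt_of_le ht hc hd hi]; simp⟩

/-- The antiderivative is `2 arctan (√s / x)`, whence the bound is independent of `x`. -/
theorem integral_arctan_kernel {x t : ℝ} (hx : 0 < x) (ht : 0 ≤ t) :
    IntervalIntegrable (fun s => (√s)⁻¹ * (x / (s + x ^ 2))) volume 0 t ∧
      ∫ s in (0 : ℝ)..t, (√s)⁻¹ * (x / (s + x ^ 2)) ≤ Real.pi := by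
  have hd : ∀ s ∈ Ioo (0 : ℝ) t,
      HasDerivAt (fun s => 2 * Real.arctan (√s / x)) ((√s)⁻¹ * (x / (s + x ^ 2))) s := by
    intro s hs
    have hs0 : 0 < s := hs.1
    have h1 := (((Real.hasDerivAt_sqrt hs.1.ne').div_const x).arctan).const_mul 2
    refine h1.congr_deriv ?_
    have h2 : √s ≠ 0 := (Real.sqrt_pos.2 hs.1).ne'
    have h3 : 1 + (√s / x) ^ 2 = (s + x ^ 2) / x ^ 2 := by
      rw [div_pow, Real.sq_sqrt hs.1.le]; field_simp; ring
    rw [h3]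
    have h4 : s + x ^ 2 ≠ 0 := by positivity
    field_simp
  have hc : ContinuousOn (fun s => 2 * Real.arctan (√s / x)) (Icc 0 t) :=
    (Continuous.mul continuous_const (Real.continuous_arctan.comp
      (Real.continuous_sqrt.div_const x))).continuousOn
  have hi : IntervalIntegrable (fun s => (√s)⁻¹ * (x / (s + x ^ 2))) volume 0 t := by
    rw [intervalIntegrable_iff_integrableOn_Ioc_of_le ht]
    refine intervalIntegral.integrableOn_deriv_of_nonneg hc hd fun s hs => ?_
    have hs0 : 0 < s := hs.1
    positivity
  refine ⟨hi, ?_⟩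
  rw [intervalIntegral.integral_eq_sub_of_hasDerivAt_of_le ht hc hd hi]
  have := Real.arctan_lt_pi_div_two (√t / x)
  simp
  linarith

/-- The single-layer potential is bounded because `K_0(x, ·)` is dominated by `s⁻¹ᐟ²`. -/
theorem timeConv_zero_bound (N : ℕ) (T : ℝ) :
    ∃ C, 0 ≤ C ∧ ∀ (g : ℝ → ℂ) (M : ℝ), (∀ τ, 0 ≤ τ → τ ≤ T → ‖g τ‖ ≤ M) →
      ∀ x t, 0 ≤ x → 0 ≤ t → t ≤ T → (1 + x) ^ N * ‖timeConv 0 g (x, t)‖ ≤ C * M := by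
  obtain ⟨C, hC, b⟩ := heatProfile_decay 0 N
  refine ⟨(1 + √T) ^ N * C * (2 * √T), by positivity, fun g M hg x t hx ht htT => ?_⟩
  refine norm_timeConv_le (G := fun s => (1 + √T) ^ N * C * (√s)⁻¹) ht (by positivity)
    (fun τ h1 h2 => hg τ h1 (h2.trans htT)) (fun s hs hst => ?_)
    ((integral_inv_sqrt ht).1.const_mul _) ?_
  · have := weight_heatK_le (x := x) hs (hst.trans htT) N 0
    rw [abs_of_nonneg hx] at this
    refine this.trans ?_
    rw [zero_add, pow_one, mul_assoc, mul_comm C]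
    gcongr
    exact b _
  · rw [intervalIntegral.integral_const_mul, (integral_inv_sqrt ht).2]
    gcongr

/-- The double-layer kernel `K_1(x, ·)` is bounded in `L¹(0, T)` uniformly in `x > 0`. -/
theorem timeConv_one_bound (N : ℕ) (T : ℝ) :
    ∃ C, 0 ≤ C ∧ ∀ (g : ℝ → ℂ) (M : ℝ), (∀ τ, 0 ≤ τ → τ ≤ T → ‖g τ‖ ≤ M) →
      ∀ x t, 0 < x → 0 ≤ t → t ≤ T → (1 + x) ^ N * ‖timeConv 1 g (x, t)‖ ≤ C * M := by
  obtain ⟨C, hC, b⟩ := heatProfile_decay 0 (N + 2)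
  refine ⟨(1 + √T) ^ N * C * Real.pi, by positivity, fun g M hg x t hx ht htT => ?_⟩
  refine norm_timeConv_le (G := fun s => (1 + √T) ^ N * C * ((√s)⁻¹ * (x / (s + x ^ 2)))) ht
    (by positivity) (fun τ h1 h2 => hg τ h1 (h2.trans htT)) (fun s hs hst => ?_)
    ((integral_arctan_kernel hx ht).1.const_mul _) ?_
  · have := weight_heatK_le (x := x) hs (hst.trans htT) N 1
    rw [abs_of_nonneg hx.le] at this
    refine this.trans ?_
    have hr : 0 < √s := Real.sqrt_pos.2 hs
    have hw : 0 < x * (√s)⁻¹ := by positivity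
    have b' := b (x * (√s)⁻¹)
    rw [abs_of_pos hw] at b' ⊢
    set w := x * (√s)⁻¹ with hwdef
    -- two further powers of `1 + w` turn the profile into the integrand of the arctangent
    have h1 : (1 + w) ^ N * |heatProfile 1 w| ≤ C * (w / (1 + w ^ 2)) := by
      rw [heatProfile_one, abs_mul, abs_neg, abs_of_pos (half_pos hw), ← mul_div_assoc,
        le_div_iff₀ (by positivity)]
      calc (1 + w) ^ N * (w / 2 * |heatProfile 0 w|) * (1 + w ^ 2)
          ≤ (1 + w) ^ N * (w * |heatProfile 0 w|) * (1 + w) ^ 2 := by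
            gcongr
            · linarith
            · nlinarith
        _ = ((1 + w) ^ (N + 2) * |heatProfile 0 w|) * w := by ring
        _ ≤ C * w := by gcongr
    have h2 : (√s)⁻¹ ^ 2 * (w / (1 + w ^ 2)) = (√s)⁻¹ * (x / (s + x ^ 2)) := by
      have h3 : 1 + w ^ 2 = (s + x ^ 2) / s := by
        rw [hwdef, mul_pow, inv_pow, Real.sq_sqrt hs.le]; field_simp
      rw [h3, inv_pow, Real.sq_sqrt hs.le, hwdef]
      have h4 : s + x ^ 2 ≠ 0 := by positivity
      field_simp
    calc (1 + √T) ^ N * ((√s)⁻¹ ^ (1 + 1) * ((1 + w) ^ N * |heatProfile 1 w|))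
        ≤ (1 + √T) ^ N * ((√s)⁻¹ ^ (1 + 1) * (C * (w / (1 + w ^ 2)))) := by gcongr
      _ = (1 + √T) ^ N * C * ((√s)⁻¹ ^ 2 * (w / (1 + w ^ 2))) := by ring
      _ = _ := by rw [h2]
  · rw [intervalIntegral.integral_const_mul]
    have := (integral_arctan_kernel hx ht).2
    gcongr

/-! ### The inhomogeneous potential -/

/-- Duhamel's integral `∫_0^t ∫_0^∞ K(x - σy, t - τ) f(y, τ) dy dτ`. -/
def duhamel (σ : ℝ) (f : ℝ × ℝ → ℂ) (p : ℝ × ℝ) : ℂ :=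
  ∫ τ in (0 : ℝ)..p.2, halfConv σ 0 (fun y => f (y, τ)) (p.1, p.2 - τ)

theorem measurable_slice {f : ℝ × ℝ → ℂ} (hf : Measurable f) (τ : ℝ) :
    Measurable fun y => f (y, τ) := hf.comp (by fun_prop)

theorem measurable_halfConv {α : Type*} [MeasurableSpace α] (σ : ℝ) (k : ℕ) {f : ℝ × ℝ → ℂ}
    (hf : Measurable f) {a b : α → ℝ} (ha : Measurable a) (hb : Measurable b) (x : ℝ) :
    Measurable fun q : α => halfConv σ k (fun y => f (y, a q)) (x, b q) := by
  have h1 : Measurable fun z : α × ℝ =>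
      (heatK k (x - σ * z.2) (b z.1) : ℂ) * f (z.2, a z.1) := by
    refine Measurable.mul ?_ (hf.comp (by fun_prop))
    exact Complex.measurable_ofReal.comp ((measurable_heatK k).comp
      ((by fun_prop : Measurable fun z : α × ℝ => x - σ * z.2).prodMk
        (hb.comp measurable_fst)))
  exact (h1.stronglyMeasurable.integral_prod_right'
    (f := fun z : α × ℝ => (heatK k (x - σ * z.2) (b z.1) : ℂ) * f (z.2, a z.1))
    (ν := volume.restrict (Ioi (0 : ℝ)))).measurable

/-- Differentiation of `∫_0^∞ c(y) f(y, τ) dy` in the parameter `τ`. -/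
theorem hasDerivAt_slice_integral {c : ℝ → ℂ} {f f' : ℝ × ℝ → ℂ} {C M T τ : ℝ}
    (hc : AEStronglyMeasurable c (volume.restrict (Ioi 0))) (hC : ∀ y, 0 < y → ‖c y‖ ≤ C)
    (hf : Measurable f) (hf' : Measurable f')
    (hM : ∀ y τ, 0 < y → 0 ≤ τ → τ ≤ T → (1 + y) ^ 2 * ‖f (y, τ)‖ ≤ M)
    (hM' : ∀ y τ, 0 < y → 0 ≤ τ → τ ≤ T → (1 + y) ^ 2 * ‖f' (y, τ)‖ ≤ M)
    (hd : ∀ y τ, 0 < y → 0 < τ → HasDerivAt (fun τ => f (y, τ)) (f' (y, τ)) τ)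
    (hτ : τ ∈ Ioo 0 T) :
    HasDerivAt (fun τ => ∫ y in Ioi (0 : ℝ), c y * f (y, τ))
      (∫ y in Ioi (0 : ℝ), c y * f' (y, τ)) τ := by
  have hC0 : 0 ≤ C := (norm_nonneg _).trans (hC 1 one_pos)
  have ms : ∀ {g : ℝ × ℝ → ℂ}, Measurable g → ∀ s,
      AEStronglyMeasurable (fun y => c y * g (y, s)) (volume.restrict (Ioi 0)) := fun hg s =>
    hc.mul (measurable_slice hg s).aestronglyMeasurable
  have hi : IntegrableOn (fun y => f (y, τ)) (Ioi 0) :=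
    (integrableOn_of_decay (measurable_slice hf _).aestronglyMeasurable
      fun y hy => hM y τ hy hτ.1.le hτ.2.le).1
  refine (hasDerivAt_integral_of_dominated_loc_of_deriv_le
    (F := fun τ y => c y * f (y, τ)) (F' := fun τ y => c y * f' (y, τ))
    (bound := fun y => C * (M * (1 + y ^ 2)⁻¹)) (Ioo_mem_nhds hτ.1 hτ.2)
    (Eventually.of_forall fun s => ms hf s)
    (hi.bdd_mul hc ((ae_restrict_mem measurableSet_Ioi).mono hC)) (ms hf' τ)
    ((ae_restrict_mem measurableSet_Ioi).mono fun y hy s hs => ?_)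
    ((integrable_inv_one_add_sq.const_mul M).const_mul C).integrableOn
    ((ae_restrict_mem measurableSet_Ioi).mono fun y hy s hs => ?_)).2
  · have hy : 0 < y := hy
    rw [norm_mul]
    gcongr
    · exact hC y hy
    · rw [← div_eq_mul_inv, le_div_iff₀ (by positivity), mul_comm]
      refine le_trans ?_ (hM' y s hy hs.1.le hs.2.le)
      gcongr
      nlinarith
  · exact (hd y s hy hs.1).const_mul (c y)

theorem continuousOn_slice_integral {c : ℝ → ℂ} {f : ℝ × ℝ → ℂ} {C M T : ℝ}
    (hc : AEStronglyMeasurable c (volume.restrict (Ioi 0))) (hC : ∀ y, 0 < y → ‖c y‖ ≤ C)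
    (hf : Measurable f)
    (hM : ∀ y τ, 0 < y → 0 ≤ τ → τ ≤ T → (1 + y) ^ 2 * ‖f (y, τ)‖ ≤ M)
    (hcont : ∀ y, 0 < y → ContinuousOn (fun τ => f (y, τ)) (Ici 0)) :
    ContinuousOn (fun τ => ∫ y in Ioi (0 : ℝ), c y * f (y, τ)) (Icc 0 T) := by
  have hC0 : 0 ≤ C := (norm_nonneg _).trans (hC 1 one_pos)
  refine continuousOn_of_dominated (bound := fun y => C * (M * (1 + y ^ 2)⁻¹))
    (fun s _ => hc.mul (measurable_slice hf s).aestronglyMeasurable)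
    (fun s hs => (ae_restrict_mem measurableSet_Ioi).mono fun y hy => ?_)
    ((integrable_inv_one_add_sq.const_mul M).const_mul C).integrableOn
    ((ae_restrict_mem measurableSet_Ioi).mono fun y hy =>
      continuousOn_const.mul ((hcont y hy).mono Icc_subset_Ici_self))
  have hy : 0 < y := hy
  rw [norm_mul]
  gcongr
  · exact hC y hy
  · rw [← div_eq_mul_inv, le_div_iff₀ (by positivity), mul_comm]
    refine le_trans ?_ (hM y s hy hs.1 hs.2)
    gcongr
    nlinarith

/-- Differentiation of `∫_0^r a(r - s, s) ds`.  After `a(0, s)` is split off, the integrand, continued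
by zero to `s > r`, is Lipschitz in `r` and differentiable except at `s = r`. -/
theorem hasDerivAt_convolution {a a' : ℝ → ℝ → ℂ} {T M t : ℝ} (ht : 0 < t) (hT : t < T)
    (hm : Measurable fun q : ℝ × ℝ => a q.1 q.2) (hm' : Measurable fun q : ℝ × ℝ => a' q.1 q.2)
    (hb : ∀ s τ, 0 < s → s ≤ T → 0 ≤ τ → τ ≤ T → ‖a τ s‖ ≤ M)
    (hb' : ∀ s τ, 0 < s → s ≤ T → 0 < τ → τ < T → ‖a' τ s‖ ≤ M)
    (hd : ∀ s τ, 0 < s → s ≤ T → 0 < τ → τ < T → HasDerivAt (fun τ => a τ s) (a' τ s) τ)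
    (hc : ∀ s, 0 < s → s ≤ T → ContinuousOn (fun τ => a τ s) (Icc 0 T))
    (h0 : ContinuousAt (a 0) t) :
    HasDerivAt (fun r => ∫ s in (0 : ℝ)..r, a (r - s) s)
      (a 0 t + ∫ s in (0 : ℝ)..t, a' (t - s) s) t := by
  have hT0 : 0 < T := ht.trans hT
  have hM : 0 ≤ M := (norm_nonneg _).trans (hb t 0 ht hT.le le_rfl hT0.le)
  have ma0 : Measurable (a 0) := hm.comp (by fun_prop : Measurable fun s : ℝ => ((0 : ℝ), s))
  -- `max (r - s) 0` continues the integrand past `s = r`, where `B r s` vanishes, so that `r`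
  -- enters the second integral only through its integrand
  set B : ℝ → ℝ → ℂ := fun r s => a (max (r - s) 0) s - a 0 s with hB
  have mB : ∀ r, Measurable (B r) := fun r =>
    (hm.comp (by fun_prop : Measurable fun s : ℝ => (max (r - s) 0, s))).sub ma0
  -- differentiability in the open interval suffices, as `a(·, s)` is continuous on the closed one
  have lip : ∀ s, 0 < s → s ≤ T → LipschitzOnWith (Real.nnabs M) (fun τ => a τ s) (Icc 0 T) := by
    intro s hs hsT
    rw [← closure_Ioo hT0.ne]
    refine LipschitzOnWith.closure (by rw [closure_Ioo hT0.ne]; exact hc s hs hsT) ?_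
    refine (convex_Ioo 0 T).lipschitzOnWith_of_nnnorm_hasDerivWithin_le
      (fun τ hτ => (hd s τ hs hsT hτ.1 hτ.2).hasDerivWithinAt) fun τ hτ => ?_
    rw [← NNReal.coe_le_coe, coe_nnnorm, Real.coe_nnabs]
    exact (hb' s τ hs hsT hτ.1 hτ.2).trans (le_abs_self _)
  have iB : ∀ r ≤ T, IntervalIntegrable (B r) volume 0 T := fun r hr => by
    rw [intervalIntegrable_iff_integrableOn_Ioc_of_le hT0.le]
    refine Measure.integrableOn_of_bounded (M := M + M) (by simp) (mB r).aestronglyMeasurable ?_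
    filter_upwards [ae_restrict_mem measurableSet_Ioc] with s hs
    refine (norm_sub_le _ _).trans (add_le_add (hb s _ hs.1 hs.2 (le_max_right _ _)
      (max_le (by linarith [hs.1]) hT0.le)) (hb s _ hs.1 hs.2 le_rfl hT0.le))
  have ia0 : ∀ r, 0 ≤ r → r ≤ T → IntervalIntegrable (a 0) volume 0 r := fun r h0 hr => by
    rw [intervalIntegrable_iff_integrableOn_Ioc_of_le h0]
    refine Measure.integrableOn_of_bounded (M := M) (by simp) ma0.aestronglyMeasurable ?_
    filter_upwards [ae_restrict_mem measurableSet_Ioc] with s hs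
    exact hb s _ hs.1 (hs.2.trans hr) le_rfl hT0.le
  have split : ∀ r ∈ Ioo 0 T, ∫ s in (0 : ℝ)..r, a (r - s) s =
      (∫ s in (0 : ℝ)..r, a 0 s) + ∫ s in (0 : ℝ)..T, B r s := by
    intro r hr
    have e1 : ∫ s in (0 : ℝ)..T, B r s = ∫ s in (0 : ℝ)..r, B r s := by
      rw [intervalIntegral.integral_of_le hT0.le, intervalIntegral.integral_of_le hr.1.le]
      refine setIntegral_eq_of_subset_of_forall_sdiff_eq_zero measurableSet_Ioc
        (Ioc_subset_Ioc_right hr.2.le) fun s hs => ?_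
      have : r ≤ s := by
        by_contra! h
        exact hs.2 ⟨hs.1.1, h.le⟩
      simp [hB, max_eq_right (sub_nonpos.2 this)]
    have iBr : IntervalIntegrable (B r) volume 0 r := by
      refine (iB r hr.2.le).mono_set ?_
      rw [uIcc_of_le hr.1.le, uIcc_of_le hT0.le]
      exact Icc_subset_Icc_right hr.2.le
    rw [e1, ← intervalIntegral.integral_add (ia0 r hr.1.le hr.2.le) iBr]
    refine intervalIntegral.integral_congr fun s hs => ?_
    rw [uIcc_of_le hr.1.le] at hs
    simp [hB, max_eq_left (sub_nonneg.2 hs.2)]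
  have d1 : HasDerivAt (fun r => ∫ s in (0 : ℝ)..r, a 0 s) (a 0 t) t :=
    intervalIntegral.integral_hasDerivAt_right (ia0 t ht.le hT.le)
      (ma0.stronglyMeasurable.stronglyMeasurableAtFilter) h0
  have d2 : HasDerivAt (fun r => ∫ s in (0 : ℝ)..T, B r s) (∫ s in (0 : ℝ)..t, a' (t - s) s) t := by
    set F' : ℝ → ℂ := (Iio t).indicator fun s => a' (t - s) s with hF'
    have mF' : Measurable F' := (hm'.comp (by fun_prop : Measurable fun s : ℝ =>
      (t - s, s))).indicator measurableSet_Iio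
    have key := (hasDerivAt_integral_of_dominated_loc_of_lip (μ := volume.restrict (Ioc 0 T))
      (F := B) (F' := F') (bound := fun _ => M) (Iio_mem_nhds hT)
      (Eventually.of_forall fun r => (mB r).aestronglyMeasurable)
      ((intervalIntegrable_iff_integrableOn_Ioc_of_le hT0.le).1 (iB t hT.le))
      mF'.aestronglyMeasurable
      ((ae_restrict_mem measurableSet_Ioc).mono fun s hs => ?_)
      (integrable_const M) ?_).2
    · rw [intervalIntegral.integral_of_le ht.le]
      simp only [intervalIntegral.integral_of_le hT0.le]
      have hset : Ioc 0 T ∩ Iio t = Ioo 0 t := by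
        ext s
        simp only [mem_Ioo, mem_inter_iff, mem_Ioc, mem_Iio]
        exact ⟨fun h => ⟨h.1.1, h.2⟩, fun h => ⟨⟨h.1, by linarith [h.2]⟩, h.2⟩⟩
      rw [hF', setIntegral_indicator measurableSet_Iio, hset] at key
      rw [integral_Ioc_eq_integral_Ioo]
      exact key
    · have h1 : LipschitzWith 1 fun r : ℝ => max (r - s) 0 := by
        refine LipschitzWith.of_dist_le_mul fun r r' => ?_
        simp only [NNReal.coe_one, one_mul, Real.dist_eq]
        refine (abs_max_sub_max_le_abs _ _ _).trans (le_of_eq ?_)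
        congr 1; ring
      have h2 := (lip s hs.1 hs.2).comp (h1.lipschitzOnWith (s := Iio T)) fun r hr =>
        ⟨le_max_right _ _, max_le (by linarith [hs.1, mem_Iio.1 hr]) hT0.le⟩
      rw [mul_one] at h2
      refine LipschitzOnWith.of_dist_le_mul fun r hr r' hr' => ?_
      have h3 := h2.dist_le_mul r hr r' hr'
      simpa [hB, dist_eq_norm] using h3
    -- off the null set `s = t` the map `r ↦ B r s` is smooth near `t`, or constant
    · filter_upwards [ae_restrict_mem measurableSet_Ioc,
        ae_restrict_of_ae (Measure.ae_ne volume t)] with s hs hst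
      rcases lt_or_gt_of_ne hst with h | h
      · have h1 := (hd s (t - s) hs.1 hs.2 (sub_pos.2 h) (by linarith [hs.1])).comp_sub_const t s
        rw [hF', indicator_of_mem (mem_Iio.2 h)]
        refine (h1.sub_const (a 0 s)).congr_of_eventuallyEq ?_
        filter_upwards [Ioi_mem_nhds h] with r hr
        simp [hB, max_eq_left (sub_nonneg.2 (le_of_lt (mem_Ioi.1 hr)))]
      · rw [hF', indicator_of_notMem (by simpa using h.le)]
        refine (hasDerivAt_const t (0 : ℂ)).congr_of_eventuallyEq ?_
        filter_upwards [Iio_mem_nhds h] with r hr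
        simp [hB, max_eq_right (sub_nonpos.2 (le_of_lt (mem_Iio.1 hr)))]
  refine (d1.add d2).congr_of_eventuallyEq ?_
  filter_upwards [Ioo_mem_nhds ht hT] with r hr using split r hr

/-- Duhamel's integral of a rapidly decaying source decays rapidly and is `O(t)`. -/
theorem duhamel_bound {σ : ℝ} (hσ : σ = 1 ∨ σ = -1) (N : ℕ) (T : ℝ) :
    ∃ C, 0 ≤ C ∧ ∀ (f : ℝ × ℝ → ℂ) (M : ℝ),
      (∀ y τ, 0 < y → 0 ≤ τ → τ ≤ T → (1 + y) ^ N * ‖f (y, τ)‖ ≤ M) →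
      ∀ x t, 0 ≤ x → 0 ≤ t → t ≤ T → (1 + x) ^ N * ‖duhamel σ f (x, t)‖ ≤ C * M * t := by
  obtain ⟨C, hC, h⟩ := halfConv_zero_bound hσ N T
  refine ⟨C, hC, fun f M hM x t hx ht htT => ?_⟩
  have w : 0 < (1 + x) ^ N := by positivity
  have h1 : ‖duhamel σ f (x, t)‖ ≤ C * M / (1 + x) ^ N * |t - 0| := by
    refine intervalIntegral.norm_integral_le_of_norm_le_const fun τ hτ => ?_
    rw [uIoc_of_le ht] at hτ
    rw [le_div_iff₀ w, mul_comm]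
    exact h _ M (fun y hy => hM y τ hy hτ.1.le (hτ.2.trans htT)) x _ hx (by linarith [hτ.1])
  rw [sub_zero, abs_of_nonneg ht, div_mul_eq_mul_div, le_div_iff₀ w, mul_comm] at h1
  exact h1

theorem tendsto_zero_of_decay {u : ℝ → ℂ} {M : ℝ} (h : ∀ y, 0 < y → (1 + y) ^ 2 * ‖u y‖ ≤ M) :
    Tendsto u atTop (𝓝 0) := by
  have h1 : Tendsto (fun y : ℝ => M * (1 + y)⁻¹) atTop (𝓝 0) := by
    simpa using (tendsto_inv_atTop_zero.comp (tendsto_atTop_add_const_left _ (1 : ℝ)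
      tendsto_id)).const_mul M
  refine squeeze_zero_norm' ?_ h1
  filter_upwards [eventually_gt_atTop 0] with y hy
  rw [← div_eq_mul_inv, le_div_iff₀ (by positivity)]
  refine le_trans ?_ (h y hy)
  rw [mul_comm, sq]
  have := norm_nonneg (u y)
  gcongr
  nlinarith

/-- Differentiating the kernel yields the factor `(t - τ)⁻¹ᐟ²`.  An integration by parts in `y`
(`halfConv_succ`) moves the derivative to the source and makes the integrand bounded, locally
uniformly in `x > 0`. -/
theorem hasDerivAt_duhamel_x {σ : ℝ} (hσ : σ = 1 ∨ σ = -1) {f f' : ℝ × ℝ → ℂ} {M x t : ℝ}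
    (hf : Measurable f) (hf' : Measurable f')
    (hc : ∀ τ, 0 ≤ τ → ContinuousOn (fun y => f (y, τ)) (Ici 0))
    (hc0 : ContinuousOn (fun τ => f (0, τ)) (Ici 0))
    (hM : ∀ y τ, 0 ≤ y → 0 ≤ τ → τ ≤ t → (1 + y) ^ 2 * ‖f (y, τ)‖ ≤ M)
    (hM' : ∀ y τ, 0 ≤ y → 0 ≤ τ → τ ≤ t → (1 + y) ^ 2 * ‖f' (y, τ)‖ ≤ M)
    (hd : ∀ y τ, 0 < y → 0 ≤ τ → HasDerivAt (fun y => f (y, τ)) (f' (y, τ)) y)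
    (hx : 0 < x) (ht : 0 < t) :
    HasDerivAt (fun x => duhamel σ f (x, t))
      (σ * (timeConv 0 (fun τ => f (0, τ)) (x, t) + duhamel σ f' (x, t))) x := by
  have hM0 : 0 ≤ M := le_trans (by positivity) (hM 0 0 le_rfl le_rfl ht.le)
  have unw : ∀ {g : ℝ × ℝ → ℂ}, (∀ y τ, 0 ≤ y → 0 ≤ τ → τ ≤ t → (1 + y) ^ 2 * ‖g (y, τ)‖ ≤ M) →
      ∀ y τ, 0 ≤ y → 0 ≤ τ → τ ≤ t → ‖g (y, τ)‖ ≤ M := fun hg y τ hy h0 h1 =>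
    (le_mul_of_one_le_left (norm_nonneg _) (one_le_pow₀ (by linarith))).trans (hg y τ hy h0 h1)
  obtain ⟨C, hC, hb⟩ := halfConv_zero_bound hσ 0 t
  obtain ⟨D, hD, hK⟩ := heatK_bound' 0 (T := t) (half_pos hx)
  have hb' : ∀ {g : ℝ × ℝ → ℂ}, (∀ y τ, 0 ≤ y → 0 ≤ τ → τ ≤ t → (1 + y) ^ 2 * ‖g (y, τ)‖ ≤ M) →
      ∀ x', 0 ≤ x' → ∀ τ ∈ Ioc 0 t, ‖halfConv σ 0 (fun y => g (y, τ)) (x', t - τ)‖ ≤ C * M :=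
    fun hg x' hx' τ hτ => by
      simpa using hb _ M (fun y hy => by simpa using unw hg y τ hy.le hτ.1.le hτ.2) x' (t - τ) hx'
        (by linarith [hτ.1])
  have me : ∀ k {g : ℝ × ℝ → ℂ}, Measurable g → ∀ x',
      Measurable fun τ => halfConv σ k (fun y => g (y, τ)) (x', t - τ) := fun k g hg x' =>
    measurable_halfConv σ k hg measurable_id (measurable_id.const_sub t) x'
  have ii : ∀ {g : ℝ × ℝ → ℂ}, Measurable g →
      (∀ y τ, 0 ≤ y → 0 ≤ τ → τ ≤ t → (1 + y) ^ 2 * ‖g (y, τ)‖ ≤ M) → IntervalIntegrable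
        (fun τ => halfConv σ 0 (fun y => g (y, τ)) (x, t - τ)) volume 0 t := fun {g} hgm hg => by
    rw [intervalIntegrable_iff_integrableOn_Ioc_of_le ht.le]
    refine Measure.integrableOn_of_bounded (M := C * M) (by simp)
      (me 0 hgm x).aestronglyMeasurable ?_
    filter_upwards [ae_restrict_mem measurableSet_Ioc] with s hs using hb' hg x hx.le s hs
  have int : ∀ {g : ℝ × ℝ → ℂ}, Measurable g →
      (∀ y τ, 0 ≤ y → 0 ≤ τ → τ ≤ t → (1 + y) ^ 2 * ‖g (y, τ)‖ ≤ M) → ∀ τ ∈ Ioc 0 t,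
        IntegrableOn (fun y => g (y, τ)) (Ioi 0) := fun hgm hg τ hτ =>
    (integrableOn_of_decay (measurable_slice hgm _).aestronglyMeasurable
      fun y hy => hg y τ hy.le hτ.1.le hτ.2).1
  have ibp : ∀ x', ∀ τ ∈ Ioo 0 t, halfConv σ 1 (fun y => f (y, τ)) (x', t - τ) =
      σ * ((heatK 0 x' (t - τ) : ℂ) * f (0, τ) +
        halfConv σ 0 (fun y => f' (y, τ)) (x', t - τ)) := fun x' τ hτ =>
    halfConv_succ hσ 0 (hc τ hτ.1.le) (fun y hy => hd y τ hy hτ.1.le)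
      (int hf hM τ ⟨hτ.1, hτ.2.le⟩) (int hf' hM' τ ⟨hτ.1, hτ.2.le⟩)
      (tendsto_zero_of_decay fun y hy => hM y τ hy.le hτ.1.le hτ.2.le) x' (sub_pos.2 hτ.2)
  have nσ : ‖(σ : ℂ)‖ = 1 := by rcases hσ with rfl | rfl <;> simp
  have ne : ∀ᵐ τ : ℝ, τ ≠ t := Measure.ae_ne volume t
  set F : ℝ → ℝ → ℂ := fun x τ => halfConv σ 0 (fun y => f (y, τ)) (x, t - τ) with hF
  set F' : ℝ → ℝ → ℂ := fun x τ => halfConv σ 1 (fun y => f (y, τ)) (x, t - τ) with hF'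
  have hs : Ioi (x / 2) ∈ 𝓝 x := isOpen_Ioi.mem_nhds (half_lt_self hx)
  have m1 : ∀ x', Measurable (F x') := fun x' => me 0 hf x'
  have m2 : Measurable (F' x) := me 1 hf x
  have i1 : IntervalIntegrable (F x) volume 0 t := ii hf hM
  have bd : ∀ᵐ τ : ℝ, τ ∈ uIoc 0 t → ∀ x' ∈ Ioi (x / 2), ‖F' x' τ‖ ≤ D * M + C * M := by
    filter_upwards [ne] with τ h1 hτ x' hx'
    rw [uIoc_of_le ht.le] at hτ
    have hτ' : τ ∈ Ioo 0 t := ⟨hτ.1, lt_of_le_of_ne hτ.2 h1⟩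
    have hx'0 : 0 < x' := (half_pos hx).trans hx'
    have e := ibp x' τ hτ'
    change ‖halfConv σ 1 (fun y => f (y, τ)) (x', t - τ)‖ ≤ _
    rw [e, norm_mul, nσ, one_mul]
    refine (norm_add_le _ _).trans (add_le_add ?_ (hb' hM' x' hx'0.le τ hτ))
    rw [norm_mul, Complex.norm_real]
    have h2 := hK x' (t - τ) (by linarith [hτ.1]) (Or.inl ((le_of_lt hx').trans (le_abs_self _)))
    exact mul_le_mul h2 (unw hM 0 τ le_rfl hτ.1.le hτ.2) (norm_nonneg _) hD
  have dd : ∀ᵐ τ : ℝ, τ ∈ uIoc 0 t → ∀ x' ∈ Ioi (x / 2), HasDerivAt (F · τ) (F' x' τ) x' := by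
    filter_upwards [ne] with τ h1 hτ x' hx'
    rw [uIoc_of_le ht.le] at hτ
    exact hasDerivAt_halfConv_x σ 0 (int hf hM τ hτ) x' (sub_pos.2 (lt_of_le_of_ne hτ.2 h1))
  have key : HasDerivAt (fun x => ∫ τ in (0 : ℝ)..t, F x τ) (∫ τ in (0 : ℝ)..t, F' x τ) x :=
    (intervalIntegral.hasDerivAt_integral_of_dominated_loc_of_deriv_le hs
      (Eventually.of_forall fun x' => (m1 x').aestronglyMeasurable) i1 m2.aestronglyMeasurable bd
      intervalIntegrable_const dd).2
  have i2 := intervalIntegrable_heatK_mul (k := 0) hx.ne' hc0 t ht.le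
  have e1 : ∫ τ in (0 : ℝ)..t, F' x τ =
      ∫ τ in (0 : ℝ)..t, (σ : ℂ) * ((heatK 0 x (t - τ) : ℂ) * f (0, τ) +
        halfConv σ 0 (fun y => f' (y, τ)) (x, t - τ)) := by
    rw [intervalIntegral.integral_of_le ht.le, intervalIntegral.integral_of_le ht.le,
      integral_Ioc_eq_integral_Ioo, integral_Ioc_eq_integral_Ioo]
    exact setIntegral_congr_fun measurableSet_Ioo fun τ hτ => ibp x τ hτ
  rw [e1, intervalIntegral.integral_const_mul, intervalIntegral.integral_add i2 (ii hf' hM')] at key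
  exact key

/-- After the substitution `s = t - τ` the derivative falls on the source, and not on the kernel,
which is singular at `s = 0`. -/
theorem hasDerivAt_duhamel_t {σ : ℝ} (hσ : σ = 1 ∨ σ = -1) {f f' : ℝ × ℝ → ℂ} {M x t : ℝ}
    (hf : Measurable f) (hf' : Measurable f')
    (hc : ∀ y, 0 < y → ContinuousOn (fun τ => f (y, τ)) (Ici 0))
    (hM : ∀ y τ, 0 ≤ y → 0 ≤ τ → τ ≤ 2 * t → (1 + y) ^ 2 * ‖f (y, τ)‖ ≤ M)
    (hM' : ∀ y τ, 0 ≤ y → 0 ≤ τ → τ ≤ 2 * t → (1 + y) ^ 2 * ‖f' (y, τ)‖ ≤ M)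
    (hd : ∀ y τ, 0 < y → 0 < τ → HasDerivAt (fun τ => f (y, τ)) (f' (y, τ)) τ)
    (hx : 0 ≤ x) (ht : 0 < t) :
    HasDerivAt (fun t => duhamel σ f (x, t))
      (halfConv σ 0 (fun y => f (y, 0)) (x, t) + duhamel σ f' (x, t)) t := by
  have unw : ∀ {g : ℝ × ℝ → ℂ},
      (∀ y τ, 0 ≤ y → 0 ≤ τ → τ ≤ 2 * t → (1 + y) ^ 2 * ‖g (y, τ)‖ ≤ M) →
      ∀ y τ, 0 ≤ y → 0 ≤ τ → τ ≤ 2 * t → ‖g (y, τ)‖ ≤ M := fun hg y τ hy h0 h1 =>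
    (le_mul_of_one_le_left (norm_nonneg _) (one_le_pow₀ (by linarith))).trans (hg y τ hy h0 h1)
  obtain ⟨C, hC, hb⟩ := halfConv_zero_bound hσ 0 (2 * t)
  have hb' : ∀ {g : ℝ × ℝ → ℂ},
      (∀ y τ, 0 ≤ y → 0 ≤ τ → τ ≤ 2 * t → (1 + y) ^ 2 * ‖g (y, τ)‖ ≤ M) →
      ∀ s τ, s ≤ 2 * t → 0 ≤ τ → τ ≤ 2 * t → ‖halfConv σ 0 (fun y => g (y, τ)) (x, s)‖ ≤ C * M :=
    fun hg s τ hs h0 h1 => by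
      simpa using hb _ M (fun y hy => by simpa using unw hg y τ hy.le h0 h1) x s hx hs
  have rev : ∀ (g : ℝ × ℝ → ℂ) r, duhamel σ g (x, r) =
      ∫ s in (0 : ℝ)..r, halfConv σ 0 (fun y => g (y, r - s)) (x, s) := fun g r => by
    have := intervalIntegral.integral_comp_sub_left
      (fun s => halfConv σ 0 (fun y => g (y, r - s)) (x, s)) r (a := 0) (b := r)
    simp only [sub_sub_cancel, sub_self, sub_zero] at this
    exact this
  have cK : ∀ s, 0 < s → ∃ D, ∀ y, 0 < y → ‖(heatK 0 (x - σ * y) s : ℂ)‖ ≤ D := fun s hs => by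
    obtain ⟨D, -, h⟩ := heatK_bound' 0 (T := s) hs
    exact ⟨D, fun y _ => by rw [Complex.norm_real]; exact h _ _ le_rfl (Or.inr le_rfl)⟩
  have key := hasDerivAt_convolution (a := fun τ s => halfConv σ 0 (fun y => f (y, τ)) (x, s))
    (a' := fun τ s => halfConv σ 0 (fun y => f' (y, τ)) (x, s)) (T := 2 * t) (M := C * M)
    ht (by linarith) (measurable_halfConv σ 0 hf measurable_fst measurable_snd x)
    (measurable_halfConv σ 0 hf' measurable_fst measurable_snd x)
    (fun s τ _ h2 h3 h4 => hb' hM s τ h2 h3 h4)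
    (fun s τ _ h2 h3 h4 => hb' hM' s τ h2 h3.le h4.le)
    (fun s τ h1 h2 h3 h4 => by
      obtain ⟨D, hD⟩ := cK s h1
      exact hasDerivAt_slice_integral (continuous_heatK_line σ 0 x s).aestronglyMeasurable hD hf hf'
        (fun y τ hy => hM y τ hy.le) (fun y τ hy => hM' y τ hy.le) hd ⟨h3, h4⟩)
    (fun s h1 h2 => by
      obtain ⟨D, hD⟩ := cK s h1
      exact continuousOn_slice_integral (continuous_heatK_line σ 0 x s).aestronglyMeasurable hD hf
        (fun y τ hy => hM y τ hy.le) hc)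
    (hasDerivAt_halfConv_t σ 0 (integrableOn_of_decay (measurable_slice hf _).aestronglyMeasurable
      fun y hy => hM y 0 hy.le le_rfl (by linarith)).1 x ht).continuousAt
  simp only [rev]
  exact key

/-! ### The potentials are controlled by seminorms of the data -/

section families
variable {E : Type*} [AddCommGroup E] [Module ℂ E] [TopologicalSpace E]

/-- `u e j` is the `j`-th derivative of a rapidly decreasing function on the half-line that depends
on a parameter `e`, with weighted sup-norms bounded by continuous seminorms of `e`. -/
structure SchwartzFamily (u : E → ℕ → ℝ → ℂ) : Prop where
  cont : ∀ e j, ContinuousOn (u e j) (Ici 0)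
  deriv : ∀ e j y, 0 < y → HasDerivAt (u e j) (u e (j + 1) y) y
  bound : ∀ j N : ℕ, ∃ q : Seminorm ℂ E, Continuous q ∧
    ∀ e y, 0 ≤ y → (1 + y) ^ N * ‖u e j y‖ ≤ q e

/-- `g e j` is the `j`-th derivative of a smooth function on the half-line that depends on a
parameter `e`, locally bounded by continuous seminorms of `e`. -/
structure SmoothFamily (g : E → ℕ → ℝ → ℂ) : Prop where
  cont : ∀ e j, ContinuousOn (g e j) (Ici 0)
  deriv : ∀ e j τ, 0 < τ → HasDerivAt (g e j) (g e (j + 1) τ) τ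
  bound : ∀ (j : ℕ) (T : ℝ), ∃ q : Seminorm ℂ E, Continuous q ∧
    ∀ e τ, 0 ≤ τ → τ ≤ T → ‖g e j τ‖ ≤ q e

/-- `F e a b` is the derivative of order `a` in `y` and `b` in `τ` of a function of `(y, τ)` that
depends on a parameter `e` and is rapidly decreasing in `y`, locally uniformly in `τ`. -/
structure SourceFamily (F : E → ℕ → ℕ → ℝ × ℝ → ℂ) : Prop where
  meas : ∀ e a b, Measurable (F e a b)
  cont : ∀ e a b, ContinuousOn (F e a b) Qbar
  deriv_x : ∀ e a b y τ, 0 < y → 0 ≤ τ →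
    HasDerivAt (fun y => F e a b (y, τ)) (F e (a + 1) b (y, τ)) y
  deriv_t : ∀ e a b y τ, 0 ≤ y → 0 < τ →
    HasDerivAt (fun τ => F e a b (y, τ)) (F e a (b + 1) (y, τ)) τ
  bound : ∀ (a b N : ℕ) (T : ℝ), ∃ q : Seminorm ℂ E, Continuous q ∧
    ∀ e y τ, 0 ≤ y → 0 ≤ τ → τ ≤ T → (1 + y) ^ N * ‖F e a b (y, τ)‖ ≤ q e

theorem SchwartzFamily.shift {u : E → ℕ → ℝ → ℂ} (h : SchwartzFamily u) :
    SchwartzFamily fun e j => u e (j + 1) :=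
  ⟨fun e j => h.cont e (j + 1), fun e j => h.deriv e (j + 1), fun j => h.bound (j + 1)⟩

theorem SmoothFamily.shift {g : E → ℕ → ℝ → ℂ} (h : SmoothFamily g) :
    SmoothFamily fun e j => g e (j + 1) :=
  ⟨fun e j => h.cont e (j + 1), fun e j => h.deriv e (j + 1), fun j => h.bound (j + 1)⟩

theorem SchwartzFamily.decay {u : E → ℕ → ℝ → ℂ} (h : SchwartzFamily u) (e : E) (j : ℕ) :
    ∃ M, ∀ y, 0 ≤ y → (1 + y) ^ 2 * ‖u e j y‖ ≤ M := by
  obtain ⟨q, -, b⟩ := h.bound j 2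
  exact ⟨q e, b e⟩

theorem SchwartzFamily.integrableOn {u : E → ℕ → ℝ → ℂ} (h : SchwartzFamily u) (e : E) (j : ℕ) :
    IntegrableOn (u e j) (Ioi 0) := by
  obtain ⟨M, hM⟩ := h.decay e j
  exact (integrableOn_of_decay (((h.cont e j).mono Ioi_subset_Ici_self).aestronglyMeasurable
    measurableSet_Ioi) fun y hy => hM y hy.le).1

theorem SchwartzFamily.tendsto {u : E → ℕ → ℝ → ℂ} (h : SchwartzFamily u) (e : E) (j : ℕ) :
    Tendsto (u e j) atTop (𝓝 0) := by
  obtain ⟨M, hM⟩ := h.decay e j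
  exact tendsto_zero_of_decay fun y hy => hM y hy.le

theorem SourceFamily.left {F : E → ℕ → ℕ → ℝ × ℝ → ℂ} (h : SourceFamily F) (a b : ℕ) :
    SmoothFamily fun e j τ => F e a (b + j) (0, τ) where
  cont e j := (h.cont e a (b + j)).comp (by fun_prop) fun τ hτ => ⟨le_rfl, hτ⟩
  deriv e j τ hτ := h.deriv_t e a (b + j) 0 τ le_rfl hτ
  bound j T := by
    obtain ⟨q, hq, hb⟩ := h.bound a (b + j) 0 T
    exact ⟨q, hq, fun e τ h0 h1 => by simpa using hb e 0 τ le_rfl h0 h1⟩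

theorem SourceFamily.bottom {F : E → ℕ → ℕ → ℝ × ℝ → ℂ} (h : SourceFamily F) (a b : ℕ) :
    SchwartzFamily fun e j y => F e (a + j) b (y, 0) where
  cont e j := (h.cont e (a + j) b).comp (by fun_prop) fun y hy => ⟨hy, le_rfl⟩
  deriv e j y hy := h.deriv_x e (a + j) b y 0 hy le_rfl
  bound j N := by
    obtain ⟨q, hq, hb⟩ := h.bound (a + j) b N 0
    exact ⟨q, hq, fun e y hy => hb e y 0 hy le_rfl le_rfl⟩

theorem strip_cases {n : ℕ+} {p : ℝ × ℝ} (hp : p ∈ punctured.K n) :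
    p.2 ≤ n ∧ (1 / (n : ℝ) ≤ p.1 ∨ 1 / (n : ℝ) ≤ p.2) := by
  have h1 : (1 : ℝ) ≤ n := Nat.one_le_cast.2 n.pos
  have h2 : 1 / (n : ℝ) ≤ n := (div_le_one₀ (by linarith)).2 h1 |>.trans h1
  rcases hp with ⟨-, h, h'⟩ | ⟨-, h, h'⟩
  · exact ⟨h', Or.inr h⟩
  · exact ⟨h'.trans h2, Or.inl h⟩

theorem one_div_pnat_pos (n : ℕ+) : (0 : ℝ) < 1 / (n : ℝ) :=
  one_div_pos.2 (by exact_mod_cast n.pos)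

/-- A bound `C * q e` by a continuous seminorm is again of this form. -/
theorem controlled_of_bound {T : E → ℝ × ℝ → ℂ}
    (h : ∀ (n : ℕ+) (N : ℕ), ∃ (q : Seminorm ℂ E) (C : ℝ), Continuous q ∧ 0 ≤ C ∧
      ∀ e, ∀ p ∈ punctured.K n ∩ Q, (1 + p.1) ^ N * ‖T e p‖ ≤ C * q e) : Controlled T := by
  intro n N
  obtain ⟨q, C, hq, hC, b⟩ := h n N
  lift C to NNReal using hC
  exact ⟨C • q, hq.const_smul C, fun e p hp => b e p hp⟩

theorem controlled_heatK (k : ℕ) {c : E → ℂ} {q : Seminorm ℂ E} (hq : Continuous q)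
    (hc : ∀ e, ‖c e‖ ≤ q e) : Controlled fun e p => (heatK k p.1 p.2 : ℂ) * c e := by
  refine controlled_of_bound fun n N => ?_
  obtain ⟨C, hC, b⟩ := heatK_bound k N (T := n) (one_div_pnat_pos n)
  refine ⟨q, C, hq, hC, fun e p hp => ?_⟩
  obtain ⟨h1, h2⟩ := strip_cases hp.1
  have h3 := b p.1 p.2 h1 (h2.imp_left fun h => h.trans (le_abs_self _))
  rw [abs_of_pos hp.2.1] at h3
  rw [norm_mul, Complex.norm_real, ← mul_assoc]
  exact mul_le_mul h3 (hc e) (norm_nonneg _) hC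

theorem SchwartzFamily.controlled_corner {u : E → ℕ → ℝ → ℂ} (h : SchwartzFamily u) (k : ℕ) :
    Controlled fun e p => (heatK k p.1 p.2 : ℂ) * u e 0 0 := by
  obtain ⟨q, hq, b⟩ := h.bound 0 0
  exact controlled_heatK k hq fun e => by simpa using b e 0 le_rfl

theorem SmoothFamily.controlled_corner {g : E → ℕ → ℝ → ℂ} (h : SmoothFamily g) (k : ℕ) :
    Controlled fun e p => (heatK k p.1 p.2 : ℂ) * g e 0 0 := by
  obtain ⟨q, hq, b⟩ := h.bound 0 0
  exact controlled_heatK k hq fun e => b e 0 le_rfl le_rfl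

theorem SchwartzFamily.controlled {u : E → ℕ → ℝ → ℂ} (h : SchwartzFamily u) {σ : ℝ}
    (hσ : σ = 1 ∨ σ = -1) (k : ℕ) : Controlled fun e => halfConv σ k (u e 0) := by
  induction k generalizing u with
  | zero =>
    refine controlled_of_bound fun n N => ?_
    obtain ⟨C, hC, b⟩ := halfConv_zero_bound hσ N n
    obtain ⟨q, hq, hb⟩ := h.bound 0 N
    exact ⟨q, C, hq, hC, fun e p hp => b (u e 0) (q e) (fun y hy => hb e y hy.le) p.1 p.2
      hp.2.1.le (strip_cases hp.1).1⟩
  | succ k ih =>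
    refine (((h.controlled_corner k).add (ih h.shift)).const_mul (σ : ℂ)).congr fun e p hp => ?_
    exact halfConv_succ hσ k (h.cont e 0) (h.deriv e 0) (h.integrableOn e 0) (h.integrableOn e 1)
      (h.tendsto e 0) p.1 hp.2

theorem SchwartzFamily.controlledUpTo {u : E → ℕ → ℝ → ℂ} (h : SchwartzFamily u) {σ : ℝ}
    (hσ : σ = 1 ∨ σ = -1) (m k : ℕ) : ControlledUpTo m fun e => halfConv σ k (u e 0) :=
  controlledUpTo_of_heat (T := fun k e => halfConv σ k (u e 0)) (h.controlled hσ)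
    (fun k e p hp => hasDerivAt_halfConv_x σ k (h.integrableOn e 0) p.1 hp.2)
    (fun k e p hp => hasDerivAt_halfConv_t σ k (h.integrableOn e 0) p.1 hp.2) m k

theorem SmoothFamily.controlled {g : E → ℕ → ℝ → ℂ} (h : SmoothFamily g) (k : ℕ) :
    Controlled fun e => timeConv k (g e 0) := by
  induction k using Nat.twoStepInduction generalizing g with
  | zero =>
    refine controlled_of_bound fun n N => ?_
    obtain ⟨C, hC, b⟩ := timeConv_zero_bound N n
    obtain ⟨q, hq, hb⟩ := h.bound 0 n
    exact ⟨q, C, hq, hC, fun e p hp => b (g e 0) (q e) (hb e) p.1 p.2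
      hp.2.1.le hp.2.2.le (strip_cases hp.1).1⟩
  | one =>
    refine controlled_of_bound fun n N => ?_
    obtain ⟨C, hC, b⟩ := timeConv_one_bound N n
    obtain ⟨q, hq, hb⟩ := h.bound 0 n
    exact ⟨q, C, hq, hC, fun e p hp => b (g e 0) (q e) (hb e) p.1 p.2
      hp.2.1 hp.2.2.le (strip_cases hp.1).1⟩
  | more k ih _ =>
    refine ((h.controlled_corner k).add (ih h.shift)).congr fun e p hp => ?_
    exact timeConv_add_two k (h.cont e 0) (h.cont e 1) (h.deriv e 0) hp.1 hp.2

theorem SmoothFamily.controlledUpTo {g : E → ℕ → ℝ → ℂ} (h : SmoothFamily g) (m k : ℕ) :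
    ControlledUpTo m fun e => timeConv k (g e 0) :=
  controlledUpTo_of_heat (T := fun k e => timeConv k (g e 0)) h.controlled
    (fun k e _ hp => hasDerivAt_timeConv_x k (h.cont e 0) hp.1 hp.2)
    (fun k e _ hp => hasDerivAt_timeConv_t k (h.cont e 0) hp.1 hp.2) m k

theorem SourceFamily.controlled {F : E → ℕ → ℕ → ℝ × ℝ → ℂ} (h : SourceFamily F) {σ : ℝ}
    (hσ : σ = 1 ∨ σ = -1) (a b : ℕ) : Controlled fun e => duhamel σ (F e a b) := by
  refine controlled_of_bound fun n N => ?_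
  obtain ⟨C, hC, hd⟩ := duhamel_bound hσ N n
  obtain ⟨q, hq, hb⟩ := h.bound a b N n
  refine ⟨q, C * n, hq, by positivity, fun e p hp => ?_⟩
  have h1 := (strip_cases hp.1).1
  refine (hd (F e a b) (q e) (fun y τ hy => hb e y τ hy.le) p.1 p.2 hp.2.1.le hp.2.2.le h1).trans ?_
  rw [mul_right_comm]
  have := apply_nonneg q e
  gcongr

theorem SourceFamily.decay {F : E → ℕ → ℕ → ℝ × ℝ → ℂ} (h : SourceFamily F) (e : E) (a b a' b' : ℕ)
    (T : ℝ) : ∃ M, (∀ y τ, 0 ≤ y → 0 ≤ τ → τ ≤ T → (1 + y) ^ 2 * ‖F e a b (y, τ)‖ ≤ M) ∧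
      ∀ y τ, 0 ≤ y → 0 ≤ τ → τ ≤ T → (1 + y) ^ 2 * ‖F e a' b' (y, τ)‖ ≤ M := by
  obtain ⟨q, -, hb⟩ := h.bound a b 2 T
  obtain ⟨q', -, hb'⟩ := h.bound a' b' 2 T
  exact ⟨max (q e) (q' e), fun y τ hy h0 h1 => (hb e y τ hy h0 h1).trans (le_max_left _ _),
    fun y τ hy h0 h1 => (hb' e y τ hy h0 h1).trans (le_max_right _ _)⟩

theorem SourceFamily.cont_x {F : E → ℕ → ℕ → ℝ × ℝ → ℂ} (h : SourceFamily F) (e : E) (a b : ℕ)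
    {τ : ℝ} (hτ : 0 ≤ τ) : ContinuousOn (fun y => F e a b (y, τ)) (Ici 0) :=
  (h.cont e a b).comp (by fun_prop) fun _ hy => ⟨hy, hτ⟩

theorem SourceFamily.cont_t {F : E → ℕ → ℕ → ℝ × ℝ → ℂ} (h : SourceFamily F) (e : E) (a b : ℕ)
    {y : ℝ} (hy : 0 ≤ y) : ContinuousOn (fun τ => F e a b (y, τ)) (Ici 0) :=
  (h.cont e a b).comp (by fun_prop) fun _ hτ => ⟨hy, hτ⟩

/-- The first derivatives of Duhamel's integral are Duhamel's integrals of the differentiated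
source and potentials of its boundary values; the latter are controlled to all orders. -/
theorem SourceFamily.controlledUpTo {F : E → ℕ → ℕ → ℝ × ℝ → ℂ} (h : SourceFamily F) {σ : ℝ}
    (hσ : σ = 1 ∨ σ = -1) (m a b : ℕ) : ControlledUpTo m fun e => duhamel σ (F e a b) := by
  induction m generalizing a b with
  | zero => exact h.controlled hσ a b
  | succ m ih =>
    refine ⟨h.controlled hσ a b, _, _,
      (((h.left a b).controlledUpTo m 0).add (ih (a + 1) b)).const_mul (σ : ℂ),
      ((h.bottom a b).controlledUpTo hσ m 0).add (ih a (b + 1)), fun e p hp => ?_, fun e p hp => ?_⟩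
    · obtain ⟨M, h1, h2⟩ := h.decay e a b (a + 1) b p.2
      exact hasDerivAt_duhamel_x hσ (h.meas e a b) (h.meas e (a + 1) b)
        (fun τ hτ => h.cont_x e a b hτ) (h.cont_t e a b le_rfl) h1 h2
        (fun y τ hy hτ => h.deriv_x e a b y τ hy hτ) hp.1 hp.2
    · obtain ⟨M, h1, h2⟩ := h.decay e a b a (b + 1) (2 * p.2)
      exact hasDerivAt_duhamel_t hσ (h.meas e a b) (h.meas e a (b + 1))
        (fun y hy => h.cont_t e a b hy.le) h1 h2
        (fun y τ hy hτ => h.deriv_t e a b y τ hy.le hτ) hp.1.le hp.2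

end families

/-! ### The data of the problem and their derivatives -/

instance : IsTopologicalAddGroup SchwartzHalfLine := withSeminorms_schwartz.topologicalAddGroup

instance : IsTopologicalAddGroup SmoothHalfLine := withSeminorms_smooth.topologicalAddGroup

instance (S : Strips) : IsTopologicalAddGroup (S1 S) := (withSeminorms_s1 S).topologicalAddGroup

theorem hasDerivAt_iteratedDerivWithin {u : ℝ → ℂ} (hu : ContDiffOn ℝ ∞ u (Ici 0)) (j : ℕ) {y : ℝ}
    (hy : 0 < y) : HasDerivAt (iteratedDerivWithin j u (Ici 0))
      (iteratedDerivWithin (j + 1) u (Ici 0) y) y := by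
  have h1 : DifferentiableOn ℝ (iteratedDerivWithin j u (Ici 0)) (Ici 0) :=
    hu.differentiableOn_iteratedDerivWithin (m := j) (by exact_mod_cast ENat.natCast_lt_top j)
      (uniqueDiffOn_Ici 0)
  rw [iteratedDerivWithin_succ]
  exact (h1 y hy.le).hasDerivWithinAt.hasDerivAt (Ici_mem_nhds hy)

theorem continuousOn_iteratedDerivWithin_Ici {u : ℝ → ℂ} (hu : ContDiffOn ℝ ∞ u (Ici 0)) (j : ℕ) :
    ContinuousOn (iteratedDerivWithin j u (Ici 0)) (Ici 0) :=
  hu.continuousOn_iteratedDerivWithin (by exact_mod_cast le_top) (uniqueDiffOn_Ici 0)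

/-- The derivatives of a Schwartz function on the half-line. -/
def SchwartzHalfLine.d (u : SchwartzHalfLine) (j : ℕ) : ℝ → ℂ := iteratedDerivWithin j u.fn (Ici 0)

/-- The derivatives of a smooth function on the half-line. -/
def SmoothHalfLine.d (g : SmoothHalfLine) (j : ℕ) : ℝ → ℂ := iteratedDerivWithin j g.fn (Ici 0)

/-- The partial derivatives of an element of `S_1(Qbar)`, extended by zero. -/
def S1.d (f : S1 closedQuarter) (a b : ℕ) : ℝ × ℝ → ℂ := Qbar.indicator (pdBar a b f.fn)

theorem SchwartzHalfLine.d_zero (u : SchwartzHalfLine) : u.d 0 = u.fn := iteratedDerivWithin_zero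

theorem SchwartzHalfLine.d_one (u : SchwartzHalfLine) : u.d 1 = derivWithin u.fn (Ici 0) :=
  iteratedDerivWithin_one

theorem SmoothHalfLine.d_zero (g : SmoothHalfLine) : g.d 0 = g.fn := iteratedDerivWithin_zero

theorem schwartzFamily_d : SchwartzFamily SchwartzHalfLine.d where
  cont u j := continuousOn_iteratedDerivWithin_Ici u.2.2.1 j
  deriv u j _ hy := hasDerivAt_iteratedDerivWithin u.2.2.1 j hy
  bound j N := by
    refine ⟨schwartzSeminorm (max j N), withSeminorms_schwartz.continuous_seminorm _,
      fun u y hy => ?_⟩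
    have h1 : (1 + y) ^ max j N * ‖u.d j y‖ ≤ schwartzSeminorm (max j N) u :=
      le_csSup (u.2.2.2 _) ⟨j, le_max_left _ _, y, hy, rfl⟩
    refine le_trans ?_ h1
    gcongr
    · linarith
    · exact le_max_right _ _

theorem smoothFamily_d : SmoothFamily SmoothHalfLine.d where
  cont g j := continuousOn_iteratedDerivWithin_Ici g.2.2 j
  deriv g j _ hy := hasDerivAt_iteratedDerivWithin g.2.2 j hy
  bound j T := by
    refine ⟨smoothSeminorm (j, ⌈T⌉₊.succPNat), withSeminorms_smooth.continuous_seminorm _,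
      fun g τ h0 h1 => ?_⟩
    refine le_csSup (smoothValues_bdd g.2.2) ⟨τ, h0, ?_, rfl⟩
    have := Nat.le_ceil T
    push_cast [Nat.succPNat_coe, Nat.succ_eq_add_one]
    linarith

theorem Dt_Dx_comm {h : ℝ × ℝ → ℂ} (hh : ContDiffOn ℝ ∞ h Q) : EqOn (Dt (Dx h)) (Dx (Dt h)) Q := by
  have key : ∀ v w : ℝ × ℝ, ∀ p ∈ Q,
      fderiv ℝ (fun p => fderiv ℝ h p v) p w = fderiv ℝ (fderiv ℝ h) p w v := by
    intro v w p hp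
    have h2 : DifferentiableAt ℝ (fderiv ℝ h) p :=
      ((hh.fderiv_of_isOpen (m := ∞) isOpen_Q (by simp)).contDiffAt
        (isOpen_Q.mem_nhds hp)).differentiableAt (by simp)
    rw [fderiv_clm_apply h2 (differentiableAt_const v)]
    simp
  intro p hp
  have e1 : Dt (Dx h) p = fderiv ℝ (fun p => fderiv ℝ h p (1, 0)) p (0, 1) := by
    rw [Dt_congr (fun q hq => Dx_eq_fderiv (differentiableAt_of_contDiffOn hh hq)) hp]
    exact Dt_eq_fderiv (differentiableAt_of_contDiffOn (contDiffOn_fderiv_apply hh (1, 0)) hp)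
  have e2 : Dx (Dt h) p = fderiv ℝ (fun p => fderiv ℝ h p (0, 1)) p (1, 0) := by
    rw [Dx_congr (fun q hq => Dt_eq_fderiv (differentiableAt_of_contDiffOn hh hq)) hp]
    exact Dx_eq_fderiv (differentiableAt_of_contDiffOn (contDiffOn_fderiv_apply hh (0, 1)) hp)
  rw [e1, e2, key _ _ p hp, key _ _ p hp]
  exact (hh.contDiffAt (isOpen_Q.mem_nhds hp)).isSymmSndFDerivAt
    (by
    rw [minSmoothness_of_isRCLikeNormedField]
    exact WithTop.coe_le_coe.2 (le_top : (2 : ℕ∞) ≤ ⊤)) _ _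

theorem pd_succ_left (k l : ℕ) (h : ℝ × ℝ → ℂ) : pd (k + 1) l h = Dx (pd k l h) := by
  simp only [pd, Function.iterate_succ_apply']

theorem Dt_pd {h : ℝ × ℝ → ℂ} (hh : ContDiffOn ℝ ∞ h Q) (k l : ℕ) :
    EqOn (Dt (pd k l h)) (pd k (l + 1) h) Q := by
  induction k with
  | zero =>
    intro p _
    simp only [pd, Function.iterate_succ_apply', Function.iterate_zero, id]
  | succ k ih =>
    rw [pd_succ_left, pd_succ_left]
    exact (Dt_Dx_comm (contDiffOn_pd hh k l)).trans (Dx_congr ih)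

theorem hasDerivAt_pd_x {h : ℝ × ℝ → ℂ} (hh : ContDiffOn ℝ ∞ h Q) (k l : ℕ) {p : ℝ × ℝ}
    (hp : p ∈ Q) : HasDerivAt (fun x => pd k l h (x, p.2)) (pd (k + 1) l h p) p.1 := by
  rw [pd_succ_left]
  have h1 : DifferentiableAt ℝ (pd k l h) (p.1, p.2) :=
    differentiableAt_of_contDiffOn (contDiffOn_pd hh k l) hp
  exact (h1.comp p.1 (f := fun x : ℝ => (x, p.2)) (by fun_prop)).hasDerivAt

theorem hasDerivAt_pd_t {h : ℝ × ℝ → ℂ} (hh : ContDiffOn ℝ ∞ h Q) (k l : ℕ) {p : ℝ × ℝ}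
    (hp : p ∈ Q) : HasDerivAt (fun t => pd k l h (p.1, t)) (pd k (l + 1) h p) p.2 := by
  rw [← Dt_pd hh k l hp]
  have h1 : DifferentiableAt ℝ (pd k l h) (p.1, p.2) :=
    differentiableAt_of_contDiffOn (contDiffOn_pd hh k l) hp
  exact (h1.comp p.2 (f := fun t : ℝ => (p.1, t)) (by fun_prop)).hasDerivAt

theorem S1.continuousOn_pdBar (f : S1 closedQuarter) (a b : ℕ) :
    ContinuousOn (pdBar a b f.fn) Qbar :=
  continuousOn_extendFrom Qbar_subset_closure fun p hp => f.2.1.limit a b p hp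

theorem S1.d_eq_pd (f : S1 closedQuarter) (a b : ℕ) {p : ℝ × ℝ} (hp : p ∈ Q) :
    f.d a b p = pd a b f.fn p := by
  rw [S1.d, indicator_of_mem (show p ∈ Qbar from ⟨hp.1.le, hp.2.le⟩)]
  exact pdBar_eq_pd f.2.1.contDiffOn a b hp

theorem S1.d_zero (f : S1 closedQuarter) : f.d 0 0 = f.fn := by
  funext p
  by_cases hp : p ∈ Qbar
  · rw [S1.d, indicator_of_mem hp]
    exact extendFrom_eq (Qbar_subset_closure hp) (f.2.1.value p hp)
  · rw [S1.d, indicator_of_notMem hp]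
    exact (f.2.1.zero_off p hp).symm

theorem isClosed_Qbar : IsClosed Qbar :=
  (isClosed_le continuous_const continuous_fst).inter (isClosed_le continuous_const continuous_snd)

theorem sourceFamily_d : SourceFamily S1.d where
  meas f a b := by
    have h1 := f.continuousOn_pdBar a b
    refine measurable_of_restrict_of_restrict_compl isClosed_Qbar.measurableSet ?_ ?_
    · have h2 : Qbar.domRestrict (f.d a b) = Qbar.domRestrict (pdBar a b f.fn) := by
        funext p; exact indicator_of_mem p.2 _
      rw [h2]
      exact (continuousOn_iff_continuous_domRestrict.1 h1).measurable
    · have h2 : Qbarᶜ.domRestrict (f.d a b) = fun _ => 0 := by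
        funext p; exact indicator_of_notMem p.2 _
      rw [h2]
      exact measurable_const
  cont f a b := (f.continuousOn_pdBar a b).congr fun p hp => indicator_of_mem hp _
  deriv_x f a b y τ hy hτ := by
    have hl : ∀ k l : ℕ, ∀ p ∈ Qpunct, ∃ c, Tendsto (pd k l f.fn) (𝓝[Q] p) (𝓝 c) :=
      fun k l p hp => f.2.1.limit k l p hp.1
    have hc := fun k l => (contDiffOn_pd f.2.1.contDiffOn k l).continuousOn
    rcases hτ.eq_or_lt with rfl | hτ
    · have h1 := hasDerivAt_bottom (hl a b) (hl (a + 1) b) (hc _ _) (hc _ _)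
        (fun p hp => hasDerivAt_pd_x f.2.1.contDiffOn a b hp) hy
      rw [show f.d (a + 1) b (y, 0) = pdBar (a + 1) b f.fn (y, 0) from
        indicator_of_mem (show (y, (0 : ℝ)) ∈ Qbar from ⟨hy.le, le_rfl⟩) _]
      refine h1.congr_of_eventuallyEq ?_
      filter_upwards [Ioi_mem_nhds hy] with z hz
      exact indicator_of_mem (show (z, (0 : ℝ)) ∈ Qbar from ⟨le_of_lt hz, le_rfl⟩) _
    · rw [f.d_eq_pd (a + 1) b (p := (y, τ)) ⟨hy, hτ⟩]
      refine (hasDerivAt_pd_x f.2.1.contDiffOn a b (p := (y, τ)) ⟨hy, hτ⟩).congr_of_eventuallyEq ?_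
      filter_upwards [Ioi_mem_nhds hy] with z hz
      exact f.d_eq_pd a b (p := (z, τ)) ⟨hz, hτ⟩
  deriv_t f a b y τ hy hτ := by
    have hl : ∀ k l : ℕ, ∀ p ∈ Qpunct, ∃ c, Tendsto (pd k l f.fn) (𝓝[Q] p) (𝓝 c) :=
      fun k l p hp => f.2.1.limit k l p hp.1
    have hc := fun k l => (contDiffOn_pd f.2.1.contDiffOn k l).continuousOn
    rcases hy.eq_or_lt with rfl | hy
    · have h1 := hasDerivAt_left (hl a b) (hl a (b + 1)) (hc _ _) (hc _ _)
        (fun p hp => hasDerivAt_pd_t f.2.1.contDiffOn a b hp) hτ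
      rw [show f.d a (b + 1) (0, τ) = pdBar a (b + 1) f.fn (0, τ) from
        indicator_of_mem (show ((0 : ℝ), τ) ∈ Qbar from ⟨le_rfl, hτ.le⟩) _]
      refine h1.congr_of_eventuallyEq ?_
      filter_upwards [Ioi_mem_nhds hτ] with z hz
      exact indicator_of_mem (show ((0 : ℝ), z) ∈ Qbar from ⟨le_rfl, le_of_lt hz⟩) _
    · rw [f.d_eq_pd a (b + 1) (p := (y, τ)) ⟨hy, hτ⟩]
      refine (hasDerivAt_pd_t f.2.1.contDiffOn a b (p := (y, τ)) ⟨hy, hτ⟩).congr_of_eventuallyEq ?_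
      filter_upwards [Ioi_mem_nhds hτ] with z hz
      exact f.d_eq_pd a b (p := (y, z)) ⟨hy, hz⟩
  bound a b N T := by
    set n : ℕ+ := (a + b + N + ⌈T⌉₊).succPNat with hn
    have hn' : (n : ℕ) = a + b + N + ⌈T⌉₊ + 1 := rfl
    refine ⟨s1Seminorm closedQuarter n, (withSeminorms_s1 _).continuous_seminorm _,
      fun f y τ hy h0 h1 => ?_⟩
    have hp : (y, τ) ∈ Qbar := ⟨hy, h0⟩
    have hK : (y, τ) ∈ closedQuarter.K n := by
      refine ⟨hp, ?_⟩
      have := Nat.le_ceil T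
      rw [hn']
      push_cast
      show τ ≤ _
      linarith [(a.cast_nonneg : (0 : ℝ) ≤ a), (b.cast_nonneg : (0 : ℝ) ≤ b),
        (N.cast_nonneg : (0 : ℝ) ≤ N)]
    have h2 : (1 + y) ^ (n : ℕ) * ‖pdBar a b f.fn (y, τ)‖ ≤ s1Seminorm closedQuarter n f :=
      le_csSup (f.2.2 n) ⟨a, b, (y, τ), hK, by omega, rfl⟩
    rw [show f.d a b (y, τ) = pdBar a b f.fn (y, τ) from indicator_of_mem hp _]
    refine le_trans ?_ h2
    gcongr
    · linarith
    · omega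

/-! ### Deformation of contours -/

theorem norm_phase (x t : ℝ) (z : ℂ) :
    ‖phase x t z‖ = Real.exp (-(z.im * x) - (z.re ^ 2 - z.im ^ 2) * t) := by
  rw [phase, Complex.norm_exp]
  congr 1
  simp [pow_two]

theorem phase_zero_right (x : ℝ) (z : ℂ) : phase x 0 z = Complex.exp (Complex.I * z * x) := by
  simp [phase]

theorem differentiable_phase (x t : ℝ) : Differentiable ℂ (phase x t) := by
  unfold phase; fun_prop

theorem continuous_phase : Continuous fun q : (ℝ × ℝ) × ℂ => phase q.1.1 q.1.2 q.2 := by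
  unfold phase; fun_prop

theorem phase_mul_exp (x y t : ℝ) (σ : ℝ) (z : ℂ) :
    phase x t z * Complex.exp (-(Complex.I * (σ * z) * y)) = phase (x - σ * y) t z := by
  rw [phase, phase, ← Complex.exp_add]
  congr 1
  push_cast; ring

theorem phase_mul_exp_sq (x t τ : ℝ) (z : ℂ) :
    phase x t z * Complex.exp (z ^ 2 * τ) = phase x (t - τ) z := by
  rw [phase, phase, ← Complex.exp_add]
  congr 1
  push_cast; ring

theorem sqrt_two_mul_dirOut : (√2 : ℂ) * dirOut = (1 : ℝ) + Complex.I := by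
  have h2 : (√2 : ℂ) * √2 = 2 := by
    rw [← Complex.ofReal_mul, Real.mul_self_sqrt zero_le_two]; simp
  have h : dirOut = Complex.exp ((Real.pi / 4 : ℝ) * Complex.I) := by
    rw [dirOut]; push_cast; ring_nf
  rw [h, Complex.exp_mul_I, ← Complex.ofReal_cos, ← Complex.ofReal_sin, Real.cos_pi_div_four,
    Real.sin_pi_div_four]
  push_cast
  linear_combination (1 + Complex.I) / 2 * h2

theorem sqrt_two_mul_dirIn : (√2 : ℂ) * dirIn = (-1 : ℝ) + Complex.I := by
  have h2 : (√2 : ℂ) * √2 = 2 := by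
    rw [← Complex.ofReal_mul, Real.mul_self_sqrt zero_le_two]; simp
  have h : dirIn = Complex.exp ((Real.pi - Real.pi / 4 : ℝ) * Complex.I) := by
    rw [dirIn]; push_cast; ring_nf
  rw [h, Complex.exp_mul_I, ← Complex.ofReal_cos, ← Complex.ofReal_sin, Real.cos_pi_sub,
    Real.sin_pi_sub, Real.cos_pi_div_four, Real.sin_pi_div_four]
  push_cast
  linear_combination (-1 + Complex.I) / 2 * h2

/-- The two rays of `γ` have the directions `(ε + i)/√2` with `ε = 1` and `ε = -1`. -/
structure IsRay (ε : ℝ) (d : ℂ) : Prop where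
  sign : ε = 1 ∨ ε = -1
  dir : (√2 : ℂ) * d = ε + Complex.I

theorem isRay_dirOut : IsRay 1 dirOut := ⟨Or.inl rfl, sqrt_two_mul_dirOut⟩

theorem isRay_dirIn : IsRay (-1) dirIn := ⟨Or.inr rfl, sqrt_two_mul_dirIn⟩

theorem sqrt_two_mul_inv : √2 * (√2)⁻¹ = 1 := mul_inv_cancel₀ (by positivity)

theorem IsRay.eq {ε : ℝ} {d : ℂ} (h : IsRay ε d) : d = (((√2)⁻¹ : ℝ) : ℂ) * (ε + Complex.I) := by
  rw [← h.dir, ← mul_assoc, ← Complex.ofReal_mul, mul_comm (√2)⁻¹, sqrt_two_mul_inv]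
  simp

theorem IsRay.re {ε : ℝ} {d : ℂ} (h : IsRay ε d) : d.re = (√2)⁻¹ * ε := by
  rw [h.eq, Complex.re_ofReal_mul]; simp

theorem IsRay.im {ε : ℝ} {d : ℂ} (h : IsRay ε d) : d.im = (√2)⁻¹ := by
  rw [h.eq, Complex.im_ofReal_mul]; simp

theorem IsRay.sq_eq {ε : ℝ} {d : ℂ} (h : IsRay ε d) : ε ^ 2 = 1 := by
  rcases h.sign with rfl | rfl <;> norm_num

theorem IsRay.norm {ε : ℝ} {d : ℂ} (h : IsRay ε d) : ‖d‖ = 1 := by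
  rw [← sq_eq_sq₀ (norm_nonneg d) zero_le_one, ← Complex.normSq_eq_norm_sq, Complex.normSq_apply,
    h.re, h.im]
  have := sqrt_two_mul_inv
  have h2 : (√2)⁻¹ * (√2)⁻¹ = 1 / 2 := by
    rw [← mul_inv, Real.mul_self_sqrt zero_le_two]; norm_num
  linear_combination (1 + ε ^ 2) * h2 + h.sq_eq / 2

/-- On the rays of `γ` the modulus of the exponential does not depend on `t`. -/
theorem IsRay.norm_phase {ε : ℝ} {d : ℂ} (h : IsRay ε d) (x t r : ℝ) :
    ‖phase x t (r * d)‖ = Real.exp (-(r * (√2)⁻¹ * x)) := by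
  rw [UTM.norm_phase]
  congr 1
  rw [Complex.re_ofReal_mul, Complex.im_ofReal_mul, h.re, h.im]
  linear_combination (-(r * (√2)⁻¹) ^ 2 * t) * h.sq_eq

theorem integral_line_eq_sub {F G : ℂ → ℂ} {U : Set ℂ}
    (hF : DifferentiableOn ℂ F U) (hG : ∀ z ∈ U, HasDerivAt G (F z) z) {z v : ℂ} {a b : ℝ}
    (hr : ∀ r ∈ uIcc a b, z + r * v ∈ U) :
    ∫ r in a..b, F (z + r * v) * v = G (z + b * v) - G (z + a * v) := by
  have hl : Continuous fun r : ℝ => z + r * v := by fun_prop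
  refine intervalIntegral.integral_eq_sub_of_hasDerivAt (f := fun r : ℝ => G (z + r * v))
    (fun r h => ?_) (ContinuousOn.intervalIntegrable ?_)
  · have h1 : HasDerivAt (fun r : ℝ => z + r * v) v r := by
      simpa using ((Complex.ofRealCLM.hasDerivAt (x := r)).mul_const v).const_add z
    exact (hG _ (hr r h)).comp_of_eq (h₂ := G) r h1 rfl
  · exact ((hF.continuousOn.comp hl.continuousOn hr).mul continuousOn_const)

/-- The integral of a holomorphic function along the part `|λ| ≥ a` of a real half-line equals the
integral along the vertical segment from its end point to the ray of `γ`, followed by the rest of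
that ray, if the function decays on the vertical segments that join the half-line to the ray. -/
theorem integral_halfLine_eq_integral_ray {F : ℂ → ℂ} {ε a C m : ℝ} {d : ℂ} (h : IsRay ε d)
    (ha : 0 ≤ a) (hm : 0 < m)
    (hU : ∀ R, a ≤ R → ∃ (c : ℂ) (ρ : ℝ), DifferentiableOn ℂ F (Metric.ball c ρ) ∧
      ∀ r s : ℝ, a ≤ r → r ≤ R → 0 ≤ s → s ≤ r → (ε * r + s * Complex.I : ℂ) ∈ Metric.ball c ρ)
    (hF : ∀ R s : ℝ, 1 ≤ R → 0 ≤ s → s ≤ R →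
      ‖F (ε * R + s * Complex.I)‖ ≤ C * R * Real.exp (-(m * R)))
    (h1 : IntegrableOn (fun r : ℝ => F (ε * r)) (Ioi a))
    (h2 : IntegrableOn (fun r : ℝ => F (r * d)) (Ioi (√2 * a))) :
    ∫ r : ℝ in Ioi a, F (ε * r) * ε =
      (∫ s in (0 : ℝ)..a, F (ε * a + s * Complex.I) * Complex.I)
        + ∫ r : ℝ in Ioi (√2 * a), F (r * d) * d := by
  -- a primitive in the ball shows that the boundary integral of the trapezoid vanishes
  have e : ∀ R, a ≤ R → (∫ r in a..R, F (ε * r) * ε)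
      + (∫ s in (0 : ℝ)..R, F (ε * R + s * Complex.I) * Complex.I) =
      (∫ s in (0 : ℝ)..a, F (ε * a + s * Complex.I) * Complex.I)
        + ∫ r in √2 * a..√2 * R, F (r * d) * d := by
    intro R hR
    obtain ⟨c, ρ, hd, hb⟩ := hU R hR
    obtain ⟨G, hG⟩ := hd.isExactOn_ball
    have hv : ∀ r, a ≤ r → r ≤ R → ∀ s ∈ uIcc 0 r,
        (ε * r + s * Complex.I : ℂ) ∈ Metric.ball c ρ := by
      intro r h1 h2 s hs
      rw [uIcc_of_le (ha.trans h1)] at hs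
      exact hb r s h1 h2 hs.1 hs.2
    -- the sides on the real axis, on the two verticals, and on the ray
    have e1 := integral_line_eq_sub hd hG (z := 0) (v := ε) (a := a) (b := R) (by
      intro r hr
      rw [uIcc_of_le hR] at hr
      simpa [mul_comm] using hb r 0 hr.1 hr.2 le_rfl (ha.trans hr.1))
    have e2 := integral_line_eq_sub hd hG (hv R hR le_rfl)
    have e3 := integral_line_eq_sub hd hG (hv a le_rfl hR)
    have e4 := integral_line_eq_sub hd hG (z := 0) (v := d) (a := √2 * a)
        (b := √2 * R) (by
      intro r hr
      rw [uIcc_of_le (by gcongr)] at hr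
      have q1 : a ≤ r * (√2)⁻¹ := by
        rw [← div_eq_mul_inv, le_div_iff₀ (by positivity), mul_comm]; exact hr.1
      have q2 : r * (√2)⁻¹ ≤ R := by
        rw [← div_eq_mul_inv, div_le_iff₀ (by positivity), mul_comm]; exact hr.2
      have := hb _ _ q1 q2 (ha.trans q1) le_rfl
      convert! this using 1
      rw [h.eq]; push_cast; ring)
    simp only [zero_add, mul_comm _ (ε : ℂ)] at e1 e4
    have hs : ∀ r : ℝ, ((√2 * r : ℝ) : ℂ) * d = ε * r + r * Complex.I := by
      intro r; push_cast; rw [mul_right_comm, h.dir]; ring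
    rw [hs, hs] at e4
    simp only [mul_comm (ε : ℂ)] at e1 e2 e3 e4 ⊢
    rw [e1, e2, e3, e4]
    simp only [Complex.ofReal_zero, zero_mul, add_zero]
    ring
  have l1 := intervalIntegral_tendsto_integral_Ioi a (h1.mul_const (ε : ℂ)) tendsto_id
  have l2 := intervalIntegral_tendsto_integral_Ioi (√2 * a) (h2.mul_const d)
    (tendsto_id.const_mul_atTop (show (0 : ℝ) < √2 by positivity))
  -- the vertical side at distance `R` has length `R` and disappears as `R → ∞`
  have l3 : Tendsto (fun R : ℝ => ∫ s in (0 : ℝ)..R, F (ε * R + s * Complex.I) * Complex.I)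
      atTop (𝓝 0) := by
    have l4 : Tendsto (fun R : ℝ => C * m⁻¹ ^ 2 * ((m * R) ^ 2 * Real.exp (-(m * R)))) atTop
        (𝓝 (C * m⁻¹ ^ 2 * 0)) :=
      ((Real.tendsto_pow_mul_exp_neg_atTop_nhds_zero 2).comp
        (tendsto_id.const_mul_atTop hm)).const_mul _
    rw [mul_zero] at l4
    refine squeeze_zero_norm' ?_ l4
    filter_upwards [eventually_ge_atTop 1] with R hR
    have := intervalIntegral.norm_integral_le_of_norm_le_const (a := 0) (b := R)
      (f := fun s : ℝ => F (ε * R + s * Complex.I) * Complex.I)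
      (C := C * R * Real.exp (-(m * R))) (by
        intro s hs
        rw [uIoc_of_le (by linarith)] at hs
        rw [norm_mul, Complex.norm_I, mul_one]
        exact hF R s hR hs.1.le hs.2)
    rw [sub_zero, abs_of_nonneg (by linarith : 0 ≤ R)] at this
    refine this.trans_eq ?_
    field_simp
  refine tendsto_nhds_unique (((l1.add l3).congr' ?_).trans_eq (by rw [add_zero]))
    (l2.const_add _)
  filter_upwards [eventually_ge_atTop a] with R hR using e R hR

/-- On the vertical segments that join the real axis to the rays of `γ` the exponential decays. -/
theorem norm_phase_vertical {x t ε R s : ℝ} (hε : ε ^ 2 = 1) (ht : 0 ≤ t) (hR : 1 ≤ R)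
    (h0 : 0 ≤ s) (h1 : s ≤ R) :
    ‖phase x t (ε * R + s * Complex.I)‖ ≤ Real.exp (-(min x t * R)) := by
  rw [norm_phase]
  simp only [Complex.add_re, Complex.add_im, Complex.re_ofReal_mul, Complex.im_ofReal_mul,
    Complex.ofReal_re, Complex.ofReal_im, Complex.I_re, Complex.I_im]
  refine Real.exp_le_exp.2 ?_
  have e1 : (ε * R + s * 0) ^ 2 = R ^ 2 := by rw [mul_zero, add_zero, mul_pow, hε, one_mul]
  rw [e1]
  have a1 : min x t * s ≤ x * s := mul_le_mul_of_nonneg_right (min_le_left _ _) h0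
  have a2 : min x t * (R - s) ≤ t * (R - s) :=
    mul_le_mul_of_nonneg_right (min_le_right _ _) (by linarith)
  have a3 : t * (R - s) * 1 ≤ t * (R - s) * (R + s) :=
    mul_le_mul_of_nonneg_left (by linarith) (mul_nonneg ht (by linarith))
  nlinarith

/-- The triangle between the real axis and the ray, up to abscissa `R`, lies in a ball about `0`. -/
theorem mem_ball_of_le {ε r s R : ℝ} (hε : ε ^ 2 = 1) (h0 : 0 ≤ s) (h1 : s ≤ r) (h2 : r ≤ R) :
    (ε * r + s * Complex.I : ℂ) ∈ Metric.ball 0 (2 * R + 1) := by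
  rw [mem_ball_zero_iff]
  have e1 : |ε| = 1 := by rw [← sq_eq_sq₀ (abs_nonneg ε) zero_le_one, sq_abs, hε, one_pow]
  refine (norm_add_le _ _).trans_lt ?_
  rw [norm_mul, norm_mul, Complex.norm_real, Complex.norm_real, Complex.norm_real, Complex.norm_I,
    Real.norm_eq_abs, e1, Real.norm_of_nonneg h0, Real.norm_of_nonneg (h0.trans h1)]
  linarith

/-- The trapezoid `1 ≤ |Re λ| ≤ R` between the real axis and the ray lies in a ball that avoids `0`
(`zero_notMem_ball`). -/
theorem mem_ball_of_one_le {ε r s R : ℝ} (hε : ε ^ 2 = 1) (h0 : 0 ≤ s) (h1 : s ≤ r) (hr : 1 ≤ r)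
    (h2 : r ≤ R) :
    (ε * r + s * Complex.I : ℂ) ∈ Metric.ball ((ε * (2 * R) : ℝ) : ℂ) (2 * R - 1 / 2) := by
  rw [Metric.mem_ball, Complex.dist_eq, ← sq_lt_sq₀ (norm_nonneg _) (by linarith),
    ← Complex.normSq_eq_norm_sq, Complex.normSq_apply]
  simp only [Complex.sub_re, Complex.sub_im, Complex.add_re, Complex.add_im, Complex.re_ofReal_mul,
    Complex.im_ofReal_mul, Complex.ofReal_re, Complex.ofReal_im, Complex.I_re, Complex.I_im]
  have e1 : (ε * r + s * 0 - ε * (2 * R)) * (ε * r + s * 0 - ε * (2 * R)) = (r - 2 * R) ^ 2 := by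
    linear_combination (r - 2 * R) ^ 2 * hε
  rw [e1]
  nlinarith

theorem zero_notMem_ball {ε R : ℝ} (hε : ε ^ 2 = 1) :
    (0 : ℂ) ∉ Metric.ball ((ε * (2 * R) : ℝ) : ℂ) (2 * R - 1 / 2) := by
  have e1 : |ε| = 1 := by rw [← sq_eq_sq₀ (abs_nonneg ε) zero_le_one, sq_abs, hε, one_pow]
  rw [Metric.mem_ball, dist_comm, dist_zero_right, Complex.norm_real, Real.norm_eq_abs, abs_mul, e1]
  have := le_abs_self (2 * R)
  linarith

theorem integrableOn_exp_neg_mul {c : ℝ} (hc : 0 < c) (a : ℝ) :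
    IntegrableOn (fun r : ℝ => Real.exp (-(r * c))) (Ioi a) := by
  simpa [mul_comm] using exp_neg_integrableOn_Ioi a hc

theorem integrableOn_mul_exp_neg_mul {c : ℝ} (hc : 0 < c) :
    IntegrableOn (fun r : ℝ => r * Real.exp (-(r * c))) (Ioi 0) := by
  have h := (integrableOn_exp_neg_mul (half_pos hc) 0).const_mul (2 / c)
  refine h.mono' (by fun_prop) ?_
  filter_upwards [ae_restrict_mem measurableSet_Ioi] with r hr
  have hr : 0 < r := hr
  rw [Real.norm_of_nonneg (by positivity)]
  have h1 := Real.add_one_le_exp (r * (c / 2))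
  have h2 : r ≤ 2 / c * Real.exp (r * (c / 2)) := by
    rw [div_mul_eq_mul_div, le_div_iff₀ hc]; linarith
  calc r * Real.exp (-(r * c)) ≤ 2 / c * Real.exp (r * (c / 2)) * Real.exp (-(r * c)) := by gcongr
    _ = 2 / c * Real.exp (-(r * (c / 2))) := by
      rw [mul_assoc, ← Real.exp_add]; congr 2; ring

theorem inv_sqrt_two_pos : 0 < (√2 : ℝ)⁻¹ := by positivity

theorem IsRay.integrableOn_phase {ε : ℝ} {d : ℂ} (h : IsRay ε d) {x : ℝ} (hx : 0 < x) (t a : ℝ) :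
    IntegrableOn (fun r : ℝ => phase x t (r * d)) (Ioi a) := by
  refine (integrableOn_exp_neg_mul (mul_pos inv_sqrt_two_pos hx) a).mono'
    (Continuous.aestronglyMeasurable (by unfold phase; fun_prop)) (ae_of_all _ fun r => ?_)
  rw [h.norm_phase, mul_assoc]

theorem IsRay.integrableOn_mul_phase {ε : ℝ} {d : ℂ} (h : IsRay ε d) {x : ℝ} (hx : 0 < x) (t : ℝ) :
    IntegrableOn (fun r : ℝ => phase x t (r * d) * (r * d)) (Ioi 0) := by
  refine (integrableOn_mul_exp_neg_mul (mul_pos inv_sqrt_two_pos hx)).mono'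
    (Continuous.aestronglyMeasurable (by unfold phase; fun_prop)) ?_
  filter_upwards [ae_restrict_mem measurableSet_Ioi] with r hr
  rw [norm_mul, h.norm_phase, norm_mul, h.norm, Complex.norm_real, Real.norm_of_nonneg (le_of_lt hr),
    mul_one, mul_comm, mul_assoc]

theorem phase_eq_quadratic (x t z : ℝ) :
    phase x t z = Complex.exp ((-t : ℂ) * (z : ℂ) ^ 2 + (Complex.I * x) * z + 0) := by
  rw [phase]; congr 1; ring

theorem integrable_phase (x : ℝ) {t : ℝ} (ht : 0 < t) : Integrable fun z : ℝ => phase x t z := by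
  simp only [phase_eq_quadratic]
  exact integrable_cexp_quadratic' (by simpa using ht) _ _

theorem norm_phase_real (x t z : ℝ) : ‖phase x t z‖ = Real.exp (-t * z ^ 2) := by
  rw [norm_phase]; congr 1; simp; ring

theorem integrable_phase_mul (x : ℝ) {t : ℝ} (ht : 0 < t) :
    Integrable fun z : ℝ => phase x t z * z := by
  refine (integrable_mul_exp_neg_mul_sq ht).norm.mono'
    (Continuous.aestronglyMeasurable (by unfold phase; fun_prop)) (ae_of_all _ fun z => ?_)
  rw [norm_mul, norm_mul, norm_phase_real, Complex.norm_real, Real.norm_of_nonneg (Real.exp_pos _).le,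
    mul_comm]

theorem integral_phase (x : ℝ) {t : ℝ} (ht : 0 < t) : ∫ z : ℝ, phase x t z = heatK 0 x t := by
  have h1 := fourierIntegral_gaussian (b := t) (by simpa using ht) x
  have e1 : ∀ z : ℝ, Complex.exp (Complex.I * x * z) * Complex.exp (-(t : ℂ) * z ^ 2) =
      phase x t z := by
    intro z; rw [phase, ← Complex.exp_add]; congr 1; ring
  simp only [e1] at h1
  rw [h1, heatK, heatProfile_zero]
  have e2 : ((Real.pi : ℂ) / t) ^ (1 / 2 : ℂ) = ((√Real.pi * (√t)⁻¹ : ℝ) : ℂ) := by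
    rw [← Complex.ofReal_div, show (1 / 2 : ℂ) = ((1 / 2 : ℝ) : ℂ) by push_cast; rfl,
      ← Complex.ofReal_cpow (by positivity), ← Real.sqrt_eq_rpow, Real.sqrt_div Real.pi_pos.le]
    rfl
  have e3 : (x * (√t)⁻¹) ^ 2 = x ^ 2 / t := by
    rw [mul_pow, inv_pow, Real.sq_sqrt ht.le, div_eq_mul_inv]
  rw [e2, e3]
  push_cast
  rw [show -(x : ℂ) ^ 2 / (4 * t) = -((x : ℂ) ^ 2 / t) / 4 by
    have : (t : ℂ) ≠ 0 := by exact_mod_cast ht.ne'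
    field_simp]
  ring

/-- The integral of the derivative of the Gaussian vanishes. -/
theorem integral_phase_mul (x : ℝ) {t : ℝ} (ht : 0 < t) :
    ∫ z : ℝ, phase x t z * z = -Complex.I * heatK 1 x t := by
  have hd : ∀ z : ℝ, HasDerivAt (fun z : ℝ => phase x t z)
      (phase x t z * (Complex.I * x) - 2 * t * (phase x t z * z)) z := by
    intro z
    have h1 : HasDerivAt (fun z : ℂ => Complex.I * z * x - z ^ 2 * t)
        (Complex.I * x - 2 * z * t) (z : ℂ) := by
      convert! (((hasDerivAt_id (z : ℂ)).const_mul Complex.I).mul_const (x : ℂ)).sub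
        ((hasDerivAt_pow 2 (z : ℂ)).mul_const (t : ℂ)) using 1
      simp
    refine (h1.cexp.comp_ofReal).congr_deriv ?_
    rw [phase]; ring
  have hi := integrable_phase x ht
  have hj := integrable_phase_mul x ht
  have h0 := integral_eq_zero_of_hasDerivAt_of_integrable hd
    ((hi.mul_const _).sub (hj.const_mul _)) hi
  rw [integral_sub (hi.mul_const _) (hj.const_mul _), integral_mul_const, integral_const_mul,
    integral_phase x ht] at h0
  have ht' : (t : ℂ) ≠ 0 := by exact_mod_cast ht.ne'
  have e : heatK 1 x t = -(x / (2 * t)) * heatK 0 x t := by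
    rw [heatK, heatK, heatProfile_one]
    have e3 : (√t)⁻¹ * (√t)⁻¹ = t⁻¹ := by rw [← mul_inv, Real.mul_self_sqrt ht.le]
    calc (√t)⁻¹ ^ (1 + 1) * (-(x * (√t)⁻¹ / 2) * heatProfile 0 (x * (√t)⁻¹))
        = -(x / 2 * ((√t)⁻¹ * (√t)⁻¹)) * ((√t)⁻¹ ^ (0 + 1) * heatProfile 0 (x * (√t)⁻¹)) := by ring
      _ = _ := by rw [e3]; field_simp
  rw [e]
  push_cast
  field_simp
  linear_combination -h0

/-- Integrals of an entire function along the real line may be deformed to `γ`. -/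
theorem integral_eq_gammaInt {F : ℂ → ℂ} {C m : ℝ} (hm : 0 < m) (hd : Differentiable ℂ F)
    (hF : ∀ ε R s : ℝ, ε ^ 2 = 1 → 1 ≤ R → 0 ≤ s → s ≤ R →
      ‖F (ε * R + s * Complex.I)‖ ≤ C * R * Real.exp (-(m * R)))
    (h1 : Integrable fun r : ℝ => F r) (h2 : GammaIntegrable 0 F) :
    ∫ r : ℝ, F r = gammaInt 0 F := by
  have key : ∀ (ε : ℝ) (d : ℂ), IsRay ε d → IntegrableOn (fun r : ℝ => F (ε * r)) (Ioi 0) →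
      IntegrableOn (fun r : ℝ => F (r * d)) (Ioi 0) →
      ∫ r : ℝ in Ioi 0, F (ε * r) * ε = ∫ r : ℝ in Ioi 0, F (r * d) * d := by
    intro ε d h i1 i2
    have := integral_halfLine_eq_integral_ray h le_rfl hm
      (fun R _ => ⟨0, 2 * R + 1, hd.differentiableOn,
        fun r s _ b c e => mem_ball_of_le h.sq_eq c e b⟩)
      (fun R s => hF ε R s h.sq_eq) i1 (by rwa [mul_zero])
    simpa using this
  have k1 := key 1 _ isRay_dirOut (by simpa using h1.integrableOn) h2.1
  have k2 := key (-1) _ isRay_dirIn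
    (by simpa using (h1.comp_neg.integrableOn : IntegrableOn (fun r : ℝ => F ((-r : ℝ) : ℂ)) (Ioi 0)))
    h2.2
  have k3 := integral_comp_neg_Ioi 0 fun r : ℝ => F r
  rw [neg_zero] at k3
  rw [gammaInt, ← k1, ← k2, ← intervalIntegral.integral_Iic_add_Ioi h1.integrableOn h1.integrableOn,
    ← k3]
  simp only [Complex.ofReal_neg, Complex.ofReal_one, one_mul, mul_one, mul_neg, neg_mul]
  rw [integral_neg]
  ring

theorem gammaInt_phase {x t : ℝ} (hx : 0 < x) (ht : 0 < t) :
    gammaInt 0 (phase x t) = heatK 0 x t := by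
  rw [← integral_phase x ht]
  refine (integral_eq_gammaInt (C := 1) (lt_min hx ht) (differentiable_phase x t)
    (fun ε R s hε hR h0 h1 => ?_) (integrable_phase x ht)
    ⟨isRay_dirOut.integrableOn_phase hx t 0, isRay_dirIn.integrableOn_phase hx t 0⟩).symm
  refine (norm_phase_vertical hε ht.le hR h0 h1).trans ?_
  rw [one_mul]
  exact le_mul_of_one_le_left (Real.exp_pos _).le hR

theorem gammaInt_phase_mul {x t : ℝ} (hx : 0 < x) (ht : 0 < t) :
    gammaInt 0 (fun z => phase x t z * z) = -Complex.I * heatK 1 x t := by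
  rw [← integral_phase_mul x ht]
  refine (integral_eq_gammaInt (F := fun z => phase x t z * z) (C := 3) (lt_min hx ht)
    ((differentiable_phase x t).mul differentiable_id)
    (fun ε R s hε hR h0 h1 => ?_) (integrable_phase_mul x ht)
    ⟨isRay_dirOut.integrableOn_mul_phase hx t, isRay_dirIn.integrableOn_mul_phase hx t⟩).symm
  have h2 := mem_ball_of_le hε h0 h1 le_rfl
  rw [mem_ball_zero_iff] at h2
  rw [norm_mul, mul_comm]
  exact mul_le_mul (by linarith) (norm_phase_vertical hε ht.le hR h0 h1) (norm_nonneg _)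
    (by linarith)

theorem norm_phase_div_le (x t : ℝ) {z : ℂ} (hz : 1 ≤ ‖z‖) :
    ‖phase x t z / (Complex.I * z)‖ ≤ ‖phase x t z‖ := by
  rw [norm_div, norm_mul, Complex.norm_I, one_mul]
  exact div_le_self (norm_nonneg _) hz

theorem measurable_phase_div (x t : ℝ) (c : ℂ) :
    Measurable fun r : ℝ => phase x t (r * c) / (Complex.I * (r * c)) := by
  have : Measurable fun r : ℝ => phase x t (r * c) :=
    Continuous.measurable (by unfold phase; fun_prop)
  exact this.div (by fun_prop)

theorem IsRay.integrableOn_phase_div {ε : ℝ} {d : ℂ} (h : IsRay ε d) {x : ℝ} (hx : 0 < x) (t : ℝ) :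
    IntegrableOn (fun r : ℝ => phase x t (r * d) / (Complex.I * (r * d))) (Ioi √2) := by
  refine (h.integrableOn_phase hx t √2).norm.mono' (measurable_phase_div x t d).aestronglyMeasurable
    ?_
  filter_upwards [ae_restrict_mem measurableSet_Ioi] with r hr
  have hr : 1 < r := lt_trans Real.one_lt_sqrt_two hr
  refine norm_phase_div_le x t ?_
  rw [norm_mul, h.norm, mul_one, Complex.norm_real, Real.norm_of_nonneg (by linarith)]
  exact hr.le

/-- The integral of `e^{iλx-λ²t}/(iλ)` over the part `|λ| > 1` of the real line may be deformed to
`γ^*`, which avoids the pole. -/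
theorem integral_phase_div {x t : ℝ} (hx : 0 < x) (ht : 0 < t) :
    (∫ z : ℝ in Iio (-1), phase x t z / (Complex.I * z))
      + (∫ z : ℝ in Ioi 1, phase x t z / (Complex.I * z)) =
      gammaStarInt fun z => phase x t z / (Complex.I * z) := by
  set F : ℂ → ℂ := fun z => phase x t z / (Complex.I * z) with hFdef
  have key : ∀ (ε : ℝ) (d : ℂ), IsRay ε d →
      ∫ r : ℝ in Ioi 1, F (ε * r) * ε = (∫ s in (0 : ℝ)..1, F (ε + s * Complex.I) * Complex.I)
        + ∫ r : ℝ in Ioi √2, F (r * d) * d := by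
    intro ε d h
    have i1 : IntegrableOn (fun r : ℝ => F (ε * r)) (Ioi 1) := by
      refine (integrable_exp_neg_mul_sq ht).integrableOn.mono'
        (by simpa only [mul_comm] using (measurable_phase_div x t ε).aestronglyMeasurable) ?_
      filter_upwards [ae_restrict_mem measurableSet_Ioi] with r hr
      have hr : 1 < r := hr
      refine (norm_phase_div_le x t ?_).trans_eq ?_
      · have e1 : |ε| = 1 := by
          rw [← sq_eq_sq₀ (abs_nonneg ε) zero_le_one, sq_abs, h.sq_eq, one_pow]
        rw [norm_mul, Complex.norm_real, Complex.norm_real, Real.norm_eq_abs, e1, one_mul,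
          Real.norm_of_nonneg (by linarith)]
        exact hr.le
      · rw [← Complex.ofReal_mul, norm_phase_real, mul_pow, h.sq_eq, one_mul]
    have i2 : IntegrableOn (fun r : ℝ => F (r * d)) (Ioi √2) := h.integrableOn_phase_div hx t
    have := integral_halfLine_eq_integral_ray (F := F) (C := 1) h zero_le_one (lt_min hx ht)
      (fun R _ => ⟨_, _, ?_, fun r s a b c e => mem_ball_of_one_le h.sq_eq c e a b⟩)
      (fun R s hR h0 h1 => ?_) i1 (by rwa [mul_one])
    · simpa using this
    · refine (differentiable_phase x t).differentiableOn.div (by fun_prop) fun z hz h0 => ?_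
      rcases mul_eq_zero.1 h0 with h0 | rfl
      · exact Complex.I_ne_zero h0
      · exact zero_notMem_ball h.sq_eq hz
    · refine (norm_phase_div_le x t ?_).trans ((norm_phase_vertical h.sq_eq ht.le hR h0 h1).trans ?_)
      · have e1 : |ε| = 1 := by
          rw [← sq_eq_sq₀ (abs_nonneg ε) zero_le_one, sq_abs, h.sq_eq, one_pow]
        have := Complex.abs_re_le_norm (ε * R + s * Complex.I)
        simp only [Complex.add_re, Complex.re_ofReal_mul, Complex.ofReal_re, Complex.I_re, mul_zero,
          add_zero, abs_mul, e1, one_mul] at this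
        exact hR.trans ((le_abs_self R).trans this)
      · rw [one_mul]
        exact le_mul_of_one_le_left (Real.exp_pos _).le hR
  have k1 := key 1 _ isRay_dirOut
  have k2 := key (-1) _ isRay_dirIn
  have k3 := integral_comp_neg_Ioi 1 fun r : ℝ => F r
  -- `γ^*` traverses the segment at `-1` downwards
  have k4 : ∫ s in (0 : ℝ)..1, F (-1 + Complex.I + s * (-1 - (-1 + Complex.I))) *
      (-1 - (-1 + Complex.I)) = -∫ s in (0 : ℝ)..1, F (-1 + s * Complex.I) * Complex.I := by
    have := intervalIntegral.integral_comp_sub_left (a := 0) (b := 1)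
      (fun s : ℝ => F (-1 + s * Complex.I) * Complex.I) 1
    rw [sub_self, sub_zero] at this
    rw [← this, ← intervalIntegral.integral_neg]
    congr 1
    funext s
    rw [← mul_neg]
    congr 2 <;> push_cast <;> ring
  simp only [Complex.ofReal_neg, Complex.ofReal_one, one_mul, mul_one, mul_neg, neg_mul] at k1 k2
  rw [integral_neg] at k2
  simp only [Complex.ofReal_neg] at k3
  rw [← integral_Iic_eq_integral_Iio, ← k3, k1, gammaStarInt, gammaInt, segInt, segInt, k4]
  simp only [add_sub_cancel_left]
  linear_combination (-1 : ℂ) * k2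

/-! ### The contour integrals as heat potentials -/

theorem norm_exp_le_one {z : ℂ} (hz : z.im ≤ 0) {y : ℝ} (hy : 0 ≤ y) :
    ‖Complex.exp (-(Complex.I * z * y))‖ ≤ 1 := by
  rw [Complex.norm_exp, ← Real.exp_zero]
  refine Real.exp_le_exp.2 ?_
  simpa using mul_nonpos_of_nonpos_of_nonneg hz hy

theorem norm_hat_le {u : ℝ → ℂ} (hu : IntegrableOn u (Ioi 0)) {z : ℂ} (hz : z.im ≤ 0) :
    ‖hat u z‖ ≤ ∫ y in Ioi (0 : ℝ), ‖u y‖ := by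
  refine norm_integral_le_of_norm_le hu.norm ?_
  filter_upwards [ae_restrict_mem measurableSet_Ioi] with y hy
  rw [norm_mul]
  exact mul_le_of_le_one_left (norm_nonneg _) (norm_exp_le_one hz (le_of_lt hy))

theorem measurable_hat_comp {α : Type*} [MeasurableSpace α] {f : ℝ × ℝ → ℂ} (hf : Measurable f)
    {a : α → ℝ} {Z : α → ℂ} (ha : Measurable a) (hZ : Measurable Z) :
    Measurable fun q : α => hat (fun y => f (y, a q)) (Z q) := by
  have h1 : Measurable fun q : α × ℝ =>
      Complex.exp (-(Complex.I * Z q.1 * q.2)) * f (q.2, a q.1) := by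
    refine Measurable.mul ?_ (hf.comp (measurable_snd.prodMk (ha.comp measurable_fst)))
    have hZ' : Measurable fun q : α × ℝ => Z q.1 := hZ.comp measurable_fst
    fun_prop
  exact (h1.stronglyMeasurable.integral_prod_right' (ν := volume.restrict (Ioi (0 : ℝ)))).measurable

theorem measurable_hat {u : ℝ → ℂ} (hu : AEStronglyMeasurable u (volume.restrict (Ioi 0))) :
    Measurable (hat u) := by
  have h1 : hat u = hat (hu.mk u) := by
    funext z
    refine integral_congr_ae ?_
    filter_upwards [hu.ae_eq_mk] with y hy
    rw [hy]
  rw [h1]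
  exact measurable_hat_comp (f := fun q => hu.mk u q.1)
    (hu.stronglyMeasurable_mk.measurable.comp measurable_fst) (a := fun _ => 0) measurable_const
    measurable_id

theorem ae_prod_fst {α β : Type*} [MeasurableSpace α] [MeasurableSpace β] {μ : Measure α}
    {ν : Measure β} [SFinite ν] {P : α → Prop} (h : ∀ᵐ a ∂μ, P a) : ∀ᵐ q ∂μ.prod ν, P q.1 :=
  Measure.quasiMeasurePreserving_fst.ae h

theorem ae_prod_snd {α β : Type*} [MeasurableSpace α] [MeasurableSpace β] {μ : Measure α}
    {ν : Measure β} [SFinite μ] [SFinite ν] {P : β → Prop} (h : ∀ᵐ b ∂ν, P b) :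
    ∀ᵐ q ∂μ.prod ν, P q.2 :=
  Measure.quasiMeasurePreserving_snd.ae h

/-- Fubini's theorem for the half-line Fourier transform under an integral along a line in the
complex plane. -/
theorem integrable_phase_mul_hat {μ : Measure ℝ} [SFinite μ] {u : ℝ → ℂ}
    (hu : IntegrableOn u (Ioi 0)) {c : ℂ} {σ x t : ℝ} {G : ℝ → ℝ} (hG : Integrable G μ)
    (hb : ∀ᵐ r : ℝ ∂μ, ∀ y, 0 < y → ‖phase (x - σ * y) t (r * c)‖ ≤ G r) :
    Integrable (fun r : ℝ => phase x t (r * c) * hat u (σ * (r * c))) μ ∧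
    IntegrableOn (fun y => (∫ r : ℝ, phase (x - σ * y) t (r * c) ∂μ) * u y) (Ioi 0) ∧
    ∫ r : ℝ, phase x t (r * c) * hat u (σ * (r * c)) ∂μ =
      ∫ y in Ioi (0 : ℝ), (∫ r : ℝ, phase (x - σ * y) t (r * c) ∂μ) * u y := by
  have hi : Integrable (fun q : ℝ × ℝ => phase (x - σ * q.2) t (q.1 * c) * u q.2)
      (μ.prod (volume.restrict (Ioi 0))) := by
    refine (hG.mul_prod hu.norm).mono' ?_ ?_
    · refine AEStronglyMeasurable.mul (Continuous.aestronglyMeasurable ?_)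
        hu.aestronglyMeasurable.comp_snd
      unfold phase; fun_prop
    · filter_upwards [ae_prod_fst hb, ae_prod_snd (ae_restrict_mem measurableSet_Ioi)] with q h1 h2
      rw [norm_mul]
      exact mul_le_mul_of_nonneg_right (h1 _ h2) (norm_nonneg _)
  have e1 : ∀ r : ℝ, phase x t (r * c) * hat u (σ * (r * c)) =
      ∫ y in Ioi (0 : ℝ), phase (x - σ * y) t (r * c) * u y := by
    intro r
    rw [hat, ← integral_const_mul]
    refine integral_congr_ae (ae_of_all _ fun y => ?_)
    show phase x t (r * c) * (Complex.exp _ * u y) = _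
    rw [← mul_assoc, phase_mul_exp]
  have e2 : ∀ y : ℝ, (∫ r : ℝ, phase (x - σ * y) t (r * c) ∂μ) * u y =
      ∫ r : ℝ, phase (x - σ * y) t (r * c) * u y ∂μ := fun y => (integral_mul_const _ _).symm
  simp only [e1, e2]
  exact ⟨hi.integral_prod_left, hi.integral_prod_right, integral_integral_swap hi⟩

/-- Fubini's theorem for a time integral under an integral along a line in the complex plane. -/
theorem integrable_phase_mul_tilde {μ : Measure ℝ} [SFinite μ] {c : ℂ} {x t : ℝ} (ht : 0 ≤ t)
    {h : ℝ → ℝ → ℂ}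
    (hi : Integrable (fun q : ℝ × ℝ => phase x (t - q.2) (q.1 * c) * h q.1 q.2)
      (μ.prod (volume.restrict (Ioc 0 t)))) :
    Integrable (fun r : ℝ => phase x t (r * c) *
      ∫ τ in (0 : ℝ)..t, Complex.exp ((r * c) ^ 2 * τ) * h r τ) μ ∧
    IntervalIntegrable (fun τ => ∫ r : ℝ, phase x (t - τ) (r * c) * h r τ ∂μ) volume 0 t ∧
    ∫ r : ℝ, phase x t (r * c) * (∫ τ in (0 : ℝ)..t, Complex.exp ((r * c) ^ 2 * τ) * h r τ) ∂μ =
      ∫ τ in (0 : ℝ)..t, ∫ r : ℝ, phase x (t - τ) (r * c) * h r τ ∂μ := by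
  have e1 : ∀ r : ℝ, phase x t (r * c) *
      (∫ τ in (0 : ℝ)..t, Complex.exp ((r * c) ^ 2 * τ) * h r τ) =
      ∫ τ in Ioc (0 : ℝ) t, phase x (t - τ) (r * c) * h r τ := by
    intro r
    rw [intervalIntegral.integral_of_le ht, ← integral_const_mul]
    refine integral_congr_ae (ae_of_all _ fun τ => ?_)
    show phase x t (r * c) * (Complex.exp _ * h r τ) = _
    rw [← mul_assoc, phase_mul_exp_sq]
  simp only [e1]
  rw [intervalIntegral.integral_of_le ht, intervalIntegrable_iff_integrableOn_Ioc_of_le ht]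
  exact ⟨hi.integral_prod_left, hi.integral_prod_right, integral_integral_swap hi⟩

section schwartz
variable {u : ℝ → ℂ} (hu : IntegrableOn u (Ioi 0))
include hu

/-- The integral over the real line. -/
theorem integral_phase_mul_hat (σ x : ℝ) {t : ℝ} (ht : 0 < t) :
    Integrable (fun z : ℝ => phase x t z * hat u (σ * z)) ∧
    ∫ z : ℝ, phase x t z * hat u (σ * z) = halfConv σ 0 u (x, t) := by
  obtain ⟨h1, -, h2⟩ := integrable_phase_mul_hat (μ := volume) hu (c := 1) (σ := σ) (x := x) (t := t)
    (integrable_exp_neg_mul_sq ht)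
    (ae_of_all _ fun r y _ => by rw [mul_one, norm_phase_real])
  simp only [mul_one, integral_phase _ ht] at h1 h2
  exact ⟨h1, h2⟩

theorem IsRay.integrable_phase_mul_hat {ε : ℝ} {d : ℂ} (h : IsRay ε d) {x : ℝ} (hx : 0 < x)
    (t : ℝ) :
    IntegrableOn (fun r : ℝ => phase x t (r * d) * hat u (-(r * d))) (Ioi 0) ∧
    IntegrableOn (fun y => (∫ r : ℝ in Ioi 0, phase (x + y) t (r * d)) * u y) (Ioi 0) ∧
    ∫ r : ℝ in Ioi 0, phase x t (r * d) * hat u (-(r * d)) =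
      ∫ y in Ioi (0 : ℝ), (∫ r : ℝ in Ioi 0, phase (x + y) t (r * d)) * u y := by
  have h1 := UTM.integrable_phase_mul_hat (μ := volume.restrict (Ioi 0)) hu (c := d) (σ := -1)
    (x := x) (t := t) (integrableOn_exp_neg_mul (mul_pos inv_sqrt_two_pos hx) 0) (by
      filter_upwards [ae_restrict_mem measurableSet_Ioi] with r hr y hy
      have hr : 0 < r := hr
      rw [h.norm_phase, mul_assoc]
      gcongr
      linarith)
  simpa [IntegrableOn] using h1

/-- The integral over `γ`. -/
theorem gammaInt_phase_mul_hat {x t : ℝ} (hx : 0 < x) (ht : 0 < t) :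
    gammaInt 0 (fun z => phase x t z * hat u (-z)) = halfConv (-1) 0 u (x, t) := by
  obtain ⟨-, i1, e1⟩ := isRay_dirOut.integrable_phase_mul_hat hu hx t
  obtain ⟨-, i2, e2⟩ := isRay_dirIn.integrable_phase_mul_hat hu hx t
  rw [gammaInt, integral_mul_const, integral_mul_const, e1, e2, ← integral_mul_const,
    ← integral_mul_const, ← integral_sub (i1.mul_const _) (i2.mul_const _), halfConv]
  refine setIntegral_congr_fun measurableSet_Ioi fun y hy => ?_
  have h1 := gammaInt_phase (add_pos hx hy) ht
  rw [gammaInt, integral_mul_const, integral_mul_const] at h1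
  simp only [neg_mul, one_mul, sub_neg_eq_add]
  rw [← h1]; ring

end schwartz

theorem integrableOn_Ioc_of_continuousOn {g : ℝ → ℂ} (hg : ContinuousOn g (Ici 0)) (t : ℝ) :
    IntegrableOn g (Ioc 0 t) :=
  ((hg.mono Icc_subset_Ici_self).integrableOn_Icc).mono_set Ioc_subset_Icc_self

theorem IsRay.integrable_phase_mul_tildeT {ε : ℝ} {d : ℂ} (h : IsRay ε d) {g : ℝ → ℂ}
    (hg : ContinuousOn g (Ici 0)) {x t : ℝ} (hx : 0 < x) (ht : 0 ≤ t) :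
    IntegrableOn (fun r : ℝ => phase x t (r * d) * tildeT g ((r * d) ^ 2) t * (r * d)) (Ioi 0) ∧
    IntervalIntegrable (fun τ => (∫ r : ℝ in Ioi 0, phase x (t - τ) (r * d) * (r * d)) * g τ)
      volume 0 t ∧
    ∫ r : ℝ in Ioi 0, phase x t (r * d) * tildeT g ((r * d) ^ 2) t * (r * d) =
      ∫ τ in (0 : ℝ)..t, (∫ r : ℝ in Ioi 0, phase x (t - τ) (r * d) * (r * d)) * g τ := by
  have hi : Integrable (fun q : ℝ × ℝ => phase x (t - q.2) (q.1 * d) * (g q.2 * (q.1 * d)))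
      ((volume.restrict (Ioi 0)).prod (volume.restrict (Ioc 0 t))) := by
    have hgi := integrableOn_Ioc_of_continuousOn hg t
    refine ((integrableOn_mul_exp_neg_mul (mul_pos inv_sqrt_two_pos hx)).mul_prod hgi.norm).mono'
      ?_ ?_
    · refine AEStronglyMeasurable.mul (Continuous.aestronglyMeasurable (by unfold phase; fun_prop))
        (hgi.aestronglyMeasurable.comp_snd.mul (Continuous.aestronglyMeasurable (by fun_prop)))
    · filter_upwards [ae_prod_fst (ae_restrict_mem measurableSet_Ioi)] with q hq
      rw [norm_mul, norm_mul, norm_mul, h.norm_phase, h.norm, Complex.norm_real,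
        Real.norm_of_nonneg (le_of_lt hq), mul_assoc]
      exact le_of_eq (by ring)
  have key := integrable_phase_mul_tilde (h := fun r τ => g τ * (r * d)) ht hi
  have e1 : ∀ r : ℝ, phase x t (r * d) *
      (∫ τ in (0 : ℝ)..t, Complex.exp ((r * d) ^ 2 * τ) * (g τ * (r * d))) =
      phase x t (r * d) * tildeT g ((r * d) ^ 2) t * (r * d) := by
    intro r
    rw [tildeT, mul_assoc, ← intervalIntegral.integral_mul_const]
    simp only [mul_assoc]
  have e2 : ∀ τ : ℝ, ∫ r : ℝ in Ioi 0, phase x (t - τ) (r * d) * (g τ * (r * d)) =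
      (∫ r : ℝ in Ioi 0, phase x (t - τ) (r * d) * (r * d)) * g τ := by
    intro τ
    rw [← integral_mul_const]
    congr 1; funext r; ring
  simpa only [e1, e2, IntegrableOn] using key

theorem ae_lt_of_Ioc (t : ℝ) : ∀ᵐ τ : ℝ, τ ∈ Ioc 0 t → τ ∈ Ioo 0 t := by
  filter_upwards [Measure.ae_ne volume t] with τ h1 h2
  exact ⟨h2.1, lt_of_le_of_ne h2.2 h1⟩

theorem i1Interior_eq {g : ℝ → ℂ} (hg : ContinuousOn g (Ici 0)) {p : ℝ × ℝ} (hp : p ∈ Q) :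
    i1Interior g p = -Complex.I * timeConv 1 g p := by
  obtain ⟨x, t⟩ := p
  have hx : 0 < x := hp.1
  have ht : 0 < t := hp.2
  obtain ⟨-, i1, e1⟩ := isRay_dirOut.integrable_phase_mul_tildeT hg hx ht.le
  obtain ⟨-, i2, e2⟩ := isRay_dirIn.integrable_phase_mul_tildeT hg hx ht.le
  rw [i1Interior, gammaInt, integral_mul_const, integral_mul_const]
  dsimp only
  rw [e1, e2, ← intervalIntegral.integral_mul_const, ← intervalIntegral.integral_mul_const,
    ← intervalIntegral.integral_sub (i1.mul_const _) (i2.mul_const _), timeConv,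
    ← intervalIntegral.integral_const_mul]
  refine intervalIntegral.integral_congr_ae ?_
  rw [uIoc_of_le ht.le]
  filter_upwards [ae_lt_of_Ioc t] with τ h1 h2
  have h3 := gammaInt_phase_mul hx (sub_pos.2 (h1 h2).2)
  rw [gammaInt, integral_mul_const, integral_mul_const] at h3
  rw [← mul_assoc, ← h3]; ring

section source
variable {f : ℝ × ℝ → ℂ} {M t : ℝ} (hf : Measurable f) (ht : 0 ≤ t)
  (hM : ∀ y τ, 0 < y → 0 ≤ τ → τ ≤ t → (1 + y) ^ 2 * ‖f (y, τ)‖ ≤ M)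
include hf hM

theorem integrableOn_slice {τ : ℝ} (h0 : 0 ≤ τ) (h1 : τ ≤ t) :
    IntegrableOn (fun y => f (y, τ)) (Ioi 0) ∧ ∫ y in Ioi (0 : ℝ), ‖f (y, τ)‖ ≤ M * Real.pi :=
  integrableOn_of_decay (measurable_slice hf τ).aestronglyMeasurable
    fun y hy => hM y τ hy h0 h1

theorem norm_hat_slice_le {τ : ℝ} (h0 : 0 ≤ τ) (h1 : τ ≤ t) {z : ℂ} (hz : z.im ≤ 0) :
    ‖hat (fun y => f (y, τ)) z‖ ≤ M * Real.pi :=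
  (norm_hat_le (integrableOn_slice hf hM h0 h1).1 hz).trans (integrableOn_slice hf hM h0 h1).2

include ht

/-- The integral over the real line. -/
theorem integral_phase_mul_tildeXT {σ : ℝ} (x : ℝ) :
    Integrable (fun z : ℝ => phase x t z * tildeXT f (σ * z) ((z : ℂ) ^ 2) t) ∧
    ∫ z : ℝ, phase x t z * tildeXT f (σ * z) ((z : ℂ) ^ 2) t = duhamel σ f (x, t) := by
  have hi : Integrable (fun q : ℝ × ℝ => phase x (t - q.2) (q.1 * 1) *
      hat (fun y => f (y, q.2)) (σ * q.1)) (volume.prod (volume.restrict (Ioc 0 t))) := by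
    have hm : Measurable fun q : ℝ × ℝ => hat (fun y => f (y, q.2)) (σ * q.1) :=
      measurable_hat_comp hf measurable_snd (by fun_prop)
    have hB : Integrable (fun q : ℝ × ℝ => Real.exp (-(t - q.2) * q.1 ^ 2))
        (volume.prod (volume.restrict (Ioc 0 t))) := by
      refine (integrable_prod_iff' (Continuous.aestronglyMeasurable (by fun_prop))).2 ⟨?_, ?_⟩
      · refine (ae_restrict_iff' measurableSet_Ioc).2 ?_
        filter_upwards [ae_lt_of_Ioc t] with τ h1 h2
        exact integrable_exp_neg_mul_sq (sub_pos.2 (h1 h2).2)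
      · have h1 : IntervalIntegrable (fun τ => √Real.pi * (√(t - τ))⁻¹) volume 0 t := by
          have := ((integral_inv_sqrt ht).1.comp_sub_left t).symm
          rw [sub_zero, sub_self] at this
          exact this.const_mul _
        rw [intervalIntegrable_iff_integrableOn_Ioc_of_le ht] at h1
        refine h1.congr ?_
        filter_upwards with τ
        simp only [Real.norm_eq_abs, Real.abs_exp]
        rw [integral_gaussian, Real.sqrt_div Real.pi_pos.le, div_eq_mul_inv]
    refine (hB.mul_const (M * Real.pi)).mono' (AEStronglyMeasurable.mul
      (Continuous.aestronglyMeasurable (by unfold phase; fun_prop)) hm.aestronglyMeasurable) ?_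
    filter_upwards [ae_prod_snd (ae_restrict_mem measurableSet_Ioc)] with q hq
    rw [norm_mul, mul_one, norm_phase_real]
    refine mul_le_mul_of_nonneg_left (norm_hat_slice_le hf hM hq.1.le hq.2 ?_) (Real.exp_pos _).le
    simp
  obtain ⟨h1, -, h2⟩ := integrable_phase_mul_tilde
    (h := fun r τ => hat (fun y => f (y, τ)) (σ * r)) ht hi
  simp only [mul_one] at h1 h2
  refine ⟨h1, h2.trans ?_⟩
  rw [duhamel]
  refine intervalIntegral.integral_congr_ae ?_
  rw [uIoc_of_le ht]
  filter_upwards [ae_lt_of_Ioc t] with τ h3 h4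
  exact (integral_phase_mul_hat (integrableOn_slice hf hM h4.1.le h4.2).1 σ x
    (sub_pos.2 (h3 h4).2)).2

theorem IsRay.integrable_phase_mul_tildeXT {ε : ℝ} {d : ℂ} (h : IsRay ε d) {x : ℝ} (hx : 0 < x) :
    IntegrableOn (fun r : ℝ => phase x t (r * d) * tildeXT f (-(r * d)) ((r * d) ^ 2) t) (Ioi 0) ∧
    IntervalIntegrable (fun τ => ∫ r : ℝ in Ioi 0, phase x (t - τ) (r * d) *
      hat (fun y => f (y, τ)) (-(r * d))) volume 0 t ∧
    ∫ r : ℝ in Ioi 0, phase x t (r * d) * tildeXT f (-(r * d)) ((r * d) ^ 2) t =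
      ∫ τ in (0 : ℝ)..t, ∫ r : ℝ in Ioi 0, phase x (t - τ) (r * d) *
        hat (fun y => f (y, τ)) (-(r * d)) := by
  have hm : Measurable fun q : ℝ × ℝ => hat (fun y => f (y, q.2)) (-(q.1 * d)) :=
    measurable_hat_comp hf measurable_snd (by fun_prop)
  refine integrable_phase_mul_tilde (h := fun r τ => hat (fun y => f (y, τ)) (-(r * d))) ht ?_
  have hc : IntegrableOn (fun _ : ℝ => M * Real.pi) (Ioc 0 t) := integrableOn_const (by simp)
  refine ((integrableOn_exp_neg_mul (mul_pos inv_sqrt_two_pos hx) 0).mul_prod hc).mono'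
    (AEStronglyMeasurable.mul (Continuous.aestronglyMeasurable (by unfold phase; fun_prop))
      hm.aestronglyMeasurable) ?_
  filter_upwards [ae_prod_fst (ae_restrict_mem measurableSet_Ioi),
    ae_prod_snd (ae_restrict_mem measurableSet_Ioc)] with q h1 h2
  rw [norm_mul, h.norm_phase, mul_assoc]
  refine mul_le_mul_of_nonneg_left (norm_hat_slice_le hf hM h2.1.le h2.2 ?_) (Real.exp_pos _).le
  rw [Complex.neg_im, Complex.im_ofReal_mul, h.im]
  exact neg_nonpos.2 (mul_nonneg (le_of_lt h1) inv_sqrt_two_pos.le)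

/-- The integral over `γ`. -/
theorem gammaInt_phase_mul_tildeXT {x : ℝ} (hx : 0 < x) :
    gammaInt 0 (fun z => phase x t z * tildeXT f (-z) (z ^ 2) t) = duhamel (-1) f (x, t) := by
  obtain ⟨-, i1, e1⟩ := isRay_dirOut.integrable_phase_mul_tildeXT hf ht hM hx
  obtain ⟨-, i2, e2⟩ := isRay_dirIn.integrable_phase_mul_tildeXT hf ht hM hx
  rw [gammaInt, integral_mul_const, integral_mul_const, e1, e2,
    ← intervalIntegral.integral_mul_const, ← intervalIntegral.integral_mul_const,
    ← intervalIntegral.integral_sub (i1.mul_const _) (i2.mul_const _), duhamel]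
  refine intervalIntegral.integral_congr_ae ?_
  rw [uIoc_of_le ht]
  filter_upwards [ae_lt_of_Ioc t] with τ h1 h2
  have h3 := gammaInt_phase_mul_hat (integrableOn_slice hf hM h2.1.le h2.2).1 hx
    (sub_pos.2 (h1 h2).2)
  rwa [gammaInt, integral_mul_const, integral_mul_const] at h3

end source

/-! ### Absolute convergence -/

section schwartz
variable {E : Type*} [AddCommGroup E] [Module ℂ E] [TopologicalSpace E]
  {u : E → ℕ → ℝ → ℂ} (h : SchwartzFamily u)
include h

/-- Integration by parts: `iλ û(λ) = u(0) + û'(λ)` in the closed lower half-plane, applied to the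
`j`-th derivative of `u`. -/
theorem SchwartzFamily.mul_hat (e : E) (j : ℕ) {z : ℂ} (hz : z.im ≤ 0) :
    Complex.I * z * hat (u e j) z = u e j 0 + hat (u e (j + 1)) z := by
  have hE : ∀ y : ℝ, HasDerivAt (fun y : ℝ => Complex.exp (-(Complex.I * z * y)))
      (-(Complex.I * z) * Complex.exp (-(Complex.I * z * y))) y := by
    intro y
    have h1 : HasDerivAt (fun y : ℂ => -(Complex.I * z * y)) (-(Complex.I * z)) (y : ℂ) := by
      convert! ((hasDerivAt_id (y : ℂ)).const_mul (Complex.I * z)).neg using 1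
      simp
    refine h1.cexp.comp_ofReal.congr_deriv ?_
    ring
  have hi : ∀ j, IntegrableOn (fun y : ℝ => Complex.exp (-(Complex.I * z * y)) * u e j y) (Ioi 0) := by
    intro j
    refine Integrable.bdd_mul (c := 1) (h.integrableOn e j)
      (Continuous.aestronglyMeasurable (by fun_prop)) ?_
    filter_upwards [ae_restrict_mem measurableSet_Ioi] with y hy
    exact norm_exp_le_one hz (le_of_lt hy)
  have key := integral_Ioi_of_hasDerivAt_of_tendsto (a := 0) (m := 0)
    (f := fun y : ℝ => Complex.exp (-(Complex.I * z * y)) * u e j y)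
    (f' := fun y : ℝ => -(Complex.I * z) * (Complex.exp (-(Complex.I * z * y)) * u e j y)
      + Complex.exp (-(Complex.I * z * y)) * u e (j + 1) y)
    ((hE 0).continuousAt.continuousWithinAt.mul (h.cont e j 0 self_mem_Ici))
    (fun y hy => ((hE y).mul (h.deriv e j y hy)).congr_deriv (by ring))
    (((hi j).const_mul _).add (hi (j + 1))) (by
      refine squeeze_zero_norm' ?_ (tendsto_zero_iff_norm_tendsto_zero.1 (h.tendsto e j))
      filter_upwards [eventually_gt_atTop 0] with y hy
      rw [norm_mul]
      exact mul_le_of_le_one_left (norm_nonneg _) (norm_exp_le_one hz hy.le))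
  rw [integral_add ((hi j).const_mul _) (hi (j + 1)), integral_const_mul] at key
  simp only [Complex.ofReal_zero, mul_zero, neg_zero, Complex.exp_zero, one_mul, zero_sub] at key
  change -(Complex.I * z) * hat (u e j) z + hat (u e (j + 1)) z = _ at key
  linear_combination -key

theorem SchwartzFamily.measurable_hat (e : E) (j : ℕ) : Measurable (hat (u e j)) :=
  UTM.measurable_hat (h.integrableOn e j).aestronglyMeasurable

/-- By `SchwartzFamily.mul_hat` the transform is `O(|λ|⁻¹)`, so that the quotient is `O(|λ|⁻²)`. -/
theorem SchwartzFamily.integrableOn_hat_div (e : E) (j : ℕ) :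
    IntegrableOn (fun z : ℝ => hat (u e j) z / (Complex.I * z)) (Iio (-1) ∪ Ioi 1) := by
  set A := ‖u e j 0‖ + ∫ y in Ioi (0 : ℝ), ‖u e (j + 1) y‖ with hA
  have hA0 : 0 ≤ A := by positivity
  have hm : Measurable fun z : ℝ => hat (u e j) z / (Complex.I * z) :=
    ((h.measurable_hat e j).comp Complex.measurable_ofReal).div (by fun_prop)
  refine (integrable_inv_one_add_sq.const_mul (2 * A)).integrableOn.mono' hm.aestronglyMeasurable ?_
  filter_upwards [ae_restrict_mem (measurableSet_Iio.union measurableSet_Ioi)] with z hz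
  have hz1 : 1 < z ^ 2 := by
    rcases hz with hz | hz
    · have hz : z < -1 := hz
      nlinarith
    · have hz : 1 < z := hz
      nlinarith
  have hz0 : (z : ℂ) ≠ 0 := by
    rw [Complex.ofReal_ne_zero]; rintro rfl; norm_num at hz1
  have e1 : hat (u e j) z / (Complex.I * z) =
      -(u e j 0 + hat (u e (j + 1)) z) / (z : ℂ) ^ 2 := by
    rw [← h.mul_hat e j (by simp)]
    field_simp
    rw [Complex.I_sq]; ring
  rw [e1, norm_div, norm_neg, norm_pow, Complex.norm_real, Real.norm_eq_abs, sq_abs]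
  have e2 : ‖u e j 0 + hat (u e (j + 1)) z‖ ≤ A :=
    (norm_add_le _ _).trans
      (add_le_add le_rfl (norm_hat_le (h.integrableOn e (j + 1)) (by simp)))
  calc ‖u e j 0 + hat (u e (j + 1)) z‖ / z ^ 2 ≤ A / z ^ 2 := by gcongr
    _ ≤ 2 * A * (1 + z ^ 2)⁻¹ := by
      rw [← div_eq_mul_inv, div_le_div_iff₀ (by positivity) (by positivity)]
      nlinarith

end schwartz

theorem norm_exp_mul_real (x z : ℝ) : ‖Complex.exp (Complex.I * z * x)‖ = 1 := by
  rw [← phase_zero_right, norm_phase_real]; simp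

theorem aestronglyMeasurable_exp_mul (x : ℝ) (μ : Measure ℝ) :
    AEStronglyMeasurable (fun z : ℝ => Complex.exp (Complex.I * z * x)) μ :=
  Continuous.aestronglyMeasurable (by fun_prop)

theorem integrableOn_hat {u : ℝ → ℂ} (hu : IntegrableOn u (Ioi 0)) {s : Set ℝ}
    (hs : volume s ≠ ⊤) : IntegrableOn (fun z : ℝ => hat u z) s := by
  refine (integrableOn_const (C := ∫ y in Ioi (0 : ℝ), ‖u y‖) hs).mono'
    ((measurable_hat hu.aestronglyMeasurable).comp Complex.measurable_ofReal).aestronglyMeasurable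
    (ae_of_all _ fun z => norm_hat_le hu (by simp))

theorem i0plusConverges (u : SchwartzHalfLine) : I0plusConverges u.fn := by
  have hu := schwartzFamily_d.integrableOn u 0
  refine ⟨fun x t _ ht => ?_, fun x hx => ⟨?_, ?_, ?_⟩⟩
  · rw [u.d_zero] at hu
    simpa using (integral_phase_mul_hat hu 1 x ht).1
  · rw [intervalIntegrable_iff_integrableOn_Ioc_of_le (by norm_num)]
    rw [u.d_zero] at hu
    exact Integrable.bdd_mul (c := 1) (integrableOn_hat hu (by simp))
      (aestronglyMeasurable_exp_mul x _) (ae_of_all _ fun z => (norm_exp_mul_real x z).le)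
  · simp only [← phase_zero_right]
    exact ⟨isRay_dirOut.integrableOn_phase_div hx 0, isRay_dirIn.integrableOn_phase_div hx 0⟩
  · rw [← u.d_one]
    exact Integrable.bdd_mul (c := 1) (schwartzFamily_d.integrableOn_hat_div u 1)
      (aestronglyMeasurable_exp_mul x _) (ae_of_all _ fun z => (norm_exp_mul_real x z).le)

theorem i0minusConverges (u : SchwartzHalfLine) : I0minusConverges u.fn := by
  have hu := schwartzFamily_d.integrableOn u 0
  rw [u.d_zero] at hu
  have h1 : ∀ x t : ℝ, 0 < t → (Integrable fun z : ℝ => phase x t z * hat u.fn (-z)) ∧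
      ∫ z : ℝ, phase x t z * hat u.fn (-z) = halfConv (-1) 0 u.fn (x, t) :=
    fun x t ht => by simpa using integral_phase_mul_hat hu (-1) x ht
  exact ⟨fun x t hx _ => ⟨(isRay_dirOut.integrable_phase_mul_hat hu hx t).1,
      (isRay_dirIn.integrable_phase_mul_hat hu hx t).1⟩, fun x t _ ht => (h1 x t ht).1,
    fun x t hx ht => (gammaInt_phase_mul_hat hu hx ht).trans (h1 x t ht).2.symm⟩

theorem i1Converges (g : SmoothHalfLine) : I1Converges g.fn := by
  intro x t hx ht
  have hg := smoothFamily_d.cont g 0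
  rw [g.d_zero] at hg
  exact ⟨(isRay_dirOut.integrable_phase_mul_tildeT hg hx ht).1,
    (isRay_dirIn.integrable_phase_mul_tildeT hg hx ht).1⟩

theorem measurable_tildeXT {f : ℝ × ℝ → ℂ} (hf : Measurable f) (t : ℝ) {Z W : ℝ → ℂ}
    (hZ : Measurable Z) (hW : Measurable W) (ht : 0 ≤ t) :
    Measurable fun r : ℝ => tildeXT f (Z r) (W r) t := by
  have h1 : Measurable fun q : ℝ × ℝ =>
      Complex.exp (W q.1 * q.2) * hat (fun y => f (y, q.2)) (Z q.1) := by
    have hW' : Measurable fun q : ℝ × ℝ => W q.1 := hW.comp measurable_fst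
    refine Measurable.mul (by fun_prop) ?_
    exact measurable_hat_comp hf measurable_snd (hZ.comp measurable_fst)
  simp only [tildeXT, intervalIntegral.integral_of_le ht]
  exact (h1.stronglyMeasurable.integral_prod_right' (ν := volume.restrict (Ioc 0 t))).measurable

section source
variable {E : Type*} [AddCommGroup E] [Module ℂ E] [TopologicalSpace E]
  {F : E → ℕ → ℕ → ℝ × ℝ → ℂ} (h : SourceFamily F)
include h

/-- An integration by parts in time shows that the integrand of `I_2^-` is `O(|λ|⁻²)` along the
rays of `γ`, uniformly up to the edge `x = 0`. -/
theorem SourceFamily.norm_phase_mul_tildeXT_le (e : E) {t : ℝ} (ht : 0 ≤ t) :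
    ∃ C, ∀ (ε : ℝ) (d : ℂ), IsRay ε d → ∀ x r : ℝ, 0 ≤ x → 0 < r →
      ‖phase x t (r * d) * tildeXT (F e 0 0) (-(r * d)) ((r * d) ^ 2) t‖ ≤ C * (1 + r ^ 2)⁻¹ := by
  obtain ⟨M, hM, hM'⟩ := h.decay e 0 0 0 1 t
  have hM0 := fun y τ (hy : 0 < y) => hM y τ hy.le
  have hM1 := fun y τ (hy : 0 < y) => hM' y τ hy.le
  have hB : 0 ≤ M * Real.pi :=
    mul_nonneg ((by positivity : (0 : ℝ) ≤ _).trans (hM 1 0 zero_le_one le_rfl ht)) Real.pi_pos.le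
  refine ⟨M * Real.pi * (2 + 2 * t), fun ε d hd x r hx hr => ?_⟩
  set z : ℂ := r * d with hz
  have him : (-z).im ≤ 0 := by
    rw [hz, Complex.neg_im, Complex.im_ofReal_mul, hd.im]
    exact neg_nonpos.2 (mul_nonneg hr.le inv_sqrt_two_pos.le)
  have hre : (z ^ 2).re = 0 := by
    rw [hz, pow_two, Complex.mul_re, Complex.re_ofReal_mul, Complex.im_ofReal_mul, hd.re, hd.im]
    linear_combination (r * (√2)⁻¹) ^ 2 * hd.sq_eq
  -- `λ²` is imaginary on the rays, so that `exp (λ² τ)` is only oscillating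
  have hexp : ∀ τ : ℝ, ‖Complex.exp (z ^ 2 * τ)‖ = 1 := by
    intro τ
    rw [Complex.norm_exp, Complex.re_mul_ofReal, hre, zero_mul, Real.exp_zero]
  set H : ℕ → ℝ → ℂ := fun b τ => hat (fun y => F e 0 b (y, τ)) (-z) with hH
  have hcm : AEStronglyMeasurable (fun y : ℝ => Complex.exp (-(Complex.I * -z * y)))
      (volume.restrict (Ioi 0)) := Continuous.aestronglyMeasurable (by fun_prop)
  have hcb : ∀ y : ℝ, 0 < y → ‖Complex.exp (-(Complex.I * -z * y))‖ ≤ 1 :=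
    fun y hy => norm_exp_le_one him hy.le
  have c0 : ContinuousOn (H 0) (Icc 0 t) := continuousOn_slice_integral hcm hcb (h.meas e 0 0) hM0
    fun y hy => h.cont_t e 0 0 hy.le
  have c1 : ContinuousOn (H 1) (Icc 0 t) := continuousOn_slice_integral hcm hcb (h.meas e 0 1) hM1
    fun y hy => h.cont_t e 0 1 hy.le
  have hd1 : ∀ τ ∈ Ioo 0 t, HasDerivAt (H 0) (H 1 τ) τ := fun τ hτ =>
    hasDerivAt_slice_integral hcm hcb (h.meas e 0 0) (h.meas e 0 1) hM0 hM1
      (fun y τ hy hτ => h.deriv_t e 0 0 y τ hy.le hτ) hτ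
  have b0 : ∀ τ ∈ Icc 0 t, ‖H 0 τ‖ ≤ M * Real.pi := fun τ hτ =>
    norm_hat_slice_le (h.meas e 0 0) hM0 hτ.1 hτ.2 him
  have b1 : ∀ τ ∈ Icc 0 t, ‖H 1 τ‖ ≤ M * Real.pi := fun τ hτ =>
    norm_hat_slice_le (h.meas e 0 1) hM1 hτ.1 hτ.2 him
  have hE : ∀ τ : ℝ, HasDerivAt (fun τ : ℝ => Complex.exp (z ^ 2 * τ))
      (z ^ 2 * Complex.exp (z ^ 2 * τ)) τ := by
    intro τ
    have h1 : HasDerivAt (fun y : ℂ => z ^ 2 * y) (z ^ 2) (τ : ℂ) := by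
      simpa using (hasDerivAt_id (τ : ℂ)).const_mul (z ^ 2)
    refine h1.cexp.comp_ofReal.congr_deriv ?_
    ring
  have hEc : Continuous fun τ : ℝ => Complex.exp (z ^ 2 * τ) := by fun_prop
  have ii : ∀ b, ContinuousOn (H b) (Icc 0 t) →
      IntervalIntegrable (fun τ => Complex.exp (z ^ 2 * τ) * H b τ) volume 0 t := by
    intro b hb
    refine ContinuousOn.intervalIntegrable ?_
    rw [uIcc_of_le ht]
    exact hEc.continuousOn.mul hb
  -- `z ^ 2 * J` consists of two boundary terms and an integral with the `τ`-derivative of the source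
  have key := intervalIntegral.integral_eq_sub_of_hasDerivAt_of_le ht
    (f := fun τ => Complex.exp (z ^ 2 * τ) * H 0 τ)
    (f' := fun τ => z ^ 2 * (Complex.exp (z ^ 2 * τ) * H 0 τ) + Complex.exp (z ^ 2 * τ) * H 1 τ)
    (hEc.continuousOn.mul c0)
    (fun τ hτ => ((hE τ).mul (hd1 τ hτ)).congr_deriv (by ring))
    (((ii 0 c0).const_mul _).add (ii 1 c1))
  rw [intervalIntegral.integral_add ((ii 0 c0).const_mul _) (ii 1 c1),
    intervalIntegral.integral_const_mul] at key
  have nb : ∀ b, (∀ τ ∈ Icc 0 t, ‖H b τ‖ ≤ M * Real.pi) →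
      ‖∫ τ in (0 : ℝ)..t, Complex.exp (z ^ 2 * τ) * H b τ‖ ≤ M * Real.pi * t := by
    intro b hb
    have := intervalIntegral.norm_integral_le_of_norm_le_const (a := 0) (b := t)
      (f := fun τ : ℝ => Complex.exp (z ^ 2 * τ) * H b τ) (C := M * Real.pi) (by
        intro τ hτ
        rw [uIoc_of_le ht] at hτ
        rw [norm_mul, hexp, one_mul]
        exact hb τ ⟨hτ.1.le, hτ.2⟩)
    rwa [sub_zero, abs_of_nonneg ht] at this
  set J := ∫ τ in (0 : ℝ)..t, Complex.exp (z ^ 2 * τ) * H 0 τ with hJ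
  have e1 : ‖J‖ ≤ M * Real.pi * t := nb 0 b0
  have e2 : ‖z ^ 2 * J‖ ≤ M * Real.pi * (2 + t) := by
    rw [eq_sub_of_add_eq key]
    refine (norm_sub_le _ _).trans ?_
    have t1 : ‖Complex.exp (z ^ 2 * t) * H 0 t - Complex.exp (z ^ 2 * (0 : ℝ)) * H 0 0‖ ≤
        M * Real.pi + M * Real.pi := by
      refine (norm_sub_le _ _).trans (add_le_add ?_ ?_)
      · rw [norm_mul, hexp, one_mul]; exact b0 t ⟨ht, le_rfl⟩
      · rw [norm_mul, hexp, one_mul]; exact b0 0 ⟨le_rfl, ht⟩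
    have t2 := nb 1 b1
    linarith
  have hzn : ‖z ^ 2‖ = r ^ 2 := by
    rw [norm_pow, hz, norm_mul, hd.norm, mul_one, Complex.norm_real, Real.norm_eq_abs, sq_abs]
  rw [norm_mul, hzn] at e2
  have e3 : ‖phase x t z‖ ≤ 1 := by
    rw [hz, hd.norm_phase]
    exact Real.exp_le_one_iff.2 (neg_nonpos.2 (by positivity))
  change ‖phase x t z * J‖ ≤ _
  rw [norm_mul, ← div_eq_mul_inv, le_div_iff₀ (by positivity)]
  have e4 : ‖phase x t z‖ * ‖J‖ ≤ ‖J‖ := mul_le_of_le_one_left (norm_nonneg _) e3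
  calc ‖phase x t z‖ * ‖J‖ * (1 + r ^ 2) ≤ ‖J‖ * (1 + r ^ 2) := by gcongr
    _ = ‖J‖ + r ^ 2 * ‖J‖ := by ring
    _ ≤ _ := by linarith

theorem SourceFamily.decay_zero (e : E) (t : ℝ) : ∃ M, ∀ y τ, 0 < y → 0 ≤ τ → τ ≤ t →
    (1 + y) ^ 2 * ‖F e 0 0 (y, τ)‖ ≤ M := by
  obtain ⟨M, hM, -⟩ := h.decay e 0 0 0 0 t
  exact ⟨M, fun y τ hy => hM y τ hy.le⟩

theorem SourceFamily.integrableOn_phase_mul_tildeXT (e : E) {ε : ℝ} {d : ℂ} (hd : IsRay ε d)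
    {x t : ℝ} (hx : 0 ≤ x) (ht : 0 ≤ t) : IntegrableOn (fun r : ℝ =>
      phase x t (r * d) * tildeXT (F e 0 0) (-(r * d)) ((r * d) ^ 2) t) (Ioi 0) := by
  obtain ⟨C, hC⟩ := h.norm_phase_mul_tildeXT_le e ht
  refine (integrable_inv_one_add_sq.const_mul C).integrableOn.mono'
    (AEStronglyMeasurable.mul (Continuous.aestronglyMeasurable (by unfold phase; fun_prop))
      (measurable_tildeXT (h.meas e 0 0) t (by fun_prop) (by fun_prop) ht).aestronglyMeasurable) ?_
  filter_upwards [ae_restrict_mem measurableSet_Ioi] with r hr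
  exact hC ε d hd x r hx hr

end source

theorem i2Converges (f : S1 closedQuarter) : I2Converges f.fn := by
  rintro ⟨x, t⟩ hp
  have hx : 0 ≤ x := hp.1.1
  have ht : 0 ≤ t := hp.1.2
  obtain ⟨M, hM⟩ := sourceFamily_d.decay_zero f t
  have h1 := (integral_phase_mul_tildeXT (sourceFamily_d.meas f 0 0) ht hM (σ := 1) x).1
  have h2 := sourceFamily_d.integrableOn_phase_mul_tildeXT f isRay_dirOut hx ht
  have h3 := sourceFamily_d.integrableOn_phase_mul_tildeXT f isRay_dirIn hx ht
  rw [f.d_zero] at h1 h2 h3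
  exact ⟨by simpa using h1, h2, h3⟩

/-! ### Boundary values -/

/-- Dominated convergence for the integrals in question, along a path `(X s, T s)` as `s → 0`; the
contour is parametrized by `Z`. -/
theorem tendsto_integral_phase {μ : Measure ℝ} {Z w : ℝ → ℂ} (hZ : Continuous Z)
    (hw : AEStronglyMeasurable w μ) {B : ℝ → ℝ} (hB : Integrable B μ) {X T : ℝ → ℝ} {x t : ℝ}
    (hX : Tendsto X (𝓝[>] 0) (𝓝 x)) (hT : Tendsto T (𝓝[>] 0) (𝓝 t))
    (hb : ∀ s, 0 < s → ∀ᵐ r ∂μ, ‖phase (X s) (T s) (Z r) * w r‖ ≤ B r) :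
    Tendsto (fun s => ∫ r, phase (X s) (T s) (Z r) * w r ∂μ) (𝓝[>] 0)
      (𝓝 (∫ r, phase x t (Z r) * w r ∂μ)) := by
  refine tendsto_integral_filter_of_dominated_convergence B (Eventually.of_forall fun s => ?_) ?_ hB
    (ae_of_all _ fun r => ?_)
  · exact (Continuous.aestronglyMeasurable (by unfold phase; fun_prop)).mul hw
  · filter_upwards [self_mem_nhdsWithin] with s hs using hb s hs
  · exact ((continuous_phase.tendsto ((x, t), Z r)).comp
      ((hX.prodMk_nhds hT).prodMk_nhds tendsto_const_nhds)).mul_const _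

theorem tendsto_id_nhdsGT : Tendsto (fun s : ℝ => s) (𝓝[>] 0) (𝓝 0) :=
  tendsto_id.mono_left nhdsWithin_le_nhds

/-- The limit at a boundary point, known to exist, may be computed along a path normal to the
edge. -/
theorem tendsto_value {E : Type*} [AddCommGroup E] [Module ℂ E] [TopologicalSpace E]
    {T : E → ℝ × ℝ → ℂ} (hT : ControlledUpTo 1 T) {e : E} {h : ℝ × ℝ → ℂ} (hQ : EqOn h (T e) Q)
    (left : ∀ t, 0 < t → Tendsto (fun s => h (s, t)) (𝓝[>] 0) (𝓝 (h (0, t))))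
    (bottom : ∀ x, 0 < x → Tendsto (fun s => h (x, s)) (𝓝[>] 0) (𝓝 (h (x, 0)))) :
    ∀ p ∈ Qpunct, Tendsto h (𝓝[Q] p) (𝓝 (h p)) := by
  rintro ⟨x, t⟩ hp
  obtain ⟨c, hc⟩ := hT.exists_limit e hp
  have hc' : Tendsto h (𝓝[Q] (x, t)) (𝓝 c) :=
    hc.congr' (hQ.symm.eventuallyEq_of_mem self_mem_nhdsWithin)
  have hx : 0 ≤ x := hp.1.1
  have ht : 0 ≤ t := hp.1.2
  suffices c = h (x, t) by rwa [← this]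
  have path : ∀ P : ℝ → ℝ × ℝ, Tendsto P (𝓝[>] 0) (𝓝 (x, t)) → (∀ s, 0 < s → P s ∈ Q) →
      Tendsto (fun s => h (P s)) (𝓝[>] 0) (𝓝 (h (x, t))) → c = h (x, t) := by
    intro P h1 h2 h3
    refine tendsto_nhds_unique (hc'.comp (tendsto_nhdsWithin_iff.2 ⟨h1, ?_⟩)) h3
    filter_upwards [self_mem_nhdsWithin] with s hs using h2 s hs
  rcases hx.eq_or_lt with rfl | hx
  · have ht : 0 < t := ht.lt_of_ne fun h0 => hp.2 (by rw [← h0]; rfl)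
    exact path (fun s => (s, t)) (tendsto_id_nhdsGT.prodMk_nhds tendsto_const_nhds)
      (fun s hs => ⟨hs, ht⟩) (left t ht)
  rcases ht.eq_or_lt with rfl | ht
  · exact path (fun s => (x, s)) (tendsto_const_nhds.prodMk_nhds tendsto_id_nhdsGT)
      (fun s hs => ⟨hx, hs⟩) (bottom x hx)
  · have h1 : Tendsto h (pure (x, t)) (𝓝 c) := hc'.mono_left (pure_le_nhdsWithin ⟨hx, ht⟩)
    exact tendsto_nhds_unique h1 (tendsto_pure_nhds _ _)

theorem Qpunct_of_pos_right {x t : ℝ} (hx : 0 ≤ x) (ht : 0 < t) : (x, t) ∈ Qpunct :=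
  ⟨⟨hx, ht.le⟩, fun h => ht.ne' (congrArg Prod.snd h)⟩

theorem Qpunct_of_pos_left {x t : ℝ} (hx : 0 < x) (ht : 0 ≤ t) : (x, t) ∈ Qpunct :=
  ⟨⟨hx.le, ht⟩, fun h => hx.ne' (congrArg Prod.fst h)⟩

theorem i0plus_of_pos {u : ℝ → ℂ} (hu : IntegrableOn u (Ioi 0)) {x t : ℝ} (hx : 0 ≤ x)
    (ht : 0 < t) : i0plus u (x, t) = halfConv 1 0 u (x, t) := by
  rw [i0plus, indicator_of_mem (Qpunct_of_pos_right hx ht), if_pos ht]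
  simpa using (integral_phase_mul_hat hu 1 x ht).2

theorem i0minus_of_pos {u : ℝ → ℂ} (hu : IntegrableOn u (Ioi 0)) {x t : ℝ} (hx : 0 ≤ x)
    (ht : 0 < t) : i0minus u (x, t) = halfConv (-1) 0 u (x, t) := by
  rw [i0minus, indicator_of_mem (Qpunct_of_pos_right hx ht)]
  split_ifs with h
  · exact gammaInt_phase_mul_hat hu h ht
  · simpa using (integral_phase_mul_hat hu (-1) x ht).2

theorem tendsto_halfConv_left (σ : ℝ) {u : ℝ → ℂ} (hu : IntegrableOn u (Ioi 0)) {t : ℝ}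
    (ht : 0 < t) : Tendsto (fun s => halfConv σ 0 u (s, t)) (𝓝[>] 0) (𝓝 (halfConv σ 0 u (0, t))) :=
  (hasDerivAt_halfConv_x σ 0 hu 0 ht).continuousAt.tendsto.mono_left nhdsWithin_le_nhds

theorem tendsto_i0plus_left {u : ℝ → ℂ} (hu : IntegrableOn u (Ioi 0)) {t : ℝ} (ht : 0 < t) :
    Tendsto (fun s => i0plus u (s, t)) (𝓝[>] 0) (𝓝 (i0plus u (0, t))) := by
  rw [i0plus_of_pos hu le_rfl ht]
  refine (tendsto_halfConv_left 1 hu ht).congr' ?_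
  filter_upwards [self_mem_nhdsWithin] with s hs
  exact (i0plus_of_pos hu (le_of_lt hs) ht).symm

theorem tendsto_i0minus_left {u : ℝ → ℂ} (hu : IntegrableOn u (Ioi 0)) {t : ℝ} (ht : 0 < t) :
    Tendsto (fun s => i0minus u (s, t)) (𝓝[>] 0) (𝓝 (i0minus u (0, t))) := by
  rw [i0minus_of_pos hu le_rfl ht]
  refine (tendsto_halfConv_left (-1) hu ht).congr' ?_
  filter_upwards [self_mem_nhdsWithin] with s hs
  exact (i0minus_of_pos hu (le_of_lt hs) ht).symm

theorem tendsto_i0minus_bottom {u : ℝ → ℂ} (hu : IntegrableOn u (Ioi 0)) {x : ℝ} (hx : 0 < x) :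
    Tendsto (fun s => i0minus u (x, s)) (𝓝[>] 0) (𝓝 (i0minus u (x, 0))) := by
  have e : ∀ t, 0 ≤ t → i0minus u (x, t) = gammaInt 0 (fun z => phase x t z * hat u (-z)) := by
    intro t ht
    rw [i0minus, indicator_of_mem (Qpunct_of_pos_left hx ht), if_pos hx]
  have key : ∀ (ε : ℝ) (d : ℂ), IsRay ε d → Tendsto
      (fun s : ℝ => ∫ r : ℝ in Ioi 0, phase x s (r * d) * hat u (-(r * d)) * d) (𝓝[>] 0)
      (𝓝 (∫ r : ℝ in Ioi 0, phase x 0 (r * d) * hat u (-(r * d)) * d)) := by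
    intro ε d h
    simp only [integral_mul_const]
    refine Tendsto.mul_const _ (tendsto_integral_phase
      (B := fun r => Real.exp (-(r * ((√2)⁻¹ * x))) * ∫ y in Ioi (0 : ℝ), ‖u y‖) (by fun_prop)
      ((measurable_hat hu.aestronglyMeasurable).comp (by fun_prop)).aestronglyMeasurable
      ((integrableOn_exp_neg_mul (mul_pos inv_sqrt_two_pos hx) 0).mul_const _) tendsto_const_nhds
      tendsto_id_nhdsGT fun s hs => ?_)
    filter_upwards [ae_restrict_mem measurableSet_Ioi] with r hr
    rw [norm_mul, h.norm_phase, mul_assoc]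
    refine mul_le_mul_of_nonneg_left (norm_hat_le hu ?_) (Real.exp_pos _).le
    rw [Complex.neg_im, Complex.im_ofReal_mul, h.im]
    exact neg_nonpos.2 (mul_nonneg (le_of_lt hr) inv_sqrt_two_pos.le)
  rw [e 0 le_rfl]
  refine ((key _ _ isRay_dirOut).sub (key _ _ isRay_dirIn)).congr' ?_
  filter_upwards [self_mem_nhdsWithin] with s hs
  exact (e s (le_of_lt hs)).symm

/-- The integral over the real line, regularized near infinity and with the part that corresponds to
the corner value `u(0)` moved to `γ^*`. -/
def regularizedIntegral (u u' : ℝ → ℂ) (x t : ℝ) : ℂ :=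
  (∫ z in (-1 : ℝ)..1, phase x t z * hat u z)
    + u 0 * gammaStarInt (fun z => phase x t z / (Complex.I * z))
    + ((∫ z in Iio (-1 : ℝ), phase x t z * (hat u' z / (Complex.I * z)))
      + ∫ z in Ioi (1 : ℝ), phase x t z * (hat u' z / (Complex.I * z)))

theorem norm_phase_real_le_one {x t : ℝ} (ht : 0 ≤ t) (z : ℝ) : ‖phase x t z‖ ≤ 1 := by
  rw [norm_phase_real]
  exact Real.exp_le_one_iff.2 (by nlinarith [mul_nonneg ht (sq_nonneg z)])

/-- The hypotheses on `a` and `b` describe the two vertical segments of `γ^*`, on which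
`|Re λ| = 1` and `0 ≤ Im λ ≤ 1`. -/
theorem tendsto_segInt_phase_div {a b : ℂ} (hab : ‖b - a‖ ≤ 1)
    (hz : ∀ s : ℝ, 0 < s → s ≤ 1 → (a + s * (b - a)).re ^ 2 = 1 ∧ 0 ≤ (a + s * (b - a)).im ∧
      (a + s * (b - a)).im ≤ 1) {x : ℝ} (hx : 0 < x) :
    Tendsto (fun t => segInt a b fun z => phase x t z / (Complex.I * z)) (𝓝[>] 0)
      (𝓝 (segInt a b fun z => phase x 0 z / (Complex.I * z))) := by
  simp only [segInt, intervalIntegral.integral_of_le zero_le_one, div_mul_eq_mul_div, mul_div_assoc]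
  refine tendsto_integral_phase (Z := fun s : ℝ => a + s * (b - a))
    (w := fun s : ℝ => (b - a) / (Complex.I * (a + s * (b - a)))) (B := fun _ => 1) (by fun_prop)
    (Measurable.aestronglyMeasurable (measurable_const.div (by fun_prop)))
    (integrableOn_const (by simp)) tendsto_const_nhds tendsto_id_nhdsGT fun t ht => ?_
  filter_upwards [ae_restrict_mem measurableSet_Ioc] with s hs
  obtain ⟨h1, h2, h3⟩ := hz s hs.1 hs.2
  have hn : 1 ≤ ‖a + s * (b - a)‖ := by
    rw [← one_le_sq_iff₀ (norm_nonneg _), ← Complex.normSq_eq_norm_sq, Complex.normSq_apply]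
    nlinarith
  have hp : ‖phase x t (a + s * (b - a))‖ ≤ 1 := by
    rw [norm_phase]
    refine Real.exp_le_one_iff.2 ?_
    rw [h1]
    have := mul_nonneg h2 hx.le
    have h4 : 0 ≤ 1 - (a + s * (b - a)).im ^ 2 := by nlinarith
    have := mul_nonneg h4 ht.le
    linarith
  rw [norm_mul, norm_div, norm_mul, Complex.norm_I, one_mul]
  exact mul_le_one₀ hp (by positivity) (div_le_one_of_le₀ (hab.trans hn) (norm_nonneg _))

section schwartz
variable {E : Type*} [AddCommGroup E] [Module ℂ E] [TopologicalSpace E]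
  {u : E → ℕ → ℝ → ℂ} (h : SchwartzFamily u)
include h

/-- For `t > 0` the regularization does not change the integral: for `|λ| > 1` it replaces `û(λ)` by
`(u(0) + û'(λ)) / (iλ)`. -/
theorem SchwartzFamily.regularizedIntegral_eq (e : E) {x t : ℝ} (hx : 0 < x) (ht : 0 < t) :
    regularizedIntegral (u e 0) (u e 1) x t = ∫ z : ℝ, phase x t z * hat (u e 0) z := by
  have hi : Integrable fun z : ℝ => phase x t z * hat (u e 0) z := by
    simpa using (integral_phase_mul_hat (h.integrableOn e 0) 1 x ht).1
  have hd := (h.integrableOn_hat_div e 1).bdd_mul (c := 1)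
    ((integrable_phase x ht).aestronglyMeasurable.restrict)
    (ae_of_all _ fun z => norm_phase_real_le_one (x := x) ht.le z)
  have hp : IntegrableOn (fun z : ℝ => u e 0 0 * (phase x t z / (Complex.I * z)))
      (Iio (-1) ∪ Ioi 1) := by
    refine Integrable.const_mul ?_ _
    have hm : Measurable fun z : ℝ => phase x t z / (Complex.I * z) := by
      simpa using measurable_phase_div x t 1
    refine (integrable_phase x ht).norm.integrableOn.mono'
      hm.aestronglyMeasurable ?_
    filter_upwards [ae_restrict_mem (measurableSet_Iio.union measurableSet_Ioi)] with z hz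
    refine norm_phase_div_le x t ?_
    rw [Complex.norm_real, Real.norm_eq_abs, le_abs]
    rcases hz with hz | hz
    · exact Or.inr (by linarith [show z < -1 from hz])
    · exact Or.inl (le_of_lt hz)
  have es : ∀ s : Set ℝ, MeasurableSet s → s ⊆ Iio (-1) ∪ Ioi 1 →
      ∫ z : ℝ in s, phase x t z * hat (u e 0) z = u e 0 0 * (∫ z : ℝ in s, phase x t z / (Complex.I * z))
        + ∫ z : ℝ in s, phase x t z * (hat (u e 1) z / (Complex.I * z)) := by
    intro s hs hsub
    rw [← integral_const_mul, ← integral_add (hp.mono_set hsub) (IntegrableOn.mono_set hd hsub)]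
    refine setIntegral_congr_fun hs fun z hz => ?_
    have hz0 : (z : ℂ) ≠ 0 := by
      rw [Complex.ofReal_ne_zero]
      rintro rfl
      rcases hsub hz with h0 | h0
      · exact absurd (show (0 : ℝ) < -1 from h0) (by norm_num)
      · exact absurd (show (1 : ℝ) < 0 from h0) (by norm_num)
    have := h.mul_hat e 0 (z := (z : ℂ)) (by simp)
    have hI := Complex.I_ne_zero
    field_simp
    linear_combination phase x t z * this
  rw [regularizedIntegral, ← integral_phase_div hx ht,
    ← intervalIntegral.integral_Iic_add_Ioi (b := 1) hi.integrableOn hi.integrableOn,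
    ← intervalIntegral.integral_Iic_sub_Iic (a := -1) hi.integrableOn hi.integrableOn,
    integral_Iic_eq_integral_Iio (x := -1), es _ measurableSet_Iio subset_union_left,
    es _ measurableSet_Ioi subset_union_right]
  ring

/-- Each integral in the regularization converges absolutely at `t = 0` as well: on the rays the
factor `e^{iλx}` decays, and for real `|λ| > 1` the quotient `û'(λ)/(iλ)` is integrable. -/
theorem SchwartzFamily.tendsto_regularizedIntegral (e : E) {x : ℝ} (hx : 0 < x) :
    Tendsto (regularizedIntegral (u e 0) (u e 1) x) (𝓝[>] 0)
      (𝓝 (regularizedIntegral (u e 0) (u e 1) x 0)) := by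
  have line : ∀ (s : Set ℝ) (w : ℝ → ℂ), IntegrableOn w s →
      Tendsto (fun t => ∫ z : ℝ in s, phase x t z * w z) (𝓝[>] 0)
        (𝓝 (∫ z : ℝ in s, phase x 0 z * w z)) := by
    intro s w hw
    refine tendsto_integral_phase (by fun_prop) hw.aestronglyMeasurable hw.norm tendsto_const_nhds
      tendsto_id_nhdsGT fun t ht => ae_of_all _ fun z => ?_
    rw [norm_mul]
    exact mul_le_of_le_one_left (norm_nonneg _) (norm_phase_real_le_one ht.le z)
  have ray : ∀ (ε : ℝ) (d : ℂ), IsRay ε d → Tendsto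
      (fun t : ℝ => ∫ r : ℝ in Ioi √2, phase x t (r * d) / (Complex.I * (r * d)) * d) (𝓝[>] 0)
      (𝓝 (∫ r : ℝ in Ioi √2, phase x 0 (r * d) / (Complex.I * (r * d)) * d)) := by
    intro ε d hd
    simp only [div_mul_eq_mul_div, mul_div_assoc]
    refine tendsto_integral_phase
      (B := fun r : ℝ => Real.exp (-(r * ((√2)⁻¹ * x))))
      (w := fun r : ℝ => d / (Complex.I * (r * d))) (by fun_prop)
      (Measurable.aestronglyMeasurable (measurable_const.div (by fun_prop)))
      (integrableOn_exp_neg_mul (mul_pos inv_sqrt_two_pos hx) _) tendsto_const_nhds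
      tendsto_id_nhdsGT fun t ht => ?_
    filter_upwards [ae_restrict_mem measurableSet_Ioi] with r hr
    have hr : 1 < r := lt_trans Real.one_lt_sqrt_two hr
    rw [norm_mul, hd.norm_phase, norm_div, norm_mul, norm_mul, hd.norm, Complex.norm_I, one_mul,
      mul_one, Complex.norm_real, Real.norm_of_nonneg (by linarith), mul_assoc]
    exact mul_le_of_le_one_right (Real.exp_pos _).le ((div_le_one (by linarith)).2 hr.le)
  have hdiv := h.integrableOn_hat_div e 1
  unfold regularizedIntegral gammaStarInt gammaInt
  simp only [intervalIntegral.integral_of_le (show (-1 : ℝ) ≤ 1 by norm_num)]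
  refine ((line _ _ (integrableOn_hat (h.integrableOn e 0) (by simp))).add
    (((((ray _ _ isRay_dirOut).sub (ray _ _ isRay_dirIn)).add
      (tendsto_segInt_phase_div ?_ ?_ hx)).add (tendsto_segInt_phase_div ?_ ?_ hx)).const_mul _)).add
    ((line _ _ (hdiv.mono_set subset_union_left)).add (line _ _ (hdiv.mono_set subset_union_right)))
  · simp
  · intro s h0 h1
    simp
    exact ⟨h1, h0.le⟩
  · simp
  · intro s h0 h1
    simp
    exact ⟨h0.le, h1⟩

end schwartz

theorem tendsto_i0plus_bottom (u : SchwartzHalfLine) {x : ℝ} (hx : 0 < x) :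
    Tendsto (fun s => i0plus u.fn (x, s)) (𝓝[>] 0) (𝓝 (i0plus u.fn (x, 0))) := by
  have h1 := schwartzFamily_d.tendsto_regularizedIntegral u hx
  have e : i0plus u.fn (x, 0) = regularizedIntegral (u.d 0) (u.d 1) x 0 := by
    rw [i0plus, indicator_of_mem (Qpunct_of_pos_left hx le_rfl), if_neg (lt_irrefl _),
      regularizedIntegral, u.d_zero, u.d_one]
    simp only [phase_zero_right]
  rw [e]
  refine h1.congr' ?_
  filter_upwards [self_mem_nhdsWithin] with s hs
  rw [schwartzFamily_d.regularizedIntegral_eq u hx hs, u.d_zero, i0plus,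
    indicator_of_mem (Qpunct_of_pos_left hx (le_of_lt hs)), if_pos (show 0 < s from hs)]

theorem i1_of_pos {g : ℝ → ℂ} (hg : ContinuousOn g (Ici 0)) {p : ℝ × ℝ} (hp : p ∈ Q) :
    i1 g p = -Complex.I * timeConv 1 g p := by
  rw [i1, indicator_of_mem (Qpunct_of_pos_left hp.1 hp.2.le), if_pos hp.1, i1Interior_eq hg hp]

theorem tendsto_i1_left (g : SmoothHalfLine) {t : ℝ} (ht : 0 < t) :
    Tendsto (fun s => i1 g.fn (s, t)) (𝓝[>] 0) (𝓝 (i1 g.fn (0, t))) := by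
  have hp : ((0 : ℝ), t) ∈ Qpunct := Qpunct_of_pos_right le_rfl ht
  have hg := smoothFamily_d.cont g 0
  obtain ⟨c, hc⟩ := ((smoothFamily_d.controlledUpTo 1 1).const_mul (-Complex.I)).exists_limit g hp
  have h1 : Tendsto (i1Interior g.fn) (𝓝[Q] (0, t)) (𝓝 c) := by
    refine hc.congr' (EqOn.eventuallyEq_of_mem (fun p hp => ?_) self_mem_nhdsWithin)
    rw [g.d_zero] at hg ⊢
    exact (i1Interior_eq hg hp).symm
  have h2 := tendsto_extendFrom ⟨c, h1⟩
  have e : i1 g.fn (0, t) = extendFrom Q (i1Interior g.fn) (0, t) := by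
    rw [i1, indicator_of_mem hp, if_neg (lt_irrefl _)]
  rw [e]
  have h3 : Tendsto (fun s : ℝ => (s, t)) (𝓝[>] 0) (𝓝[Q] (0, t)) := by
    refine tendsto_nhdsWithin_iff.2 ⟨tendsto_id_nhdsGT.prodMk_nhds tendsto_const_nhds, ?_⟩
    filter_upwards [self_mem_nhdsWithin] with s hs using ⟨hs, ht⟩
  refine (h2.comp h3).congr' ?_
  filter_upwards [self_mem_nhdsWithin] with s hs
  rw [i1, indicator_of_mem (Qpunct_of_pos_left hs ht.le), if_pos (show 0 < s from hs)]
  rfl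

theorem tendsto_i1_bottom {g : ℝ → ℂ} (hg : ContinuousOn g (Ici 0)) {x : ℝ} (hx : 0 < x) :
    Tendsto (fun s => i1 g (x, s)) (𝓝[>] 0) (𝓝 (i1 g (x, 0))) := by
  have e : i1 g (x, 0) = 0 := by
    rw [i1, indicator_of_mem (Qpunct_of_pos_left hx le_rfl), if_pos hx]
    simp [i1Interior, gammaInt, tildeT]
  obtain ⟨C, hC, hb⟩ := heatK_bound' 1 (T := 1) hx
  obtain ⟨M, hM⟩ := isCompact_Icc.exists_bound_of_continuousOn
    (hg.mono (Icc_subset_Ici_self : Icc 0 (1 : ℝ) ⊆ Ici 0))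
  rw [e]
  have hlim : Tendsto (fun s : ℝ => C * s * M) (𝓝[>] 0) (𝓝 0) := by
    simpa using (tendsto_id_nhdsGT.const_mul C).mul_const M
  refine squeeze_zero_norm' ?_ hlim
  filter_upwards [Ioc_mem_nhdsGT zero_lt_one] with s hs
  rw [i1_of_pos hg (p := (x, s)) ⟨hx, hs.1⟩, norm_mul, norm_neg, Complex.norm_I]
  refine norm_timeConv_le (G := fun _ => C) hs.1.le zero_le_one
    (fun τ h0 h1 => hM τ ⟨h0, h1.trans hs.2⟩) (fun r h0 h1 => ?_) intervalIntegrable_const ?_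
  · rw [one_mul]
    exact hb x r (h1.trans hs.2) (Or.inl (le_abs_self x))
  · simp [mul_comm]

section source
variable {E : Type*} [AddCommGroup E] [Module ℂ E] [TopologicalSpace E]
  {F : E → ℕ → ℕ → ℝ × ℝ → ℂ} (h : SourceFamily F)
include h

theorem SourceFamily.i2plus_of_pos (e : E) {p : ℝ × ℝ} (hp : p ∈ Q) :
    i2plus (F e 0 0) p = duhamel 1 (F e 0 0) p := by
  obtain ⟨M, hM⟩ := h.decay_zero e p.2
  rw [i2plus, indicator_of_mem (Qpunct_of_pos_left hp.1 hp.2.le)]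
  simpa using (integral_phase_mul_tildeXT (h.meas e 0 0) hp.2.le hM (σ := 1) p.1).2

theorem SourceFamily.i2minus_of_pos (e : E) {p : ℝ × ℝ} (hp : p ∈ Q) :
    i2minus (F e 0 0) p = duhamel (-1) (F e 0 0) p := by
  obtain ⟨M, hM⟩ := h.decay_zero e p.2
  rw [i2minus, indicator_of_mem (Qpunct_of_pos_left hp.1 hp.2.le)]
  exact gammaInt_phase_mul_tildeXT (h.meas e 0 0) hp.2.le hM hp.1

theorem SourceFamily.tendsto_duhamel {σ : ℝ} (hσ : σ = 1 ∨ σ = -1) (e : E) {x : ℝ} (hx : 0 < x) :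
    Tendsto (fun s => duhamel σ (F e 0 0) (x, s)) (𝓝[>] 0) (𝓝 0) := by
  obtain ⟨C, -, hb⟩ := duhamel_bound hσ 0 1
  obtain ⟨q, -, hq⟩ := h.bound 0 0 0 1
  have hlim : Tendsto (fun s : ℝ => C * q e * s) (𝓝[>] 0) (𝓝 0) := by
    simpa using tendsto_id_nhdsGT.const_mul (C * q e)
  refine squeeze_zero_norm' ?_ hlim
  filter_upwards [Ioc_mem_nhdsGT zero_lt_one] with s hs
  simpa using hb (F e 0 0) (q e) (fun y τ hy => hq e y τ hy.le) x s hx.le hs.1.le hs.2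

theorem SourceFamily.tendsto_i2plus_bottom (e : E) {x : ℝ} (hx : 0 < x) :
    Tendsto (fun s => i2plus (F e 0 0) (x, s)) (𝓝[>] 0) (𝓝 (i2plus (F e 0 0) (x, 0))) := by
  have e0 : i2plus (F e 0 0) (x, 0) = 0 := by
    rw [i2plus, indicator_of_mem (Qpunct_of_pos_left hx le_rfl)]
    simp [tildeXT]
  rw [e0]
  refine (h.tendsto_duhamel (Or.inl rfl) e hx).congr' ?_
  filter_upwards [self_mem_nhdsWithin] with s hs
  exact (h.i2plus_of_pos e (p := (x, s)) ⟨hx, hs⟩).symm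

theorem SourceFamily.tendsto_i2minus_bottom (e : E) {x : ℝ} (hx : 0 < x) :
    Tendsto (fun s => i2minus (F e 0 0) (x, s)) (𝓝[>] 0) (𝓝 (i2minus (F e 0 0) (x, 0))) := by
  have e0 : i2minus (F e 0 0) (x, 0) = 0 := by
    rw [i2minus, indicator_of_mem (Qpunct_of_pos_left hx le_rfl)]
    simp [tildeXT, gammaInt]
  rw [e0]
  refine (h.tendsto_duhamel (Or.inr rfl) e hx).congr' ?_
  filter_upwards [self_mem_nhdsWithin] with s hs
  exact (h.i2minus_of_pos e (p := (x, s)) ⟨hx, hs⟩).symm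

theorem SourceFamily.tendsto_i2plus_left (e : E) {t : ℝ} (ht : 0 < t) :
    Tendsto (fun s => i2plus (F e 0 0) (s, t)) (𝓝[>] 0) (𝓝 (i2plus (F e 0 0) (0, t))) := by
  obtain ⟨M, hM⟩ := h.decay_zero e t
  have hi := (integral_phase_mul_tildeXT (h.meas e 0 0) ht.le hM (σ := 1) 0).1
  simp only [Complex.ofReal_one, one_mul] at hi
  have ev : ∀ s, 0 ≤ s → i2plus (F e 0 0) (s, t) =
      ∫ z : ℝ, phase s t z * tildeXT (F e 0 0) z ((z : ℂ) ^ 2) t := by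
    intro s hs
    rw [i2plus, indicator_of_mem (Qpunct_of_pos_right hs ht)]
  rw [ev 0 le_rfl]
  refine (tendsto_integral_phase (by fun_prop)
    (measurable_tildeXT (h.meas e 0 0) t (by fun_prop) (by fun_prop) ht.le).aestronglyMeasurable
    hi.norm tendsto_id_nhdsGT tendsto_const_nhds fun s _ => ae_of_all _ fun z => ?_).congr' ?_
  · rw [norm_mul, norm_mul, norm_phase_real, norm_phase_real]
  · filter_upwards [self_mem_nhdsWithin] with s hs
    exact (ev s (le_of_lt hs)).symm

theorem SourceFamily.tendsto_i2minus_left (e : E) {t : ℝ} (ht : 0 < t) :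
    Tendsto (fun s => i2minus (F e 0 0) (s, t)) (𝓝[>] 0) (𝓝 (i2minus (F e 0 0) (0, t))) := by
  obtain ⟨C, hC⟩ := h.norm_phase_mul_tildeXT_le e ht.le
  have ev : ∀ s, 0 ≤ s → i2minus (F e 0 0) (s, t) =
      gammaInt 0 fun z => phase s t z * tildeXT (F e 0 0) (-z) (z ^ 2) t := by
    intro s hs
    rw [i2minus, indicator_of_mem (Qpunct_of_pos_right hs ht)]
  have key : ∀ (ε : ℝ) (d : ℂ), IsRay ε d → Tendsto (fun s : ℝ => ∫ r : ℝ in Ioi 0,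
      phase s t (r * d) * tildeXT (F e 0 0) (-(r * d)) ((r * d) ^ 2) t * d) (𝓝[>] 0)
      (𝓝 (∫ r : ℝ in Ioi 0,
        phase 0 t (r * d) * tildeXT (F e 0 0) (-(r * d)) ((r * d) ^ 2) t * d)) := by
    intro ε d hd
    simp only [integral_mul_const]
    refine Tendsto.mul_const _ (tendsto_integral_phase (by fun_prop)
      (measurable_tildeXT (h.meas e 0 0) t (by fun_prop) (by fun_prop) ht.le).aestronglyMeasurable
      (integrable_inv_one_add_sq.const_mul C).integrableOn tendsto_id_nhdsGT tendsto_const_nhds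
      fun s hs => ?_)
    filter_upwards [ae_restrict_mem measurableSet_Ioi] with r hr
    exact hC ε d hd s r hs.le hr
  rw [ev 0 le_rfl]
  refine ((key _ _ isRay_dirOut).sub (key _ _ isRay_dirIn)).congr' ?_
  filter_upwards [self_mem_nhdsWithin] with s hs
  exact (ev s (le_of_lt hs)).symm

end source

/-! ### The component operators as continuous linear maps -/

/-- The values on the edges are limits from within `Q`. -/
theorem S1.eq_of_eqOn {a b : S1 punctured} (h : EqOn a.fn b.fn Q) : a = b := by
  refine Subtype.ext (funext fun p => ?_)
  by_cases hp : p ∈ Qpunct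
  · have := neBot_Q hp.1
    exact tendsto_nhds_unique (a.2.1.value p hp)
      ((b.2.1.value p hp).congr' (h.symm.eventuallyEq_of_mem self_mem_nhdsWithin))
  · exact (a.2.1.zero_off p hp).trans (b.2.1.zero_off p hp).symm

/-- An operator that is given in `Q` by a linear operator controlled to all orders, and on the edges
by the limits from within `Q`, is a continuous linear map into `S_1(Qpunct)`. -/
theorem exists_continuous_linearMap {E : Type*} [AddCommGroup E] [Module ℂ E] [TopologicalSpace E]
    [IsTopologicalAddGroup E] {T h : E → ℝ × ℝ → ℂ} (hT : ∀ m, ControlledUpTo m T)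
    (hlin : ∀ (c : ℂ) (e e' : E), ∀ p ∈ Q, T (c • e + e') p = c * T e p + T e' p)
    (hQ : ∀ e, EqOn (h e) (T e) Q) (off : ∀ e p, p ∉ Qpunct → h e p = 0)
    (left : ∀ e t, 0 < t → Tendsto (fun s => h e (s, t)) (𝓝[>] 0) (𝓝 (h e (0, t))))
    (bottom : ∀ e x, 0 < x → Tendsto (fun s => h e (x, s)) (𝓝[>] 0) (𝓝 (h e (x, 0)))) :
    ∃ L : E →ₗ[ℂ] S1 punctured, Continuous L ∧ ∀ e, (L e).fn = h e := by
  have bd := fun n => exists_seminorm_of_controlled hT hQ n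
  have mem : ∀ e, h e ∈ s1Submodule punctured := fun e =>
    ⟨isSmoothUpTo_of_controlled hT (hQ e) (off e) (tendsto_value (hT 1) (hQ e) (left e) (bottom e)),
      fun n => by
        obtain ⟨q, -, hq⟩ := bd n
        exact ⟨q e, hq e⟩⟩
  have h0 : ∀ p ∈ Q, T 0 p = 0 := by
    intro p hp
    have := hlin 1 0 0 p hp
    rwa [smul_zero, add_zero, one_mul, left_eq_add] at this
  let L : E →ₗ[ℂ] S1 punctured :=
    { toFun := fun e => ⟨h e, mem e⟩
      map_add' := fun a b => S1.eq_of_eqOn fun p hp => by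
        show h (a + b) p = h a p + h b p
        rw [hQ _ hp, hQ _ hp, hQ _ hp]
        simpa using hlin 1 a b p hp
      map_smul' := fun c a => S1.eq_of_eqOn fun p hp => by
        show h (c • a) p = c * h a p
        rw [hQ _ hp, hQ _ hp]
        simpa [h0 p hp] using hlin c a 0 p hp }
  refine ⟨L, (withSeminorms_s1 punctured).continuous_of_continuous_comp L fun n => ?_, fun e => rfl⟩
  obtain ⟨q, hqc, hq⟩ := bd n
  exact Seminorm.continuous_of_le hqc fun e => Real.sSup_le (hq e) (apply_nonneg q e)

theorem halfConv_lin (σ : ℝ) (k : ℕ) {u v : ℝ → ℂ} (hu : IntegrableOn u (Ioi 0))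
    (hv : IntegrableOn v (Ioi 0)) (c : ℂ) (p : ℝ × ℝ) :
    halfConv σ k (c • u + v) p = c * halfConv σ k u p + halfConv σ k v p := by
  rw [halfConv, halfConv, halfConv, ← integral_const_mul,
    ← integral_add ((integrableOn_heatK_mul σ k _ _ hu).const_mul c)
      (integrableOn_heatK_mul σ k _ _ hv)]
  congr 1; funext y
  simp only [Pi.add_apply, Pi.smul_apply, smul_eq_mul]
  ring

theorem timeConv_lin (k : ℕ) {g g' : ℝ → ℂ} (hg : ContinuousOn g (Ici 0))
    (hg' : ContinuousOn g' (Ici 0)) (c : ℂ) {p : ℝ × ℝ} (hp : p ∈ Q) :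
    timeConv k (c • g + g') p = c * timeConv k g p + timeConv k g' p := by
  rw [timeConv, timeConv, timeConv, ← intervalIntegral.integral_const_mul,
    ← intervalIntegral.integral_add
      ((intervalIntegrable_heatK_mul hp.1.ne' hg _ hp.2.le).const_mul c)
      (intervalIntegrable_heatK_mul hp.1.ne' hg' _ hp.2.le)]
  congr 1; funext τ
  simp only [Pi.add_apply, Pi.smul_apply, smul_eq_mul]
  ring

theorem SourceFamily.intervalIntegrable_halfConv {E : Type*} [AddCommGroup E] [Module ℂ E]
    [TopologicalSpace E] {F : E → ℕ → ℕ → ℝ × ℝ → ℂ} (h : SourceFamily F) {σ : ℝ}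
    (hσ : σ = 1 ∨ σ = -1) (e : E) {p : ℝ × ℝ} (hp : p ∈ Q) :
    IntervalIntegrable (fun τ => halfConv σ 0 (fun y => F e 0 0 (y, τ)) (p.1, p.2 - τ)) volume
      0 p.2 := by
  obtain ⟨C, -, hb⟩ := halfConv_zero_bound hσ 0 p.2
  obtain ⟨q, -, hq⟩ := h.bound 0 0 0 p.2
  rw [intervalIntegrable_iff_integrableOn_Ioc_of_le hp.2.le]
  have hc : IntegrableOn (fun _ : ℝ => C * q e) (Ioc 0 p.2) := integrableOn_const (by simp)
  refine hc.mono' (measurable_halfConv σ 0 (h.meas e 0 0) measurable_id (by fun_prop)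
    p.1).aestronglyMeasurable ?_
  filter_upwards [ae_restrict_mem measurableSet_Ioc] with τ hτ
  simpa using hb (fun y => F e 0 0 (y, τ)) (q e) (fun y hy => hq e y τ hy.le hτ.1.le hτ.2) p.1
    (p.2 - τ) hp.1.le (by linarith [hτ.1])

theorem duhamel_d_lin {σ : ℝ} (hσ : σ = 1 ∨ σ = -1) (c : ℂ) (f f' : S1 closedQuarter) {p : ℝ × ℝ}
    (hp : p ∈ Q) : duhamel σ ((c • f + f').d 0 0) p =
      c * duhamel σ (f.d 0 0) p + duhamel σ (f'.d 0 0) p := by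
  rw [duhamel, duhamel, duhamel, ← intervalIntegral.integral_const_mul,
    ← intervalIntegral.integral_add
      ((sourceFamily_d.intervalIntegrable_halfConv hσ f hp).const_mul c)
      (sourceFamily_d.intervalIntegrable_halfConv hσ f' hp)]
  refine intervalIntegral.integral_congr fun τ hτ => ?_
  rw [uIcc_of_le hp.2.le] at hτ
  have hi : ∀ f : S1 closedQuarter, IntegrableOn (fun y => f.d 0 0 (y, τ)) (Ioi 0) := by
    intro f
    obtain ⟨M, hM⟩ := sourceFamily_d.decay_zero f p.2
    exact (integrableOn_slice (sourceFamily_d.meas f 0 0) hM hτ.1 hτ.2).1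
  rw [← halfConv_lin σ 0 (hi f) (hi f')]
  simp only [S1.d_zero]
  rfl

theorem exists_i0plus : ∃ L : SchwartzHalfLine →ₗ[ℂ] S1 punctured, Continuous L ∧
    ∀ u, (L u).fn = i0plus u.fn := by
  refine exists_continuous_linearMap (T := fun u : SchwartzHalfLine => halfConv 1 0 (u.d 0))
    (fun m => schwartzFamily_d.controlledUpTo (Or.inl rfl) m 0) (fun c u v p _ => ?_)
    (fun u p hp => ?_) (fun u p hp => indicator_of_notMem hp _)
    (fun u t ht => tendsto_i0plus_left ?_ ht) (fun u x hx => tendsto_i0plus_bottom u hx)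
  · rw [← halfConv_lin _ _ (schwartzFamily_d.integrableOn u 0) (schwartzFamily_d.integrableOn v 0)]
    simp only [SchwartzHalfLine.d_zero]
    rfl
  · rw [u.d_zero]
    exact i0plus_of_pos (u.d_zero ▸ schwartzFamily_d.integrableOn u 0) hp.1.le hp.2
  · exact u.d_zero ▸ schwartzFamily_d.integrableOn u 0

theorem exists_i0minus : ∃ L : SchwartzHalfLine →ₗ[ℂ] S1 punctured, Continuous L ∧
    ∀ u, (L u).fn = i0minus u.fn := by
  refine exists_continuous_linearMap (T := fun u : SchwartzHalfLine => halfConv (-1) 0 (u.d 0))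
    (fun m => schwartzFamily_d.controlledUpTo (Or.inr rfl) m 0) (fun c u v p _ => ?_)
    (fun u p hp => ?_) (fun u p hp => indicator_of_notMem hp _)
    (fun u t ht => tendsto_i0minus_left ?_ ht) (fun u x hx => tendsto_i0minus_bottom ?_ hx)
  · rw [← halfConv_lin _ _ (schwartzFamily_d.integrableOn u 0) (schwartzFamily_d.integrableOn v 0)]
    simp only [SchwartzHalfLine.d_zero]
    rfl
  · rw [u.d_zero]
    exact i0minus_of_pos (u.d_zero ▸ schwartzFamily_d.integrableOn u 0) hp.1.le hp.2
  · exact u.d_zero ▸ schwartzFamily_d.integrableOn u 0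
  · exact u.d_zero ▸ schwartzFamily_d.integrableOn u 0

theorem exists_i1 : ∃ L : SmoothHalfLine →ₗ[ℂ] S1 punctured, Continuous L ∧
    ∀ g, (L g).fn = i1 g.fn := by
  refine exists_continuous_linearMap
    (T := fun (g : SmoothHalfLine) p => -Complex.I * timeConv 1 (g.d 0) p)
    (fun m => (smoothFamily_d.controlledUpTo m 1).const_mul _) (fun c g g' p hp => ?_)
    (fun g p hp => ?_) (fun g p hp => indicator_of_notMem hp _)
    (fun g t ht => tendsto_i1_left g ht) (fun g x hx => tendsto_i1_bottom ?_ hx)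
  · have e : timeConv 1 ((c • g + g').d 0) p =
        c * timeConv 1 (g.d 0) p + timeConv 1 (g'.d 0) p := by
      rw [← timeConv_lin _ (smoothFamily_d.cont g 0) (smoothFamily_d.cont g' 0) c hp]
      simp only [SmoothHalfLine.d_zero]
      rfl
    rw [e]; ring
  · dsimp only
    rw [g.d_zero]
    exact i1_of_pos (g.d_zero ▸ smoothFamily_d.cont g 0) hp
  · exact g.d_zero ▸ smoothFamily_d.cont g 0

theorem exists_i2plus : ∃ L : S1 closedQuarter →ₗ[ℂ] S1 punctured, Continuous L ∧
    ∀ f, (L f).fn = i2plus f.fn := by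
  refine exists_continuous_linearMap (T := fun f : S1 closedQuarter => duhamel 1 (f.d 0 0))
    (fun m => sourceFamily_d.controlledUpTo (Or.inl rfl) m 0 0)
    (fun c f f' p hp => duhamel_d_lin (Or.inl rfl) c f f' hp)
    (fun f p hp => ?_) (fun f p hp => indicator_of_notMem hp _) (fun f t ht => ?_)
    (fun f x hx => ?_)
  all_goals rw [← f.d_zero]
  · exact sourceFamily_d.i2plus_of_pos f hp
  · exact sourceFamily_d.tendsto_i2plus_left f ht
  · exact sourceFamily_d.tendsto_i2plus_bottom f hx

theorem exists_i2minus : ∃ L : S1 closedQuarter →ₗ[ℂ] S1 punctured, Continuous L ∧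
    ∀ f, (L f).fn = i2minus f.fn := by
  refine exists_continuous_linearMap (T := fun f : S1 closedQuarter => duhamel (-1) (f.d 0 0))
    (fun m => sourceFamily_d.controlledUpTo (Or.inr rfl) m 0 0)
    (fun c f f' p hp => duhamel_d_lin (Or.inr rfl) c f f' hp)
    (fun f p hp => ?_) (fun f p hp => indicator_of_notMem hp _) (fun f t ht => ?_)
    (fun f x hx => ?_)
  all_goals rw [← f.d_zero]
  · exact sourceFamily_d.i2minus_of_pos f hp
  · exact sourceFamily_d.tendsto_i2minus_left f ht
  · exact sourceFamily_d.tendsto_i2minus_bottom f hx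

end

end UTM

theorem mainTheorem1 :
    (∀ u : UTM.SchwartzHalfLine, UTM.I0plusConverges u.fn ∧ UTM.I0minusConverges u.fn) ∧
    (∀ g : UTM.SmoothHalfLine, UTM.I1Converges g.fn) ∧
    (∀ f : UTM.S1 UTM.closedQuarter, UTM.I2Converges f.fn) ∧
    ∃ (I0p I0m : UTM.SchwartzHalfLine → UTM.S1 UTM.punctured)
      (I1 : UTM.SmoothHalfLine → UTM.S1 UTM.punctured)
      (I2p I2m : UTM.S1 UTM.closedQuarter → UTM.S1 UTM.punctured)
      (Φ : UTM.SchwartzHalfLine × UTM.SmoothHalfLine × UTM.S1 UTM.closedQuarter →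
        UTM.S1 UTM.punctured),
      (∀ u, (I0p u).fn = UTM.i0plus u.fn) ∧
      (∀ u, (I0m u).fn = UTM.i0minus u.fn) ∧
      (∀ g, (I1 g).fn = UTM.i1 g.fn) ∧
      (∀ f, (I2p f).fn = UTM.i2plus f.fn) ∧
      (∀ f, (I2m f).fn = UTM.i2minus f.fn) ∧
      (∀ u g f, (2 * Real.pi : ℂ) • Φ (u, g, f) =
        I0p u - I0m u - (2 * Complex.I) • I1 g + I2p f - I2m f) ∧
      Continuous Φ := by
  obtain ⟨A, hA, eA⟩ := UTM.exists_i0plus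
  obtain ⟨B, hB, eB⟩ := UTM.exists_i0minus
  obtain ⟨G, hG, eG⟩ := UTM.exists_i1
  obtain ⟨P, hP, eP⟩ := UTM.exists_i2plus
  obtain ⟨M, hM, eM⟩ := UTM.exists_i2minus
  have := (UTM.withSeminorms_s1 UTM.punctured).continuousSMul
  refine ⟨fun u => ⟨UTM.i0plusConverges u, UTM.i0minusConverges u⟩, UTM.i1Converges,
    UTM.i2Converges, A, B, G, P, M, fun d => (2 * Real.pi : ℂ)⁻¹ •
      (A d.1 - B d.1 - (2 * Complex.I) • G d.2.1 + P d.2.2 - M d.2.2),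
    eA, eB, eG, eP, eM, fun u g f => ?_, ?_⟩
  · rw [smul_inv_smul₀]
    exact mul_ne_zero two_ne_zero (Complex.ofReal_ne_zero.2 Real.pi_ne_zero)
  · have hg : Continuous fun d : UTM.SchwartzHalfLine × UTM.SmoothHalfLine ×
        UTM.S1 UTM.closedQuarter => G d.2.1 := hG.comp (continuous_fst.comp continuous_snd)
    have hf := continuous_snd.comp (continuous_snd (X := UTM.SchwartzHalfLine)
      (Y := UTM.SmoothHalfLine × UTM.S1 UTM.closedQuarter))
    exact (((((hA.comp continuous_fst).sub (hB.comp continuous_fst)).sub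
      (hg.const_smul (2 * Complex.I))).add (hP.comp hf)).sub (hM.comp hf)).const_smul (2 * Real.pi : ℂ)⁻¹
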